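/- Let $K$ be a field of characteristic $0$, complete for a non-archimedean absolute value $|\cdot|$ with $|p|<1$ for a prime $p$. For an interval $I\subset\,]0,\infty[$ let $\mathcal A_K(I)$ be the ring of Laurent series $f=\sum_{i\in\mathbb Z}a_iT^i$, $a_i\in K$, with $|a_i|\rho^i\to0$ as $i\to\pm\infty$ for all $\rho\in I$, and put $|f|_\rho=\sup_i|a_i|\rho^i$. Let $B$ be either the Robba ring $\mathcal R_K=\bigcup_{0<\varepsilon<1}\mathcal A_K(I_\varepsilon)$, $I_\varepsilon=\,]1-\varepsilon,1[$, or $\mathcal H_K^\dagger=\bigcup_{0<\varepsilon<1}\mathcal A_K(I_\varepsilon)$, $I_\varepsilon=\,]1-\varepsilon,1+\varepsilon[$. For $|q|=1$ let $\sigma_q(f)(T)=f(qT)$; let $\delta_1=T\frac{d}{dT}$, and $D^-(1,r)=\{q\in K: |q-1|<r\}$. **Modules.** For $S\subseteq\{q\in K:|q|=1\}$, an object of $\sigma\text{-Mod}(B)_S$ is a finite free $B$-module $M$ with a group morphism $q\mapsto\sigma_q^M$ from the group $\langle S\rangle$ generated by $S$ to $\mathrm{Aut}(M)$ such that $\sigma_q^M$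 is $\sigma_q$-semilinear for all $q\in S$; morphisms are the $B$-linear maps commuting with all $\sigma_q$, $q\in S$. An object of $(\sigma,\delta)\text{-Mod}(B)_S$ carries in addition an additive map $\delta_1^M$ with $\delta_1^M(fm)=\delta_1(f)m+f\delta_1^M(m)$, with which morphisms commute. For $S=\{q\}$ write $\sigma_q\text{-Mod}(B)$ and $(\sigma_q,\delta_q)\text{-Mod}(B)$; for $q=1$ the latter is the category $\delta_1\text{-Mod}(B)$ of differential modules. In a basis $(e_i)$ write $\sigma_q^M(e_i)=\sum_ja_{ij}e_j$, $A(q,T)=(a_{ij})$, and $\delta_1^M(e_i)=\sum_jg_{ij}e_j$, $G=(g_{ij})$. **Taylor solutions and radius.** Put $d_q=\frac{\sigma_q-1}{(q-1)T}$, $[n]_q^!=\prod_{i=1}^n(1+q+\dots+q^{i-1})$, $(x-y)_{q,n}=\prod_{m<n}(x-q^my)$. Let $H_n$ and $G_{[n]}$ be the matrices with $d_q^nY=H_nY$ whenever $\sigma_q(Y)=A(q,T)Y$, and $(\frac{d}{dT})^nY=G_{[n]}Y$ whenever $\delta_1(Y)=GY$. The Taylor solutions are $Y_{A(q,T)}(x,y)=\sum_nH_n(y)\frac{(x-y)_{q,n}}{[n]_q^!}$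 ($q$ not a root of unity) and $Y_G(x,y)=\sum_nG_{[n]}(y)\frac{(x-y)^n}{n!}$. The generic radius $Ray(M,\rho)$ is the minimum of $\rho$ and $\liminf_n(|H_n|_\rho/|[n]_q^!|)^{-1/n}$ for a $\sigma_q$-module, respectively of $\rho$ and $\liminf_n(|G_{[n]}|_\rho/|n!|)^{-1/n}$ for a $(\sigma_q,\delta_q)$-module. Identities between functions of $x$ near $y=t_\rho$, where $t_\rho$ is a generic point with $|f(t_\rho)|=|f|_\rho$, are understood as identities of the expansions in powers of $x-y$, all the series of coefficients being convergent for $|\cdot|_\rho$. **The categories $[r]$.** Let $0<r\le1$, $|q-1|<r$. For $q$ not a root of unity, $\sigma_q\text{-Mod}(B)^{[r]}$ is the full subcategory of $\sigma_q\text{-Mod}(B)$ of the $M$ such that, if $B=\mathcal R_K$, $\lim_{\rho\to1^-}Ray(M,\rho)$ exists and is $\ge r$, and $Ray(M,\rho)>|q-1|$ for all $\rho<1$ close to $1$; and, if $B=\mathcal H_K^\dagger$, $Ray(M,1)\ge r$. For any $q$ (roots of unity and $q=1$ included), $(\sigma_q,\delta_q)\text{-Mod}(B)^{[r]}$ is the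 full subcategory of $(\sigma_q,\delta_q)\text{-Mod}(B)$ of the $M$ whose radius satisfies the same conditions and for which $Y_G$ also solves the $q$-difference equation, $Y_G(qx,t_\rho)=A(q,x)Y_G(x,t_\rho)$ for all $\rho$ in some $I_\varepsilon$. With $D=D^-(1,r)$, $\sigma\text{-Mod}(B)_D^{[r]}$ is the full subcategory of $\sigma\text{-Mod}(B)_D$ of the $M$ such that (i) the restriction of $M$ to every $q\in D$ which is not a root of unity is in $\sigma_q\text{-Mod}(B)^{[r]}$, and (ii) for every $0<\tau<r$ there are $\varepsilon\in\,]0,1[$ and a basis in which $A(q,T)$ has entries in $\mathcal A_K(I_\varepsilon)$ for all $q\in D^-(1,\tau)$, and, for $\rho\in I_\varepsilon$, the $Y_{A(q,T)}(x,t_\rho)$ with $q\in D^-(1,\tau)$ not a root of unity are all equal to one function, which also solves the equations given by the roots of unity in $D^-(1,\tau)$. The category $(\sigma,\delta)\text{-Mod}(B)_D^{[r]}$ is defined in the same way: (i) for all $q\in D$, and in (ii) $G$ too has entries in $\mathcal A_K(I_\varepsilon)$ and $Y_G(x,t_\rho)$ solves the $q$-difference equation for all $q\in D^-(1,\tau)$.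 **Statement.** For $B=\mathcal R_K$ and for $B=\mathcal H_K^\dagger$, and every real $r\le1$: 1. If $q,q'$ are not roots of unity (equivalently, not of $p$-power order) and $\max(|q-1|,|q'-1|)<r$, then the restriction functor $\mathrm{Res}_q:\sigma\text{-Mod}(B)^{[r]}_{D}\to\sigma_q\text{-Mod}(B)^{[r]}$ is an equivalence, and so is the deformation functor $$\mathrm{Def}^{\mathrm{Tay}}_{q,q'}=\mathrm{Res}_{q'}\circ(\mathrm{Res}_q)^{-1}:\ \sigma_q\text{-Mod}(B)^{[r]}\to\sigma_{q'}\text{-Mod}(B)^{[r]}.$$ 2. For arbitrary $q,q'$ (possibly roots of unity, possibly $1$) with $\max(|q-1|,|q'-1|)<r$, the restriction functor $\mathrm{Res}_q:(\sigma,\delta)\text{-Mod}(B)^{[r]}_{D}\to(\sigma_q,\delta_q)\text{-Mod}(B)^{[r]}$ is an equivalence, and so is $$\mathrm{Def}^{\mathrm{Tay}}_{q,q'}=\mathrm{Res}_{q'}\circ(\mathrm{Res}_q)^{-1}:\ (\sigma_q,\delta_q)\text{-Mod}(B)^{[r]}\to(\sigma_{q'},\delta_{q'})\text{-Mod}(B)^{[r]}.$$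 3. If $q$ is not a root of unity and $|q-1|<r$, then forgetting $\delta_q$ sends $(\sigma_q,\delta_q)\text{-Mod}(B)^{[r]}$ into $\sigma_q\text{-Mod}(B)^{[r]}$ and is an equivalence between them; hence so is the confluence functor $$\mathrm{Conf}^{\mathrm{Tay}}_q=\mathrm{Def}^{\mathrm{Tay}}_{q,1}\circ(\mathrm{Forget}\ \delta_q)^{-1}:\ \sigma_q\text{-Mod}(B)^{[r]}\to\delta_1\text{-Mod}(B)^{[r]}.$$ -/

import Mathlib

open Filter Topology CategoryTheory
open scoped ENNReal

universe u

set_option linter.unusedSectionVars false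

namespace QConf

/-! ### The base rings `𝓡_K` and `𝓗†_K` as rings of Laurent series -/

/-- The two kinds of base ring: the Robba ring `𝓡_K` and the ring `𝓗†_K` of overconvergent
analytic functions on `|T| = 1`. -/
inductive Base : Type
  | robba
  | dagger

/-- The interval `I_ε`: `]1-ε, 1[` for the Robba ring and `]1-ε, 1+ε[` for `𝓗†_K`. -/
def Base.I : Base → ℝ → Set ℝ
  | .robba, ε => Set.Ioo (1 - ε) 1
  | .dagger, ε => Set.Ioo (1 - ε) (1 + ε)

theorem Base.I_mono (B : Base) {ε ε' : ℝ} (h : ε ≤ ε') : B.I ε ⊆ B.I ε' := by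
  cases B
  · exact Set.Ioo_subset_Ioo (by linarith) le_rfl
  · exact Set.Ioo_subset_Ioo (by linarith) (by linarith)

theorem Base.pos_of_mem (B : Base) {ε ρ : ℝ} (h1 : ε < 1) (h : ρ ∈ B.I ε) : 0 < ρ := by
  cases B <;> exact lt_trans (by linarith) h.1

theorem Base.nonempty_I (B : Base) {ε : ℝ} (h0 : 0 < ε) : (B.I ε).Nonempty := by
  cases B
  · exact Set.nonempty_Ioo.2 (by linarith)
  · exact Set.nonempty_Ioo.2 (by linarith)

/-- The Laurent series `∑ aᵢ Tⁱ` satisfies `|aᵢ| ρⁱ → 0` as `i → ±∞`. -/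
def ConvAt {K : Type u} [NormedField K] (ρ : ℝ) (a : ℤ → K) : Prop :=
  Tendsto (fun i : ℤ => ‖a i‖ * ρ ^ i) cofinite (𝓝 0)

section ConvLemmas

variable {K : Type u} [NormedField K] {ρ : ℝ}

theorem ConvAt.zero : ConvAt ρ (0 : ℤ → K) := by
  simp [ConvAt]

theorem ConvAt.of_le (hρ : 0 < ρ) {a b : ℤ → K} (ha : ConvAt ρ a) (h : ∀ i, ‖b i‖ ≤ ‖a i‖) :
    ConvAt ρ b := by
  refine squeeze_zero (fun i => by positivity) (fun i => ?_) ha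
  exact mul_le_mul_of_nonneg_right (h i) (by positivity)

theorem ConvAt.neg {a : ℤ → K} (ha : ConvAt ρ a) : ConvAt ρ (-a) := by
  simpa [ConvAt] using ha

theorem ConvAt.add (hρ : 0 < ρ) {a b : ℤ → K} (ha : ConvAt ρ a) (hb : ConvAt ρ b) :
    ConvAt ρ (a + b) := by
  have h := Tendsto.add ha hb
  rw [add_zero] at h
  refine squeeze_zero (fun i => by positivity) (fun i => ?_) h
  rw [← add_mul]
  exact mul_le_mul_of_nonneg_right (norm_add_le _ _) (by positivity)

theorem ConvAt.single (k : ℤ) (c : K) : ConvAt ρ (Pi.single k c : ℤ → K) := by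
  refine tendsto_const_nhds.congr' ?_
  have : ∀ᶠ i : ℤ in cofinite, i ≠ k :=
    (Set.finite_singleton k).compl_mem_cofinite
  filter_upwards [this] with i hi
  simp [hi]

/-- The coefficients of the product of two Laurent series. -/
noncomputable def conv (a b : ℤ → K) : ℤ → K := fun k => ∑' i, a i * b (k - i)

theorem ConvAt.bdd {a : ℤ → K} (ha : ConvAt ρ a) :
    ∃ C : ℝ, 0 ≤ C ∧ ∀ i, ‖a i‖ * ρ ^ i ≤ C := by
  have h1 : ∀ᶠ i : ℤ in cofinite, ‖a i‖ * ρ ^ i < 1 := ha.eventually_lt_const one_pos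
  have hfin : {i : ℤ | ¬ ‖a i‖ * ρ ^ i < 1}.Finite := h1
  obtain ⟨C, hC⟩ := (hfin.image (fun i => ‖a i‖ * ρ ^ i)).bddAbove
  refine ⟨max C 1, by positivity, fun i => ?_⟩
  by_cases hi : ‖a i‖ * ρ ^ i < 1
  · exact hi.le.trans (le_max_right _ _)
  · exact (hC ⟨i, hi, rfl⟩).trans (le_max_left _ _)

theorem ConvAt.mul_cofinite {a b : ℤ → K} (ha : ConvAt ρ a) (hb : ConvAt ρ b) :
    Tendsto (fun x : ℤ × ℤ => (‖a x.1‖ * ρ ^ x.1) * (‖b x.2‖ * ρ ^ x.2)) cofinite (𝓝 0) :=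
  tendsto_mul_cofinite_nhds_zero ha hb

variable [CompleteSpace K] [IsUltrametricDist K]

theorem summable_triple (hρ : 0 < ρ) {a b c : ℤ → K} (ha : ConvAt ρ a) (hb : ConvAt ρ b)
    (hc : ConvAt ρ c) (k : ℤ) :
    Summable (fun x : ℤ × ℤ => a x.1 * b x.2 * c (k - x.1 - x.2)) := by
  apply NonarchimedeanAddGroup.summable_of_tendsto_cofinite_zero
  obtain ⟨C, hC0, hC⟩ := hc.bdd
  rw [tendsto_zero_iff_norm_tendsto_zero]
  have h := (ha.mul_cofinite hb).mul_const (C * ρ ^ (-k))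
  rw [zero_mul] at h
  refine squeeze_zero (fun _ => norm_nonneg _) (fun x => ?_) h
  have h1 := hC (k - x.1 - x.2)
  have e : ‖a x.1 * b x.2 * c (k - x.1 - x.2)‖ =
      ((‖a x.1‖ * ρ ^ x.1) * (‖b x.2‖ * ρ ^ x.2)) *
        ((‖c (k - x.1 - x.2)‖ * ρ ^ (k - x.1 - x.2)) * ρ ^ (-k)) := by
    have : ρ ^ x.1 * ρ ^ x.2 * (ρ ^ (k - x.1 - x.2) * ρ ^ (-k)) = 1 := by
      rw [← zpow_add₀ hρ.ne', ← zpow_add₀ hρ.ne', ← zpow_add₀ hρ.ne']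
      ring_nf
      simp
    rw [norm_mul, norm_mul]
    linear_combination (-(‖a x.1‖ * ‖b x.2‖ * ‖c (k - x.1 - x.2)‖)) * this
  rw [e]
  gcongr

theorem summable_conv (hρ : 0 < ρ) {a b : ℤ → K} (ha : ConvAt ρ a) (hb : ConvAt ρ b) (k : ℤ) :
    Summable (fun i => a i * b (k - i)) := by
  apply NonarchimedeanAddGroup.summable_of_tendsto_cofinite_zero
  obtain ⟨C, hC0, hC⟩ := hb.bdd
  rw [tendsto_zero_iff_norm_tendsto_zero]
  have h := Tendsto.mul_const (C * ρ ^ (-k)) ha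
  rw [zero_mul] at h
  refine squeeze_zero (fun _ => norm_nonneg _) (fun i => ?_) h
  have h1 := hC (k - i)
  have e : ‖a i * b (k - i)‖ =
      (‖a i‖ * ρ ^ i) * ((‖b (k - i)‖ * ρ ^ (k - i)) * ρ ^ (-k)) := by
    have : ρ ^ i * (ρ ^ (k - i) * ρ ^ (-k)) = 1 := by
      rw [← zpow_add₀ hρ.ne', ← zpow_add₀ hρ.ne']
      ring_nf
      simp
    rw [norm_mul]
    linear_combination (-(‖a i‖ * ‖b (k - i)‖)) * this
  rw [e]
  gcongr

theorem norm_tsum_le_of_forall {ι : Type*} {f : ι → K} {C : ℝ} (hC : 0 ≤ C)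
    (h : ∀ i, ‖f i‖ ≤ C) : ‖∑' i, f i‖ ≤ C := by
  by_cases hf : Summable f
  · refine le_of_tendsto hf.hasSum.norm (Eventually.of_forall fun s => ?_)
    exact IsUltrametricDist.norm_sum_le_of_forall_le_of_nonneg hC fun i _ => h i
  · simpa [tsum_eq_zero_of_not_summable hf] using hC

theorem ConvAt.conv (hρ : 0 < ρ) {a b : ℤ → K} (ha : ConvAt ρ a) (hb : ConvAt ρ b) :
    ConvAt ρ (conv a b) := by
  have h := ha.mul_cofinite hb
  rw [ConvAt, Metric.tendsto_nhds]
  intro η hη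
  have h1 : ∀ᶠ x : ℤ × ℤ in cofinite,
      (‖a x.1‖ * ρ ^ x.1) * (‖b x.2‖ * ρ ^ x.2) < η / 2 :=
    h.eventually_lt_const (by positivity)
  have hfin := Set.Finite.image (fun x : ℤ × ℤ => x.1 + x.2) (show Set.Finite _ from h1)
  have h2 : ∀ᶠ k : ℤ in cofinite, k ∉ (fun x : ℤ × ℤ => x.1 + x.2) ''
      {x | ¬ (‖a x.1‖ * ρ ^ x.1) * (‖b x.2‖ * ρ ^ x.2) < η / 2} :=
    hfin.compl_mem_cofinite
  filter_upwards [h2] with k hk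
  rw [Real.dist_0_eq_abs, abs_of_nonneg (by positivity)]
  have hb' : ‖QConf.conv a b k‖ ≤ η / 2 * ρ ^ (-k) := by
    refine norm_tsum_le_of_forall (by positivity) fun i => ?_
    have hlt : (‖a i‖ * ρ ^ i) * (‖b (k - i)‖ * ρ ^ (k - i)) < η / 2 := by
      by_contra hcon
      exact hk ⟨(i, k - i), hcon, by simp⟩
    have e : ‖a i * b (k - i)‖ =
        ((‖a i‖ * ρ ^ i) * (‖b (k - i)‖ * ρ ^ (k - i))) * ρ ^ (-k) := by
      have : ρ ^ i * ρ ^ (k - i) * ρ ^ (-k) = 1 := by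
        rw [← zpow_add₀ hρ.ne', ← zpow_add₀ hρ.ne']
        ring_nf
        simp
      rw [norm_mul]
      linear_combination (-(‖a i‖ * ‖b (k - i)‖)) * this
    rw [e]
    exact mul_le_mul_of_nonneg_right hlt.le (by positivity)
  calc ‖QConf.conv a b k‖ * ρ ^ k ≤ η / 2 * ρ ^ (-k) * ρ ^ k := by gcongr
    _ = η / 2 := by rw [mul_assoc, ← zpow_add₀ hρ.ne']; simp
    _ < η := by linarith

theorem conv_comm (a b : ℤ → K) : conv a b = conv b a := by
  funext k
  unfold conv
  rw [← (Equiv.subLeft k).tsum_eq]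
  refine tsum_congr fun i => ?_
  simp [mul_comm]

theorem conv_assoc (hρ : 0 < ρ) {a b c : ℤ → K} (ha : ConvAt ρ a) (hb : ConvAt ρ b)
    (hc : ConvAt ρ c) : conv (conv a b) c = conv a (conv b c) := by
  funext k
  have hs := summable_triple hρ ha hb hc k
  have hR : conv a (conv b c) k = ∑' x : ℤ × ℤ, a x.1 * b x.2 * c (k - x.1 - x.2) := by
    rw [hs.tsum_prod]
    refine tsum_congr fun i => ?_
    simp only [conv]
    rw [← tsum_mul_left]
    exact tsum_congr fun j => by ring
  let e : ℤ × ℤ ≃ ℤ × ℤ :=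
    { toFun := fun x => (x.2, x.1 - x.2)
      invFun := fun x => (x.1 + x.2, x.1)
      left_inv := fun x => by ext <;> simp
      right_inv := fun x => by ext <;> simp }
  have hs' : Summable (fun x : ℤ × ℤ => a x.2 * b (x.1 - x.2) * c (k - x.1)) := by
    refine ((e.summable_iff).2 hs).congr fun x => ?_
    simp only [Function.comp, e, Equiv.coe_fn_mk]
    congr 2
    ring
  have hL : conv (conv a b) c k = ∑' x : ℤ × ℤ, a x.2 * b (x.1 - x.2) * c (k - x.1) := by
    rw [hs'.tsum_prod]
    refine tsum_congr fun j => ?_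
    simp only [conv]
    rw [← tsum_mul_right]
  rw [hL, hR, ← e.tsum_eq (fun x : ℤ × ℤ => a x.1 * b x.2 * c (k - x.1 - x.2))]
  refine tsum_congr fun x => ?_
  simp only [e, Equiv.coe_fn_mk]
  congr 2
  ring

theorem conv_add (hρ : 0 < ρ) {a b c : ℤ → K} (ha : ConvAt ρ a) (hb : ConvAt ρ b)
    (hc : ConvAt ρ c) : conv a (b + c) = conv a b + conv a c := by
  funext k
  simp only [conv, Pi.add_apply, mul_add]
  exact (summable_conv hρ ha hb k).tsum_add (summable_conv hρ ha hc k)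

theorem one_conv (a : ℤ → K) : conv (Pi.single 0 1) a = a := by
  funext k
  unfold conv
  rw [tsum_eq_single 0 (fun i hi => by simp [hi])]
  simp

end ConvLemmas

/-- `⋃_{0<ε<1} 𝒜_K(I_ε)` as an additive group of Laurent series, where `𝒜_K(I)` consists of the
series with `|aᵢ| ρⁱ → 0` as `i → ±∞` for all `ρ ∈ I`. -/
def series (B : Base) (K : Type u) [NormedField K] : AddSubgroup (ℤ → K) where
  carrier := {a | ∃ ε : ℝ, 0 < ε ∧ ε < 1 ∧ ∀ ρ ∈ B.I ε, ConvAt ρ a}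
  zero_mem' := ⟨1 / 2, by norm_num, by norm_num, fun _ _ => ConvAt.zero⟩
  add_mem' := by
    rintro a b ⟨ε, h0, h1, h⟩ ⟨ε', h0', h1', h'⟩
    refine ⟨min ε ε', lt_min h0 h0', min_lt_of_left_lt h1, fun ρ hρ => ?_⟩
    have hρ1 := B.I_mono (min_le_left ε ε') hρ
    exact (h ρ hρ1).add (B.pos_of_mem h1 hρ1) (h' ρ (B.I_mono (min_le_right ε ε') hρ))
  neg_mem' := by
    rintro a ⟨ε, h0, h1, h⟩
    exact ⟨ε, h0, h1, fun ρ hρ => (h ρ hρ).neg⟩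

/-- The base ring: `𝓡_K = ⋃_ε 𝒜_K(]1-ε,1[)` for `B = robba`, and
`𝓗†_K = ⋃_ε 𝒜_K(]1-ε,1+ε[)` for `B = dagger`. -/
def Fn (B : Base) (K : Type u) [NormedField K] : Type u := series B K

section Ring

variable {B : Base} {K : Type u} [NormedField K]

/-- The coefficients of an element of the base ring. -/
def Fn.coeff (f : Fn B K) : ℤ → K := f.1

theorem Fn.ext {f g : Fn B K} (h : f.coeff = g.coeff) : f = g := Subtype.ext h

instance : AddCommGroup (Fn B K) := inferInstanceAs (AddCommGroup (series B K))

theorem Fn.common (f g h : Fn B K) :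
    ∃ ρ : ℝ, 0 < ρ ∧ ConvAt ρ f.coeff ∧ ConvAt ρ g.coeff ∧ ConvAt ρ h.coeff := by
  obtain ⟨ε, h0, h1, hf⟩ := f.2
  obtain ⟨ε', h0', h1', hg⟩ := g.2
  obtain ⟨ε'', h0'', h1'', hh⟩ := h.2
  obtain ⟨ρ, hρ⟩ := B.nonempty_I (lt_min h0 (lt_min h0' h0''))
  have hρ1 := B.I_mono (min_le_left _ _) hρ
  have hρ2 := B.I_mono (min_le_right _ _) hρ
  exact ⟨ρ, B.pos_of_mem h1 hρ1, hf ρ hρ1, hg ρ (B.I_mono (min_le_left _ _) hρ2),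
    hh ρ (B.I_mono (min_le_right _ _) hρ2)⟩

/-- The monomial `c Tᵏ`. -/
noncomputable def mono (k : ℤ) (c : K) : Fn B K :=
  ⟨Pi.single k c, 1 / 2, by norm_num, by norm_num, fun _ _ => ConvAt.single k c⟩

variable [CompleteSpace K] [IsUltrametricDist K]

noncomputable instance : Mul (Fn B K) where
  mul f g := ⟨conv f.coeff g.coeff, by
    obtain ⟨ε, h0, h1, hf⟩ := f.2
    obtain ⟨ε', h0', h1', hg⟩ := g.2
    refine ⟨min ε ε', lt_min h0 h0', min_lt_of_left_lt h1, fun ρ hρ => ?_⟩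
    have hρ1 := B.I_mono (min_le_left ε ε') hρ
    exact (hf ρ hρ1).conv (B.pos_of_mem h1 hρ1) (hg ρ (B.I_mono (min_le_right ε ε') hρ))⟩

theorem Fn.coeff_mul (f g : Fn B K) : (f * g).coeff = conv f.coeff g.coeff := rfl

theorem Fn.coeff_add (f g : Fn B K) : (f + g).coeff = f.coeff + g.coeff := rfl

noncomputable instance : CommRing (Fn B K) :=
  { (inferInstance : AddCommGroup (Fn B K)), (inferInstance : Mul (Fn B K)) with
    one := mono 0 1
    mul_assoc := fun f g h => by
      obtain ⟨ρ, hρ, h1, h2, h3⟩ := Fn.common f g h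
      exact Fn.ext (conv_assoc hρ h1 h2 h3)
    mul_comm := fun f g => Fn.ext (conv_comm _ _)
    one_mul := fun f => Fn.ext (one_conv _)
    mul_one := fun f => Fn.ext ((conv_comm _ _).trans (one_conv _))
    left_distrib := fun f g h => by
      obtain ⟨ρ, hρ, h1, h2, h3⟩ := Fn.common f g h
      exact Fn.ext (conv_add hρ h1 h2 h3)
    right_distrib := fun f g h => by
      obtain ⟨ρ, hρ, h1, h2, h3⟩ := Fn.common h f g
      refine Fn.ext ?_
      rw [Fn.coeff_mul, Fn.coeff_add, conv_comm, conv_add hρ h1 h2 h3, conv_comm, Fn.coeff_add,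
        Fn.coeff_mul, Fn.coeff_mul, conv_comm h.coeff g.coeff]
    zero_mul := fun f => Fn.ext (by
      funext k
      change (∑' i, (0 : ℤ → K) i * f.coeff (k - i)) = 0
      simp)
    mul_zero := fun f => Fn.ext (by
      funext k
      change (∑' i, f.coeff i * (0 : ℤ → K) (k - i)) = 0
      simp) }

/-- The group `𝒬 = {q ∈ K : |q| = 1}` of the `q` such that `f(T) ↦ f(qT)` is an automorphism of
the base ring. It contains the open disk `D⁻(1,1)`. -/
abbrev Q (K : Type u) [NormedField K] : Type u := Metric.sphere (0 : K) 1

/-- The operator `σ_q : f(T) ↦ f(qT)`. -/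
noncomputable def sigma (q : Q K) : Fn B K →+* Fn B K where
  toFun f := ⟨fun i => (q : K) ^ i * f.coeff i, by
    obtain ⟨ε, h0, h1, hf⟩ := f.2
    refine ⟨ε, h0, h1, fun ρ hρ => (hf ρ hρ).of_le (B.pos_of_mem h1 hρ) fun i => ?_⟩
    have : ‖(q : K)‖ = 1 := by simp
    simp [this, Fn.coeff]⟩
  map_one' := Fn.ext (by
    funext k
    change (q : K) ^ k * (Pi.single 0 1 : ℤ → K) k = (Pi.single 0 1 : ℤ → K) k
    by_cases hk : k = 0
    · subst hk; simp
    · simp [hk])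
  map_mul' f g := Fn.ext (by
    funext k
    change (q : K) ^ k * conv f.coeff g.coeff k =
      conv (fun i => (q : K) ^ i * f.coeff i) (fun i => (q : K) ^ i * g.coeff i) k
    have hq : (q : K) ≠ 0 := ne_zero_of_mem_unit_sphere q
    simp only [conv]
    rw [← tsum_mul_left]
    refine tsum_congr fun i => ?_
    have : (q : K) ^ k = (q : K) ^ i * (q : K) ^ (k - i) := by
      rw [← zpow_add₀ hq]; congr 1; ring
    rw [this]; ring)
  map_zero' := Fn.ext (by
    funext k
    change (q : K) ^ k * (0 : ℤ → K) k = 0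
    simp)
  map_add' f g := Fn.ext (by
    funext k
    change (q : K) ^ k * (f.coeff k + g.coeff k) = (q : K) ^ k * f.coeff k + (q : K) ^ k * g.coeff k
    ring)

/-- The derivation `δ₁ = T d/dT` of the base ring. -/
def delta (f : Fn B K) : Fn B K :=
  ⟨fun i => (i : K) * f.coeff i, by
    obtain ⟨ε, h0, h1, hf⟩ := f.2
    refine ⟨ε, h0, h1, fun ρ hρ => (hf ρ hρ).of_le (B.pos_of_mem h1 hρ) fun i => ?_⟩
    rw [norm_mul]
    exact mul_le_of_le_one_left (norm_nonneg _) (IsUltrametricDist.norm_intCast_le_one K i)⟩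

/-- The derivation `d/dT = T⁻¹ δ₁`. -/
noncomputable def ddT (f : Fn B K) : Fn B K := mono (-1) 1 * delta f

/-- The operator `d_q = (σ_q - 1) / ((q-1) T)` (used for `q ≠ 1`). -/
noncomputable def dq (q : Q K) (f : Fn B K) : Fn B K :=
  mono (-1) ((q : K) - 1)⁻¹ * (sigma q f - f)

/-! ### Gauss norms, Taylor solutions, generic radius -/

/-- `|f|_ρ = sup |aᵢ| ρⁱ`, the absolute value of `f` at the generic point `t_ρ`, in `[0,∞]`. -/
noncomputable def gaussNorm (ρ : ℝ) (f : Fn B K) : ℝ≥0∞ :=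
  ⨆ i : ℤ, ENNReal.ofReal (‖f.coeff i‖ * ρ ^ i)

/-- The maximum of the `|.|_ρ` of the entries. -/
noncomputable def matNorm (ρ : ℝ) {n : ℕ} (A : Matrix (Fin n) (Fin n) (Fn B K)) : ℝ≥0∞ :=
  ⨆ (i : Fin n) (j : Fin n), gaussNorm ρ (A i j)

/-- The series of matrices `∑ Fₙ` converges to `L` for the norm `|.|_ρ`, that is, it converges to
`L` after evaluation at the generic point `t_ρ`. -/
def SumsAt (ρ : ℝ) {n : ℕ} (F : ℕ → Matrix (Fin n) (Fin n) (Fn B K))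
    (L : Matrix (Fin n) (Fin n) (Fn B K)) : Prop :=
  Tendsto (fun N => matNorm ρ (∑ k ∈ Finset.range N, F k - L)) atTop (𝓝 0)

/-- `q` is a root of unity. -/
def IsRootOfUnity (q : Q K) : Prop := ∃ m : ℕ, 0 < m ∧ q ^ m = 1

/-- The `q`-factorial `[n]_q^! = ∏_{i=1}^n (1 + q + ⋯ + q^{i-1})`. -/
noncomputable def qFactorial (q : K) (n : ℕ) : K :=
  ∏ i ∈ Finset.range n, ∑ j ∈ Finset.range (i + 1), q ^ j

/-- The matrices `H_n` with `d_q^n(Y) = H_n Y` for the equation `σ_q(Y) = A Y`. -/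
noncomputable def Hmat (q : Q K) {n : ℕ} (A : Matrix (Fin n) (Fin n) (Fn B K)) :
    ℕ → Matrix (Fin n) (Fin n) (Fn B K)
  | 0 => 1
  | k + 1 => (Hmat q A k).map (dq q) +
      (Hmat q A k).map (sigma q) * ((mono (-1) ((q : K) - 1)⁻¹ : Fn B K) • (A - 1))

/-- The matrices `G_{[n]}` with `(d/dT)^n(Y) = G_{[n]} Y` for the equation `δ₁(Y) = G Y`. -/
noncomputable def Gmat {n : ℕ} (G : Matrix (Fin n) (Fin n) (Fn B K)) :
    ℕ → Matrix (Fin n) (Fin n) (Fn B K)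
  | 0 => 1
  | k + 1 => (Gmat G k).map ddT + Gmat G k * ((mono (-1) 1 : Fn B K) • G)

/-- `min(R_ρ, ρ)`, with `R_ρ = liminf_n (|H_n|_ρ / |[n]_q^!|)^{-1/n}` the radius of convergence at
`t_ρ` of the Taylor solution `∑ H_n(y) (x-y)_{q,n} / [n]_q^!` of `σ_q(Y) = A Y`
(for `q` not a root of unity). -/
noncomputable def qRay (q : Q K) {n : ℕ} (A : Matrix (Fin n) (Fin n) (Fn B K)) (ρ : ℝ) : ℝ≥0∞ :=
  min (liminf (fun k : ℕ =>
      (matNorm ρ (Hmat q A k) / ENNReal.ofReal ‖qFactorial (q : K) k‖) ^ (-(1 / (k : ℝ)))) atTop)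
    (ENNReal.ofReal ρ)

/-- `min(R_ρ, ρ)`, with `R_ρ = liminf_n (|G_{[n]}|_ρ / |n!|)^{-1/n}` the radius of convergence at
`t_ρ` of the Taylor solution `∑ G_{[n]}(y) (x-y)^n / n!` of `δ₁(Y) = G Y`. -/
noncomputable def dRay {n : ℕ} (G : Matrix (Fin n) (Fin n) (Fn B K)) (ρ : ℝ) : ℝ≥0∞ :=
  min (liminf (fun k : ℕ =>
      (matNorm ρ (Gmat G k) / ENNReal.ofReal ‖(k.factorial : K)‖) ^ (-(1 / (k : ℝ)))) atTop)
    (ENNReal.ofReal ρ)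

/-- The condition on the generic radius defining the categories `Mod(𝓡_K)^{[r]}` (the limit of
`Ray(M,ρ)` for `ρ → 1⁻` is `≥ r`, and `Ray(M,ρ) > |q-1|` for `ρ` close to `1`), respectively
`Mod(𝓗†_K)^{[r]}` (`Ray(M,1) ≥ r`). -/
def RadiusCond (B : Base) (r : ℝ) (q : Q K) (Ray : ℝ → ℝ≥0∞) : Prop :=
  match B with
  | .robba =>
      (∃ L : ℝ≥0∞, ENNReal.ofReal r ≤ L ∧ Tendsto Ray (𝓝[<] 1) (𝓝 L)) ∧
        ∃ ε : ℝ, 0 < ε ∧ ε < 1 ∧ ∀ ρ ∈ Set.Ioo (1 - ε) 1, ENNReal.ofReal ‖(q : K) - 1‖ < Ray ρ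
  | .dagger => ENNReal.ofReal r ≤ Ray 1

/-- The matrix function `Y(x,y) = ∑ Fᵢ(y) (x-y)ⁱ`, near `y = t_ρ`, is the Taylor solution
`Y_A(x,y) = ∑_k H_k(y) (x-y)_{q,k} / [k]_q^!` of `σ_q(Y) = A Y`, for `q` not a root of unity. Here
`(x-y)_{q,k} = ∏_{m<k} (x - q^m y)` is expanded in powers of `x-y`: the coefficient of `(x-y)ⁱ` is
`y^{k-i}` times the coefficient of `Xⁱ` in `∏_{m<k} (X + (1 - q^m))`. -/
def IsQTaylor (ρ : ℝ) (q : Q K) {n : ℕ} (A : Matrix (Fin n) (Fin n) (Fn B K))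
    (F : ℕ → Matrix (Fin n) (Fin n) (Fn B K)) : Prop :=
  ∀ i : ℕ, SumsAt ρ (fun k => (mono ((k : ℤ) - i)
      ((qFactorial (q : K) k)⁻¹ *
        (∏ m ∈ Finset.range k, (Polynomial.X + Polynomial.C (1 - (q : K) ^ m))).coeff i)
      : Fn B K) • Hmat q A k) (F i)

/-- The matrix function `Y(x,y) = ∑ Fᵢ(y) (x-y)ⁱ`, near `y = t_ρ`, is a solution of
`Y(qx,y) = A(x) Y(x,y)`. Both sides are expanded in powers of `x-y`, using
`qx - y = q (x-y) + (q-1) y` on the left and the Taylor expansion of `A(x)` at `y` on the right. -/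
def Solves (ρ : ℝ) (q : Q K) {n : ℕ} (A : Matrix (Fin n) (Fin n) (Fn B K))
    (F : ℕ → Matrix (Fin n) (Fin n) (Fn B K)) : Prop :=
  ∀ i : ℕ, SumsAt ρ (fun k => (mono ((k : ℤ) - i)
      ((k.choose i : K) * (q : K) ^ i * ((q : K) - 1) ^ (k - i)) : Fn B K) • F k)
    (∑ x ∈ Finset.HasAntidiagonal.antidiagonal i,
      ((mono 0 ((x.1.factorial : K)⁻¹) : Fn B K) • A.map (ddT^[x.1])) * F x.2)

/-- The coefficients in powers of `x-y` of the Taylor solution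
`Y_G(x,y) = ∑ G_{[n]}(y) (x-y)^n / n!` of `δ₁(Y) = G Y`. -/
noncomputable def dTaylor {n : ℕ} (G : Matrix (Fin n) (Fin n) (Fn B K)) (i : ℕ) :
    Matrix (Fin n) (Fin n) (Fn B K) :=
  (mono 0 ((i.factorial : K)⁻¹) : Fn B K) • Gmat G i

/-- The entries of `A` lie in `𝒜_K(I_ε)`. -/
def EntriesIn (ε : ℝ) {n : ℕ} (A : Matrix (Fin n) (Fin n) (Fn B K)) : Prop :=
  ∀ i j, ∀ ρ ∈ B.I ε, ConvAt ρ (A i j).coeff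

/-- The matrix `(a_{ij})` of an operator `φ`, given by `φ(eᵢ) = ∑ⱼ a_{ij} eⱼ`. -/
noncomputable def matrixOf {M : Type u} [AddCommGroup M] [Module (Fn B K) M] {n : ℕ}
    (b : Module.Basis (Fin n) (Fn B K) M) (φ : M → M) : Matrix (Fin n) (Fin n) (Fn B K) :=
  fun i j => b.repr (φ (b i)) j

end Ring

/-! ### Discrete `σ`-modules and `(σ,δ)`-modules -/

section Modules

variable (B : Base) (K : Type u) [NormedField K] [CompleteSpace K] [IsUltrametricDist K]

/-- A discrete `σ`-module over `S ⊆ 𝒬`: a finite free module `M` over the base ring with a group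
morphism `⟨S⟩ → Aut(M)`, `q ↦ σ_q^M`, such that `σ_q^M` is `σ_q`-semilinear for `q ∈ S`.
(A morphism from a group to the monoid of additive endomorphisms has automorphisms as values;
semilinearity makes them `K`-linear and continuous.) -/
structure SigmaMod (S : Set (Q K)) : Type (u + 1) where
  carrier : Type u
  [addCommGroup : AddCommGroup carrier]
  [module : Module (Fn B K) carrier]
  [free : Module.Free (Fn B K) carrier]
  [finite : Module.Finite (Fn B K) carrier]
  act : Subgroup.closure S →* AddMonoid.End carrier
  act_smul : ∀ (q : Q K) (hq : q ∈ S) (f : Fn B K) (m : carrier),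
    act ⟨q, Subgroup.subset_closure hq⟩ (f • m) =
      sigma q f • act ⟨q, Subgroup.subset_closure hq⟩ m

attribute [instance] SigmaMod.addCommGroup SigmaMod.module SigmaMod.free SigmaMod.finite

/-- A discrete `(σ,δ)`-module over `S`: a discrete `σ`-module over `S` with a connection
`δ₁^M`. -/
structure SigmaDeltaMod (S : Set (Q K)) : Type (u + 1) extends SigmaMod B K S where
  conn : carrier →+ carrier
  conn_smul : ∀ (f : Fn B K) (m : carrier), conn (f • m) = delta f • m + f • conn m

variable {B K} {S : Set (Q K)}

/-- Morphisms of discrete `σ`-modules: linear maps commuting with `σ_q` for all `q ∈ S`. -/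
@[ext]
structure SigmaMod.Hom (M N : SigmaMod B K S) : Type u where
  lin : M.carrier →ₗ[Fn B K] N.carrier
  comm : ∀ (q : Q K) (hq : q ∈ S) (m : M.carrier),
    lin (M.act ⟨q, Subgroup.subset_closure hq⟩ m) =
      N.act ⟨q, Subgroup.subset_closure hq⟩ (lin m)

noncomputable instance : Category (SigmaMod B K S) where
  Hom M N := SigmaMod.Hom M N
  id M := ⟨LinearMap.id, fun _ _ _ => rfl⟩
  comp f g := ⟨g.lin.comp f.lin, fun q hq m => by
    simp only [LinearMap.comp_apply, f.comm q hq, g.comm q hq]⟩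

/-- Morphisms of discrete `(σ,δ)`-modules: morphisms of `σ`-modules commuting with `δ₁`. -/
@[ext]
structure SigmaDeltaMod.Hom (M N : SigmaDeltaMod B K S) : Type u extends
    SigmaMod.Hom M.toSigmaMod N.toSigmaMod where
  comm_conn : ∀ m : M.carrier, lin (M.conn m) = N.conn (lin m)

noncomputable instance : Category (SigmaDeltaMod B K S) where
  Hom M N := SigmaDeltaMod.Hom M N
  id M := ⟨⟨LinearMap.id, fun _ _ _ => rfl⟩, fun _ => rfl⟩
  comp f g := ⟨⟨g.lin.comp f.lin, fun q hq m => by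
    simp only [LinearMap.comp_apply, f.comm q hq, g.comm q hq]⟩, fun m => by
    simp only [LinearMap.comp_apply, f.comm_conn, g.comm_conn]⟩

/-- Restriction of a `σ`-module from `S` to `S' ⊆ S`. -/
noncomputable def SigmaMod.restrict {S' : Set (Q K)} (h : S' ⊆ S) (M : SigmaMod B K S) :
    SigmaMod B K S' where
  carrier := M.carrier
  act := M.act.comp (Subgroup.inclusion (Subgroup.closure_mono h))
  act_smul q hq f m := M.act_smul q (h hq) f m

/-- Restriction of a `(σ,δ)`-module from `S` to `S' ⊆ S`. -/
noncomputable def SigmaDeltaMod.restrict {S' : Set (Q K)} (h : S' ⊆ S)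
    (M : SigmaDeltaMod B K S) : SigmaDeltaMod B K S' where
  toSigmaMod := M.toSigmaMod.restrict h
  conn := M.conn
  conn_smul := M.conn_smul

/-- The restriction functor `Res^S_{S'}` for `σ`-modules. -/
noncomputable def resSigma {S' : Set (Q K)} (h : S' ⊆ S) : SigmaMod B K S ⥤ SigmaMod B K S' where
  obj M := M.restrict h
  map f := ⟨f.lin, fun q hq m => f.comm q (h hq) m⟩

/-- The restriction functor `Res^S_{S'}` for `(σ,δ)`-modules. -/
noncomputable def resSigmaDelta {S' : Set (Q K)} (h : S' ⊆ S) :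
    SigmaDeltaMod B K S ⥤ SigmaDeltaMod B K S' where
  obj M := M.restrict h
  map f := ⟨⟨f.lin, fun q hq m => f.comm q (h hq) m⟩, f.comm_conn⟩

/-- The functor forgetting `δ`. -/
noncomputable def forgetDelta : SigmaDeltaMod B K S ⥤ SigmaMod B K S where
  obj M := M.toSigmaMod
  map f := f.toHom

/-- The matrix of `σ_q^M` in the basis `b`, for `q` in the group generated by `S`. -/
noncomputable def SigmaMod.mat (M : SigmaMod B K S) {n : ℕ}
    (b : Module.Basis (Fin n) (Fn B K) M.carrier) (q : Q K) (hq : q ∈ Subgroup.closure S) :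
    Matrix (Fin n) (Fin n) (Fn B K) :=
  matrixOf b (M.act ⟨q, hq⟩)

/-! ### The categories with exponent `[r]` -/

/-- The open disk `D⁻(1,r)`. -/
def disk (K : Type u) [NormedField K] (r : ℝ) : Set (Q K) := {q | ‖(q : K) - 1‖ < r}

theorem singleton_sub_disk {r : ℝ} {q : Q K} (hq : ‖(q : K) - 1‖ < r) : {q} ⊆ disk K r :=
  Set.singleton_subset_iff.2 hq

/-- The objects of `σ_q-Mod^{[r]}`, for `q` not a root of unity. (The generic radius does not
depend on the basis.) -/
def sigmaQProp (r : ℝ) (q : Q K) : ObjectProperty (SigmaMod B K {q}) := fun M =>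
  ∃ (n : ℕ) (b : Module.Basis (Fin n) (Fn B K) M.carrier),
    RadiusCond B r q (qRay q (M.mat b q (Subgroup.subset_closure rfl)))

/-- The objects of `(σ_q,δ_q)-Mod^{[r]}`, for any `q`: the radius of the Taylor solution `Y_G` of
the underlying differential equation satisfies the required bounds, and `Y_G` is at the same time
a solution of the `q`-difference equation, at `t_ρ` for all `ρ` in some `I_ε`. -/
def sigmaDeltaQProp (r : ℝ) (q : Q K) : ObjectProperty (SigmaDeltaMod B K {q}) := fun M =>
  ∃ (n : ℕ) (b : Module.Basis (Fin n) (Fn B K) M.carrier),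
    RadiusCond B r q (dRay (matrixOf b M.conn)) ∧
    ∃ ε : ℝ, 0 < ε ∧ ε < 1 ∧ ∀ ρ ∈ B.I ε,
      Solves ρ q (M.mat b q (Subgroup.subset_closure rfl)) (dTaylor (matrixOf b M.conn))

/-- The objects of `σ-Mod_S^{[r]}`. (i) The restriction to each `q ∈ S` which is not a root of unity
is in `σ_q-Mod^{[r]}`. (ii) For `0 < τ < r`, the restriction to `S_τ = S ∩ D⁻(1,τ)` comes from a
module over some `𝒜_K(I_ε)`, such that for all `ρ ∈ I_ε` the Taylor solutions `Y_{A(q)}(x,t_ρ)`,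
`q ∈ S_τ` not a root of unity, are all equal to one and the same `Y(x,t_ρ)`, which is also a
solution of the equations given by the roots of unity in `S_τ` (for these the Taylor solution is
not defined). -/
def sigmaProp (r : ℝ) (S : Set (Q K)) : ObjectProperty (SigmaMod B K S) := fun M =>
  (∀ (q : Q K) (hq : q ∈ S), ¬ IsRootOfUnity q →
    sigmaQProp r q (M.restrict (Set.singleton_subset_iff.2 hq))) ∧
  ∀ τ : ℝ, 0 < τ → τ < r → ∃ ε : ℝ, 0 < ε ∧ ε < 1 ∧
    ∃ (n : ℕ) (b : Module.Basis (Fin n) (Fn B K) M.carrier)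
      (Y : ℕ → Matrix (Fin n) (Fin n) (Fn B K)),
      (∀ (q : Q K) (hq : q ∈ Subgroup.closure (S ∩ disk K τ)),
        EntriesIn ε (M.mat b q (Subgroup.closure_mono Set.inter_subset_left hq))) ∧
      ∀ ρ ∈ B.I ε, ∀ (q : Q K) (hq : q ∈ S ∩ disk K τ),
        (¬ IsRootOfUnity q → IsQTaylor ρ q (M.mat b q (Subgroup.subset_closure hq.1)) Y) ∧
        (IsRootOfUnity q → Solves ρ q (M.mat b q (Subgroup.subset_closure hq.1)) Y)

/-- The objects of `(σ,δ)-Mod_S^{[r]}`. (i) The restriction to each `q ∈ S` is in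
`(σ_q,δ_q)-Mod^{[r]}`. (ii) For `0 < τ < r`, the restriction to `S_τ = S ∩ D⁻(1,τ)` comes from a
module over some `𝒜_K(I_ε)`, such that for all `ρ ∈ I_ε` the Taylor solution `Y_G(x,t_ρ)` of the
differential equation is a solution of the equations given by all `q ∈ S_τ`. -/
def sigmaDeltaProp (r : ℝ) (S : Set (Q K)) : ObjectProperty (SigmaDeltaMod B K S) := fun M =>
  (∀ (q : Q K) (hq : q ∈ S),
    sigmaDeltaQProp r q (M.restrict (Set.singleton_subset_iff.2 hq))) ∧
  ∀ τ : ℝ, 0 < τ → τ < r → ∃ ε : ℝ, 0 < ε ∧ ε < 1 ∧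
    ∃ (n : ℕ) (b : Module.Basis (Fin n) (Fn B K) M.carrier),
      (∀ (q : Q K) (hq : q ∈ Subgroup.closure (S ∩ disk K τ)),
        EntriesIn ε (M.mat b q (Subgroup.closure_mono Set.inter_subset_left hq))) ∧
      EntriesIn ε (matrixOf b M.conn) ∧
      ∀ ρ ∈ B.I ε, ∀ (q : Q K) (hq : q ∈ S ∩ disk K τ),
        Solves ρ q (M.mat b q (Subgroup.subset_closure hq.1)) (dTaylor (matrixOf b M.conn))

variable (B)

/-- `σ_q-Mod^{[r]}`. -/
abbrev SigmaQ (r : ℝ) (q : Q K) : Type (u + 1) :=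
  (sigmaQProp (B := B) r q).FullSubcategory

/-- `(σ_q,δ_q)-Mod^{[r]}`. For `q = 1` this is the category `δ₁-Mod^{[r]}` of differential modules
(`σ₁^M` is the identity). -/
abbrev SigmaDeltaQ (r : ℝ) (q : Q K) : Type (u + 1) :=
  (sigmaDeltaQProp (B := B) r q).FullSubcategory

/-- `σ-Mod_{D⁻(1,r)}^{[r]}`. -/
abbrev SigmaDisk (K : Type u) [NormedField K] [CompleteSpace K] [IsUltrametricDist K] (r : ℝ) :
    Type (u + 1) :=
  (sigmaProp (B := B) r (disk K r)).FullSubcategory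

/-- `(σ,δ)-Mod_{D⁻(1,r)}^{[r]}`. -/
abbrev SigmaDeltaDisk (K : Type u) [NormedField K] [CompleteSpace K] [IsUltrametricDist K]
    (r : ℝ) : Type (u + 1) :=
  (sigmaDeltaProp (B := B) r (disk K r)).FullSubcategory

/-- The restriction `σ-Mod_{D⁻(1,r)}^{[r]} ⥤ σ_q-Mod^{[r]}`, for `q ∈ D⁻(1,r)` not a root of
unity. -/
noncomputable def resQ (r : ℝ) (q : Q K) (hq : ‖(q : K) - 1‖ < r) (hu : ¬ IsRootOfUnity q) :
    SigmaDisk B K r ⥤ SigmaQ B r q :=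
  ObjectProperty.lift _ (ObjectProperty.ι _ ⋙ resSigma (singleton_sub_disk hq))
    fun M => M.property.1 q hq hu

/-- The restriction `(σ,δ)-Mod_{D⁻(1,r)}^{[r]} ⥤ (σ_q,δ_q)-Mod^{[r]}`, for `q ∈ D⁻(1,r)`. -/
noncomputable def resDeltaQ (r : ℝ) (q : Q K) (hq : ‖(q : K) - 1‖ < r) :
    SigmaDeltaDisk B K r ⥤ SigmaDeltaQ B r q :=
  ObjectProperty.lift _ (ObjectProperty.ι _ ⋙ resSigmaDelta (singleton_sub_disk hq))
    fun M => M.property.1 q hq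

/-- The functor `Forget δ_q : (σ_q,δ_q)-Mod^{[r]} ⥤ σ_q-Mod^{[r]}`; it is defined once one knows
that it respects the conditions on the radius. -/
noncomputable def forgetDeltaQ (r : ℝ) (q : Q K)
    (h : ∀ M : SigmaDeltaQ B r q, sigmaQProp r q (forgetDelta.obj M.obj)) :
    SigmaDeltaQ B r q ⥤ SigmaQ B r q :=
  ObjectProperty.lift _ (ObjectProperty.ι _ ⋙ forgetDelta) h

end Modules

/-- `G ∘ F⁻¹`, for an equivalence `F`. Applied to the restrictions to `q` and `q'` this is the
deformation functor `Def_{q,q'}^{Tay} = Res_{q'} ∘ (Res_q)⁻¹`. -/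
noncomputable def deform {C D E : Type (u + 1)} [Category.{u} C] [Category.{u} D] [Category.{u} E]
    (F : C ⥤ D) (hF : F.IsEquivalence) (G : C ⥤ E) : D ⥤ E :=
  haveI := hF
  F.inv ⋙ G

/-- `1 ∈ D⁻(1,r)` for `r > 0`. -/
theorem one_mem_disk {K : Type u} [NormedField K] {r : ℝ} {q : Q K} (hq : ‖(q : K) - 1‖ < r) :
    ‖((1 : Q K) : K) - 1‖ < r := by
  simpa using (norm_nonneg _).trans_lt hq

end QConf

namespace QConf

/-! ### Arithmetic in an ultrametric field of residue characteristic `p` -/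

section Arithmetic

variable {K : Type u} [NormedField K] [IsUltrametricDist K] {p : ℕ} [hpp : Fact p.Prime]

/-! Put `x = (1+z)y`. At a generic point the Taylor solution `Y(x,y)` becomes a matrix `W(z)` of
power series in `z` whose coefficients are Laurent series in `y = T`. For a differential equation
with matrix `G` this is `wSer G`, with coefficients `Tᵏ G_{[k]} / k!`, and solving the equation
given by `q` means that its value at `z = q - 1`, namely `Y(qy,y)`, is `A(q,y)`.

From differential to `q`-difference equations: the identity `Y(wx,y) = Y(wx,x) Y(x,y)`
(`wSer_affine`) turns the values at `q - 1` into a cocycle (`wSer_ev_mul`). A single `W` converging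
on every disk `|z| ≤ τ`, `τ < r`, therefore yields an action of the whole group `D⁻(1,r)`
(`exists_cocycle`, `exists_extension`).

From `q`-difference to differential equations, for `q` not a root of unity: the value of `W` at `qⁿ
- 1` has to be the matrix of `σ_qⁿ`. This is the predicate `Interp`, and the `q`-Taylor series is
precisely Newton's interpolation series at these nodes. When `|q-1| ≤ s`, the Newton polynomials and
the powers of `z` are exchanged by unitriangular matrices that respect the weights `sᵏ`, so either
expansion decays at radius `s` if and only if the other does (`interp_newtonSer`, `Interp.decays`);
hence the equality of radii `qRay_eq_dRay`. The nodes `q^{pʲ} - 1` are nonzero and tend to `0`, so a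
convergent series is determined by its values at the nodes (`mres_ext`). This identity principle
extends the cocycle relation from the nodes to all `z`; differentiating it shows that `W` is the
Taylor solution of the differential equation whose matrix is the coefficient of `z`
(`Interp.eq_wSer`). That is the confluence.

Morphisms: a matrix `D` commutes with `σ_q`, or with the connections, exactly when `W(z) D(T) =
D((1+z)T) W'(z)`. The same criterion serves all `q`, which gives fullness.

Analysis: the condition on the radius must give convergence of `W` on a whole annulus. In the Robba
case this is immediate. For `𝓗†_K` only the circle `|T| = 1` is controlled, and log-convexity of
Gauss norms together with geometric growth of the coefficients propagates the estimate to nearby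
circles (`exists_decays_near_one`). The values of `W` on the different circles then glue to elements
of the base ring (`exists_hasSum`). -/

theorem norm_natCast_eq_one (hp : ‖(p : K)‖ < 1) {n : ℕ} (hn : ¬ p ∣ n) : ‖(n : K)‖ = 1 := by
  refine le_antisymm (IsUltrametricDist.norm_natCast_le_one K n) ?_
  by_contra! h
  have hc : IsCoprime (n : ℤ) p :=
    Nat.isCoprime_iff_coprime.2 ((Nat.Prime.coprime_iff_not_dvd hpp.out).2 hn).symm
  obtain ⟨a, b, hab⟩ := hc
  have h1 : ((a : K) * n + b * p) = 1 := by exact_mod_cast congrArg (Int.cast : ℤ → K) hab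
  have h2 := IsUltrametricDist.norm_add_le_max ((a : K) * n) (b * p)
  rw [h1, norm_one, norm_mul, norm_mul] at h2
  have ha := IsUltrametricDist.norm_intCast_le_one K a
  have hb := IsUltrametricDist.norm_intCast_le_one K b
  have : max (‖(a : K)‖ * ‖(n : K)‖) (‖(b : K)‖ * ‖(p : K)‖) < 1 :=
    max_lt (by nlinarith [norm_nonneg (n : K)]) (by nlinarith [norm_nonneg (p : K)])
  linarith

theorem norm_natCast_eq_pow (hp : ‖(p : K)‖ < 1) {n : ℕ} (hn : n ≠ 0) :
    ‖(n : K)‖ = ‖(p : K)‖ ^ padicValNat p n := by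
  obtain ⟨m, hm⟩ := pow_padicValNat_dvd (p := p) (n := n)
  have hpm : ¬ p ∣ m := by
    rintro ⟨l, rfl⟩
    refine pow_succ_padicValNat_not_dvd (p := p) hn ⟨l, ?_⟩
    rw [pow_succ, mul_assoc]
    exact hm
  conv_lhs => rw [hm]
  rw [Nat.cast_mul, Nat.cast_pow, norm_mul, norm_pow, norm_natCast_eq_one hp hpm, mul_one]

theorem pow_le_norm_natCast (hp : ‖(p : K)‖ < 1) {n m : ℕ} (hn : n ≠ 0) (h : n < p ^ (m + 1)) :
    ‖(p : K)‖ ^ m ≤ ‖(n : K)‖ := by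
  rw [norm_natCast_eq_pow hp hn]
  refine pow_le_pow_of_le_one (norm_nonneg _) hp.le ?_
  have h1 := Nat.le_of_dvd (Nat.pos_of_ne_zero hn) (pow_padicValNat_dvd (p := p) (n := n))
  have := (Nat.pow_lt_pow_iff_right hpp.out.one_lt).1 (h1.trans_lt h)
  omega

/-- Legendre's formula bounds the `p`-adic valuation of `k!` by `k/(p-1) ≤ k`. The resulting
geometric bound on `1/k!` keeps the growth of Taylor coefficients geometric on every circle. -/
theorem pow_le_norm_factorial (hp : ‖(p : K)‖ < 1) (k : ℕ) :
    ‖(p : K)‖ ^ k ≤ ‖(k.factorial : K)‖ := by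
  rw [norm_natCast_eq_pow hp (Nat.factorial_ne_zero k)]
  refine pow_le_pow_of_le_one (norm_nonneg _) hp.le ?_
  have h := sub_one_mul_padicValNat_factorial (p := p) k
  have h2 : 1 ≤ p - 1 := by have := hpp.out.two_le; omega
  have : padicValNat p k.factorial ≤ (p - 1) * padicValNat p k.factorial :=
    Nat.le_mul_of_pos_left _ h2
  omega

theorem norm_eq_one_of_sub_one {q : K} (hq : ‖q - 1‖ < 1) : ‖q‖ = 1 := by
  have h := IsUltrametricDist.norm_add_eq_max_of_norm_ne_norm (x := q - 1) (y := 1)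
    (by rw [norm_one]; exact hq.ne)
  rw [sub_add_cancel, norm_one, max_eq_right hq.le] at h
  exact h

theorem norm_pow_sub_one_le {q : K} (hq : ‖q‖ ≤ 1) (n : ℕ) : ‖q ^ n - 1‖ ≤ ‖q - 1‖ := by
  rw [← geom_sum_mul, norm_mul]
  refine mul_le_of_le_one_left (norm_nonneg _) ?_
  refine IsUltrametricDist.norm_sum_le_of_forall_le_of_nonneg zero_le_one fun i _ => ?_
  rw [norm_pow]
  exact pow_le_one₀ (norm_nonneg _) hq

/-- The cofactor `1 + q + ⋯ + q^{p-1}` of `q - 1` differs from `p` by a sum of terms `qⁱ - 1`, each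
of norm at most `|q - 1|`. -/
theorem norm_pow_prime_sub_one_le {q : K} (hq : ‖q - 1‖ < 1) :
    ‖q ^ p - 1‖ ≤ max ‖q - 1‖ ‖(p : K)‖ * ‖q - 1‖ := by
  have hq1 := norm_eq_one_of_sub_one hq
  have e : ∑ i ∈ Finset.range p, q ^ i = ∑ i ∈ Finset.range p, (q ^ i - 1) + (p : K) := by
    simp [Finset.sum_sub_distrib]
  rw [← geom_sum_mul, norm_mul]
  gcongr
  rw [e]
  refine (IsUltrametricDist.norm_add_le_max _ _).trans (max_le_max ?_ le_rfl)
  exact IsUltrametricDist.norm_sum_le_of_forall_le_of_nonneg (norm_nonneg _)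
    fun i _ => norm_pow_sub_one_le hq1.le i

/-- Each `p`-th power contracts the distance to `1` by the fixed factor `θ < 1`. These powers later
supply the points accumulating at `0` in the identity principle. -/
theorem tendsto_pow_prime_pow (hp : ‖(p : K)‖ < 1) {q : K} (hq : ‖q - 1‖ < 1) :
    Tendsto (fun j : ℕ => ‖q ^ p ^ j - 1‖) atTop (𝓝 0) := by
  set θ := max ‖q - 1‖ ‖(p : K)‖ with hθ
  have hθ1 : θ < 1 := max_lt hq hp
  have h0 : 0 ≤ θ := (norm_nonneg _).trans (le_max_left _ _)
  have key : ∀ j : ℕ, ‖q ^ p ^ j - 1‖ ≤ θ ^ (j + 1) := by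
    intro j
    induction j with
    | zero => simp [hθ]
    | succ j ih =>
      have hle : θ ^ (j + 1) ≤ θ := pow_le_of_le_one h0 hθ1.le (Nat.succ_ne_zero j)
      have h1 : ‖q ^ p ^ j - 1‖ < 1 := (ih.trans hle).trans_lt hθ1
      have h2 := norm_pow_prime_sub_one_le (p := p) h1
      rw [← pow_mul, ← pow_succ] at h2
      refine h2.trans ?_
      rw [pow_succ' θ (j + 1)]
      gcongr
      exact max_le (ih.trans hle) (le_max_right _ _)
  refine squeeze_zero (fun _ => norm_nonneg _) key ?_
  exact (tendsto_pow_atTop_nhds_zero_of_lt_one h0 hθ1).comp (tendsto_add_atTop_nat 1)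

/-- In the binomial expansion of `(1+x)ᵏ - 1` the linear term `kx` strictly dominates: `j` times the
binomial coefficient of `xʲ` is a multiple of `k`, and `|x|^{j-1} < |j|` for `j ≥ 2`. -/
theorem norm_pow_sub_one_ge_of_small [CharZero K] (hp : ‖(p : K)‖ < 1) {x : K}
    (hx : ‖x‖ < ‖(p : K)‖) (k : ℕ) : ‖(k : K)‖ * ‖x‖ ≤ ‖(1 + x) ^ k - 1‖ := by
  rcases eq_or_ne x 0 with rfl | hx0
  · simp
  rcases k with _ | k
  · simp
  have hpos : 0 < ‖x‖ := norm_pos_iff.2 hx0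
  have hk0 : 0 < ‖((k + 1 : ℕ) : K)‖ := norm_pos_iff.2 (Nat.cast_ne_zero.2 (Nat.succ_ne_zero k))
  set S := ∑ i ∈ Finset.range k, x ^ (i + 2) * ((k + 1).choose (i + 2) : K) with hS
  have e : (1 + x) ^ (k + 1) - 1 = ((k + 1 : ℕ) : K) * x + S := by
    rw [add_comm, add_pow, Finset.sum_range_succ', Finset.sum_range_succ']
    simp [hS]
    ring
  have hlt : ∀ i, ‖x ^ (i + 2) * ((k + 1).choose (i + 2) : K)‖ < ‖((k + 1 : ℕ) : K)‖ * ‖x‖ := by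
    intro i
    have hi0 : 0 < ‖((i + 2 : ℕ) : K)‖ := norm_pos_iff.2 (Nat.cast_ne_zero.2 (by omega))
    have h1 : ‖((k + 1).choose (i + 2) : K)‖ * ‖((i + 2 : ℕ) : K)‖ ≤ ‖((k + 1 : ℕ) : K)‖ := by
      have := Nat.add_one_mul_choose_eq k (i + 1)
      rw [← norm_mul, ← Nat.cast_mul, ← this, Nat.cast_mul, norm_mul]
      exact mul_le_of_le_one_right (norm_nonneg _) (IsUltrametricDist.norm_natCast_le_one K _)
    have h2 : ‖x‖ ^ (i + 1) < ‖((i + 2 : ℕ) : K)‖ := by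
      refine (pow_lt_pow_left₀ hx (norm_nonneg _) (Nat.succ_ne_zero i)).trans_le ?_
      -- Since `i + 2 < p^(i+2)`, the valuation of `i + 2` is at most `i + 1`.
      exact pow_le_norm_natCast hp (by omega) (Nat.lt_pow_self hpp.out.one_lt)
    rw [norm_mul, norm_pow]
    have h3 : ‖x‖ ^ (i + 2) = ‖x‖ ^ (i + 1) * ‖x‖ := pow_succ _ _
    rw [h3]
    rcases eq_or_ne ‖((k + 1).choose (i + 2) : K)‖ 0 with h0 | h0
    · rw [h0, mul_zero]; positivity
    · have h4 : 0 < ‖((k + 1).choose (i + 2) : K)‖ := lt_of_le_of_ne (norm_nonneg _) h0.symm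
      calc ‖x‖ ^ (i + 1) * ‖x‖ * ‖((k + 1).choose (i + 2) : K)‖
          < ‖((i + 2 : ℕ) : K)‖ * ‖x‖ * ‖((k + 1).choose (i + 2) : K)‖ := by gcongr
        _ = ‖((k + 1).choose (i + 2) : K)‖ * ‖((i + 2 : ℕ) : K)‖ * ‖x‖ := by ring
        _ ≤ _ := by gcongr
  have hSlt : ‖S‖ < ‖((k + 1 : ℕ) : K)‖ * ‖x‖ := by
    rcases k with _ | k
    · simp only [hS, Finset.range_zero, Finset.sum_empty, norm_zero]
      positivity
    · obtain ⟨i, -, hi⟩ := IsUltrametricDist.exists_norm_finsetSum_le_of_nonempty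
        (t := Finset.range (k + 1)) ⟨0, by simp⟩
        (fun i => x ^ (i + 2) * ((k + 1 + 1).choose (i + 2) : K))
      exact hi.trans_lt (hlt i)
  rw [e, IsUltrametricDist.norm_add_eq_max_of_norm_ne_norm (by rw [norm_mul]; exact hSlt.ne'),
    norm_mul]
  exact le_max_left _ _

/-- Some `q^{pʲ}` lies so close to `1` that the linear term dominates, and `q^{k pʲ} - 1` is no
larger than `qᵏ - 1`. So `c = |q^{pʲ} - 1|` works; it is nonzero because `q` is not a root of unity.
-/
theorem exists_norm_pow_sub_one_ge [CharZero K] (hp : ‖(p : K)‖ < 1) {q : K} (hq : ‖q - 1‖ < 1)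
    (hu : ∀ m : ℕ, 0 < m → q ^ m ≠ 1) :
    ∃ c : ℝ, 0 < c ∧ ∀ k : ℕ, c * ‖(k : K)‖ ≤ ‖q ^ k - 1‖ := by
  have hp0 : 0 < ‖(p : K)‖ := norm_pos_iff.2 (Nat.cast_ne_zero.2 hpp.out.ne_zero)
  obtain ⟨j, hj⟩ := ((tendsto_pow_prime_pow hp hq).eventually_lt_const hp0).exists
  have hq1 := norm_eq_one_of_sub_one hq
  refine ⟨‖q ^ p ^ j - 1‖, ?_, fun k => ?_⟩
  · exact norm_pos_iff.2 (sub_ne_zero.2 (hu _ (pow_pos hpp.out.pos j)))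
  · have h := norm_pow_sub_one_ge_of_small hp hj k
    rw [add_sub_cancel, ← pow_mul, mul_comm (p ^ j) k, pow_mul] at h
    rw [mul_comm]
    exact h.trans (norm_pow_sub_one_le (by rw [norm_pow, hq1, one_pow]) _)

end Arithmetic

/-! ### Restricted power series with coefficients in an ultrametric Banach algebra -/

/-- The sequence `N` satisfies `‖N k‖ s ^ k → 0`. -/
def Decays {E : Type*} [NormedAddCommGroup E] (s : ℝ) (N : ℕ → E) : Prop :=
  Tendsto (fun k => ‖N k‖ * s ^ k) atTop (𝓝 0)

section Decays

variable {E : Type*} [NormedAddCommGroup E] {s : ℝ} {N : ℕ → E}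

theorem Decays.bdd (_hs : 0 ≤ s) (h : Decays s N) : ∃ C : ℝ, 0 ≤ C ∧ ∀ k, ‖N k‖ * s ^ k ≤ C := by
  obtain ⟨C, hC⟩ := h.bddAbove_range
  exact ⟨C, (by positivity : 0 ≤ ‖N 0‖ * s ^ 0).trans (hC ⟨0, rfl⟩), fun k => hC ⟨k, rfl⟩⟩

theorem Decays.mono {E' : Type*} [NormedAddCommGroup E'] {N' : ℕ → E'} (hs : 0 ≤ s)
    (h : Decays s N) (hN : ∀ k, ‖N' k‖ ≤ ‖N k‖) : Decays s N' :=
  squeeze_zero (fun _ => by positivity)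
    (fun k => mul_le_mul_of_nonneg_right (hN k) (pow_nonneg hs k)) h

theorem Decays.add [IsUltrametricDist E] {N' : ℕ → E} (hs : 0 ≤ s) (h : Decays s N)
    (h' : Decays s N') : Decays s (N + N') := by
  have := Tendsto.add h h'
  rw [add_zero] at this
  refine squeeze_zero (fun _ => by positivity) (fun k => ?_) this
  rw [← add_mul]
  exact mul_le_mul_of_nonneg_right (norm_add_le _ _) (pow_nonneg hs k)

theorem Decays.neg (h : Decays s N) : Decays s (-N) := by
  simpa [Decays] using h

theorem Decays.sub [IsUltrametricDist E] {N' : ℕ → E} (hs : 0 ≤ s) (h : Decays s N)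
    (h' : Decays s N') : Decays s (N - N') := by
  rw [sub_eq_add_neg]; exact h.add hs h'.neg

/-- Boundedness at a larger radius implies decay. -/
theorem Decays.of_bdd {s' C : ℝ} (hs : 0 ≤ s) (hss : s < s') (h : ∀ᶠ k in atTop, ‖N k‖ * s' ^ k ≤ C) :
    Decays s N := by
  have hs' : 0 < s' := hs.trans_lt hss
  have h1 := (tendsto_pow_atTop_nhds_zero_of_lt_one (div_nonneg hs hs'.le)
    ((div_lt_one hs').2 hss)).const_mul C
  rw [mul_zero] at h1
  refine squeeze_zero' (Eventually.of_forall fun _ => by positivity) ?_ h1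
  filter_upwards [h] with k hk
  rw [div_pow]
  calc ‖N k‖ * s ^ k = (‖N k‖ * s' ^ k) * (s ^ k / s' ^ k) := by field_simp
    _ ≤ _ := by gcongr

end Decays

theorem norm_tsum_le_of_forall_le {ι E : Type*} [NormedAddCommGroup E] [IsUltrametricDist E]
    {f : ι → E} {C : ℝ} (hC : 0 ≤ C) (h : ∀ i, ‖f i‖ ≤ C) : ‖∑' i, f i‖ ≤ C := by
  by_cases hf : Summable f
  · refine le_of_tendsto hf.hasSum.norm (Eventually.of_forall fun s => ?_)
    exact IsUltrametricDist.norm_sum_le_of_forall_le_of_nonneg hC fun i _ => h i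
  · simpa [tsum_eq_zero_of_not_summable hf] using hC

section Series

open PowerSeries

variable {K : Type*} [NormedField K] {E : Type*} [NormedCommRing E] [NormedAlgebra K E]
  [CompleteSpace E] [IsUltrametricDist E] {s : ℝ}

theorem summable_smul_of_decays (_hs : 0 ≤ s) {N : ℕ → E} (hN : Decays s N) {ψ : ℕ → K}
    (hψ : ∀ i, ‖ψ i‖ ≤ s ^ i) : Summable (fun k => ψ k • N k) := by
  apply NonarchimedeanAddGroup.summable_of_tendsto_cofinite_zero
  rw [Nat.cofinite_eq_atTop, tendsto_zero_iff_norm_tendsto_zero]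
  refine squeeze_zero (fun _ => norm_nonneg _) (fun k => ?_) hN
  rw [norm_smul, mul_comm]
  exact mul_le_mul_of_nonneg_left (hψ k) (norm_nonneg _)

theorem norm_pow_le_pow {z : K} (hz : ‖z‖ ≤ s) (k : ℕ) : ‖z ^ k‖ ≤ s ^ k := by
  rw [norm_pow]
  exact pow_le_pow_left₀ (norm_nonneg _) hz k

theorem isRestricted_iff_decays {F : E⟦X⟧} :
    F.IsRestricted s ↔ Decays s (fun k => coeff k F) := isRestricted_iff' s F

theorem isRestricted_mk {N : ℕ → E} : (PowerSeries.mk N).IsRestricted s ↔ Decays s N := by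
  simp [isRestricted_iff_decays]

theorem isRestricted_sum {ι : Type*} {t : Finset ι} {F : ι → E⟦X⟧}
    (h : ∀ i ∈ t, (F i).IsRestricted s) : (∑ i ∈ t, F i).IsRestricted s :=
  sum_mem (S := PowerSeries.IsRestricted.subring (R := E) s) h

/-- Evaluation of a power series at a scalar. -/
noncomputable def ev (z : K) (F : E⟦X⟧) : E := ∑' k, z ^ k • coeff k F

variable {z : K}

theorem summable_ev (hz : ‖z‖ ≤ s) {F : E⟦X⟧} (hF : F.IsRestricted s) :
    Summable (fun k => z ^ k • coeff k F) :=
  summable_smul_of_decays ((norm_nonneg z).trans hz) (isRestricted_iff_decays.1 hF)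
    (norm_pow_le_pow hz)

theorem hasSum_ev (hz : ‖z‖ ≤ s) {F : E⟦X⟧} (hF : F.IsRestricted s) :
    HasSum (fun k => z ^ k • coeff k F) (ev z F) := (summable_ev hz hF).hasSum

theorem ev_sub (hz : ‖z‖ ≤ s) {F G : E⟦X⟧} (hF : F.IsRestricted s) (hG : G.IsRestricted s) :
    ev z (F - G) = ev z F - ev z G := by
  simp only [ev, map_sub, smul_sub]
  exact (summable_ev hz hF).tsum_sub (summable_ev hz hG)

theorem ev_C (z : K) (a : E) : ev z (C a) = a := by
  rw [ev, tsum_eq_single 0 (fun k hk => by simp [coeff_C, hk])]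
  simp

theorem ev_sum {ι : Type*} {t : Finset ι} (hz : ‖z‖ ≤ s) {F : ι → E⟦X⟧}
    (h : ∀ i ∈ t, (F i).IsRestricted s) : ev z (∑ i ∈ t, F i) = ∑ i ∈ t, ev z (F i) := by
  simp only [ev, map_sum, Finset.smul_sum]
  exact Summable.tsum_finsetSum fun i hi => summable_ev hz (h i hi)

/-- The product of two null families is null along the cofinite filter of `ℕ × ℕ`, which is
summability in a complete ultrametric group. The Cauchy product may therefore be regrouped along
antidiagonals. -/
theorem ev_mul (hz : ‖z‖ ≤ s) {F G : E⟦X⟧} (hF : F.IsRestricted s) (hG : G.IsRestricted s) :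
    ev z (F * G) = ev z F * ev z G := by
  have h1 := summable_ev hz hF
  have h2 := summable_ev hz hG
  have h3 : Summable (fun x : ℕ × ℕ => (z ^ x.1 • coeff x.1 F) * (z ^ x.2 • coeff x.2 G)) := by
    rw [NonarchimedeanAddGroup.summable_iff_tendsto_cofinite_zero] at h1 h2 ⊢
    exact tendsto_mul_cofinite_nhds_zero h1 h2
  rw [ev, ev, ev, h1.tsum_mul_tsum_eq_tsum_sum_antidiagonal h2 h3]
  refine tsum_congr fun n => ?_
  rw [coeff_mul, Finset.smul_sum]
  refine Finset.sum_congr rfl fun x hx => ?_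
  rw [smul_mul_smul_comm, ← pow_add, Finset.HasAntidiagonal.mem_antidiagonal.1 hx]

/-! ### Changes of topological basis -/

variable {c : ℕ → ℕ → K} {N : ℕ → E}

/-- This licenses the exchange of sums in `tsum_transform`. The term of index `(k,i)` vanishes for
`i > k` and otherwise has norm at most `‖N k‖ sᵏ`; only finitely many `k` exceed a given `η`, each
with finitely many `i`. -/
theorem summable_transform (hs : 0 ≤ s) (hc0 : ∀ k i, k < i → c k i = 0)
    (hc : ∀ k i, i ≤ k → ‖c k i‖ ≤ s ^ (k - i)) (hN : Decays s N) {ψ : ℕ → K}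
    (hψ : ∀ i, ‖ψ i‖ ≤ s ^ i) :
    Summable (fun x : ℕ × ℕ => (c x.1 x.2 * ψ x.2) • N x.1) := by
  apply NonarchimedeanAddGroup.summable_of_tendsto_cofinite_zero
  rw [tendsto_zero_iff_norm_tendsto_zero, Metric.tendsto_nhds]
  intro η hη
  have h1 : ∀ᶠ k in atTop, ‖N k‖ * s ^ k < η := hN.eventually_lt_const hη
  rw [← Nat.cofinite_eq_atTop] at h1
  have hfin : {k | ¬ ‖N k‖ * s ^ k < η}.Finite := h1
  refine (hfin.biUnion (t := fun k => (fun i => (k, i)) '' (Set.Iic k))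
    fun k _ => (Set.finite_Iic k).image _).subset ?_
  rintro ⟨k, i⟩ hx
  simp only [Set.mem_compl_iff, Set.mem_ofPred_eq, dist_zero_right, norm_norm] at hx
  have hik : i ≤ k := by
    by_contra hcon
    exact hx (by simpa [hc0 k i (not_le.1 hcon)] using hη)
  have hle : ‖(c k i * ψ i) • N k‖ ≤ ‖N k‖ * s ^ k := by
    rw [norm_smul, norm_mul, mul_comm]
    gcongr
    calc ‖c k i‖ * ‖ψ i‖ ≤ s ^ (k - i) * s ^ i :=
          mul_le_mul (hc k i hik) (hψ i) (norm_nonneg _) (pow_nonneg hs _)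
      _ = s ^ k := by rw [← pow_add, Nat.sub_add_cancel hik]
  simp only [Set.mem_iUnion]
  exact ⟨k, fun hcon => hx (hle.trans_lt hcon), i, hik, rfl⟩

/-- The coefficients `∑ₖ c k i • N k` of the expansion in a new topological basis. -/
noncomputable def transform (c : ℕ → ℕ → K) (N : ℕ → E) (i : ℕ) : E := ∑' k, c k i • N k

theorem hasSum_transform (hs : 0 < s) (hc0 : ∀ k i, k < i → c k i = 0)
    (hc : ∀ k i, i ≤ k → ‖c k i‖ ≤ s ^ (k - i)) (hN : Decays s N) (i : ℕ) :
    HasSum (fun k => c k i • N k) (transform c N i) := by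
  refine Summable.hasSum ?_
  apply NonarchimedeanAddGroup.summable_of_tendsto_cofinite_zero
  rw [Nat.cofinite_eq_atTop, tendsto_zero_iff_norm_tendsto_zero]
  have h := Tendsto.mul_const ((s ^ i)⁻¹) hN
  rw [zero_mul] at h
  refine squeeze_zero (fun _ => norm_nonneg _) (fun k => ?_) h
  rcases lt_or_ge k i with hki | hik
  · rw [hc0 k i hki, zero_smul, norm_zero]; positivity
  · rw [norm_smul, mul_comm, mul_assoc]
    gcongr
    refine (hc k i hik).trans_eq ?_
    rw [pow_sub₀ _ hs.ne' hik]

/-- The bound on `c` gives `‖c k i‖ sⁱ ≤ sᵏ`, so a triangular change of basis does not increase the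
weighted sup norm of the tail of the sequence. -/
theorem decays_transform (hs : 0 < s) (hc0 : ∀ k i, k < i → c k i = 0)
    (hc : ∀ k i, i ≤ k → ‖c k i‖ ≤ s ^ (k - i)) (hN : Decays s N) :
    Decays s (transform c N) := by
  rw [Decays, Metric.tendsto_nhds]
  intro η hη
  have h1 : ∀ᶠ k in atTop, ‖N k‖ * s ^ k < η / 2 := hN.eventually_lt_const (by positivity)
  obtain ⟨k₀, hk₀⟩ := eventually_atTop.1 h1
  filter_upwards [eventually_ge_atTop k₀] with i hi
  rw [Real.dist_0_eq_abs, abs_of_nonneg (by positivity)]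
  have hb : ‖transform c N i‖ ≤ η / 2 / s ^ i := by
    refine norm_tsum_le_of_forall_le (by positivity) fun k => ?_
    rcases lt_or_ge k i with hki | hik
    · rw [hc0 k i hki, zero_smul, norm_zero]; positivity
    · rw [norm_smul, le_div_iff₀ (by positivity)]
      have h2 := (hk₀ k (hi.trans hik)).le
      calc ‖c k i‖ * ‖N k‖ * s ^ i ≤ s ^ (k - i) * ‖N k‖ * s ^ i := by gcongr; exact hc k i hik
        _ = ‖N k‖ * s ^ k := by
          rw [mul_comm (s ^ (k - i)), mul_assoc, ← pow_add, Nat.sub_add_cancel hik]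
        _ ≤ _ := h2
  calc ‖transform c N i‖ * s ^ i ≤ η / 2 / s ^ i * s ^ i := by gcongr
    _ = η / 2 := by field_simp
    _ < η := by linarith

/-- Here `ψ i` is the value of the `i`-th new basis function at a point, and `∑ c k i ψ i` is the
value of the `k`-th old one: both expansions evaluate to the same element. -/
theorem tsum_transform (hs : 0 < s) (hc0 : ∀ k i, k < i → c k i = 0)
    (hc : ∀ k i, i ≤ k → ‖c k i‖ ≤ s ^ (k - i)) (hN : Decays s N) {ψ : ℕ → K}
    (hψ : ∀ i, ‖ψ i‖ ≤ s ^ i) :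
    ∑' i, ψ i • transform c N i = ∑' k, (∑ i ∈ Finset.range (k + 1), c k i * ψ i) • N k := by
  have h := summable_transform hs.le hc0 hc hN hψ
  have h' : Summable (Function.uncurry fun k i => (c k i * ψ i) • N k) := h
  calc ∑' i, ψ i • transform c N i = ∑' i, ∑' k, (c k i * ψ i) • N k := by
        refine tsum_congr fun i => ?_
        rw [transform, ← (hasSum_transform hs hc0 hc hN i).summable.tsum_const_smul]
        exact tsum_congr fun k => by rw [smul_smul, mul_comm]
    _ = ∑' k, ∑' i, (c k i * ψ i) • N k := h'.tsum_comm
    _ = _ := by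
        refine tsum_congr fun k => ?_
        rw [tsum_eq_sum (s := Finset.range (k + 1)), Finset.sum_smul]
        intro i hi
        rw [hc0 k i (by simpa using hi), zero_mul, zero_smul]

/-! ### Isolated zeros -/

/-- If the coefficients below `k` vanish, then at each zero `w` the term `wᵏ aₖ` equals minus a tail
of size `O(|w|^{k+1})`. Dividing by `wᵏ` and letting `w` tend to `0` gives `aₖ = 0`. -/
theorem eq_zero_of_ev_eq_zero (hs : 0 < s) {F : E⟦X⟧} (hF : F.IsRestricted s) {w : ℕ → K}
    (hw : Tendsto (fun j => ‖w j‖) atTop (𝓝 0)) (hw0 : ∀ j, w j ≠ 0)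
    (h : ∀ j, ev (w j) F = 0) : F = 0 := by
  have hD := isRestricted_iff_decays.1 hF
  obtain ⟨C, hC0, hC⟩ := hD.bdd hs.le
  ext k
  induction k using Nat.strong_induction_on with
  | _ k ih =>
  rw [map_zero, ← norm_le_zero_iff]
  have hlim : Tendsto (fun j => ‖w j‖ * (C / s ^ (k + 1))) atTop (𝓝 0) := by
    simpa using hw.mul_const (C / s ^ (k + 1))
  refine ge_of_tendsto hlim ?_
  filter_upwards [hw.eventually_le_const hs] with j hj
  have hsum := summable_ev hj hF
  have h1 := hsum.sum_add_tsum_nat_add k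
  have h1' := hsum.sum_add_tsum_nat_add (k + 1)
  rw [Finset.sum_range_succ, Finset.sum_eq_zero, zero_add] at h1'
  swap
  · intro i hi
    rw [ih i (Finset.mem_range.1 hi), map_zero, smul_zero]
  have h2 : w j ^ k • coeff k F = -∑' i, w j ^ (i + (k + 1)) • coeff (i + (k + 1)) F := by
    rw [eq_neg_iff_add_eq_zero, h1']; exact h j
  have h3 : ‖∑' i, w j ^ (i + (k + 1)) • coeff (i + (k + 1)) F‖ ≤
      ‖w j‖ ^ (k + 1) * (C / s ^ (k + 1)) := by
    refine norm_tsum_le_of_forall_le (by positivity) fun i => ?_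
    rw [norm_smul, norm_pow, pow_add]
    have h4 := hC (i + (k + 1))
    rw [pow_add] at h4
    calc ‖w j‖ ^ i * ‖w j‖ ^ (k + 1) * ‖coeff (i + (k + 1)) F‖
        ≤ s ^ i * ‖w j‖ ^ (k + 1) * ‖coeff (i + (k + 1)) F‖ := by gcongr
      _ = ‖w j‖ ^ (k + 1) * (‖coeff (i + (k + 1)) F‖ * (s ^ i * s ^ (k + 1)) / s ^ (k + 1)) := by
          field_simp
      _ ≤ _ := by gcongr
  rw [← norm_neg, ← h2, norm_smul, norm_pow, pow_succ, mul_assoc] at h3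
  exact le_of_mul_le_mul_left h3 (pow_pos (norm_pos_iff.2 (hw0 j)) k)

end Series

/-! ### Newton polynomials -/

section Newton

variable {K : Type u} [NormedField K] [IsUltrametricDist K] {s : ℝ} {q : K}

/-- `∏_{m<k} (X + (1 - q^m))`. -/
noncomputable def newton (q : K) (k : ℕ) : Polynomial K :=
  ∏ m ∈ Finset.range k, (Polynomial.X + Polynomial.C (1 - q ^ m))

theorem newton_succ (q : K) (k : ℕ) :
    newton q (k + 1) = newton q k * (Polynomial.X + Polynomial.C (1 - q ^ k)) :=
  Finset.prod_range_succ _ _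

theorem eval_newton (q z : K) (k : ℕ) :
    (newton q k).eval z = ∏ m ∈ Finset.range k, (z + 1 - q ^ m) := by
  rw [newton, Polynomial.eval_prod]
  exact Finset.prod_congr rfl fun m _ => by simp; ring

theorem natDegree_newton_le (q : K) (k : ℕ) : (newton q k).natDegree ≤ k := by
  refine (Polynomial.natDegree_prod_le _ _).trans ?_
  refine (Finset.sum_le_sum fun m _ => (Polynomial.natDegree_X_add_C (1 - q ^ m)).le).trans ?_
  simp

theorem coeff_newton_eq_zero {k i : ℕ} (h : k < i) : (newton q k).coeff i = 0 :=
  Polynomial.coeff_eq_zero_of_natDegree_lt ((natDegree_newton_le q k).trans_lt h)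

theorem norm_one_sub_pow_le (hq1 : ‖q‖ ≤ 1) (hq : ‖q - 1‖ ≤ s) (m : ℕ) : ‖1 - q ^ m‖ ≤ s := by
  rw [norm_sub_rev]
  exact (norm_pow_sub_one_le hq1 m).trans hq

/-- The coefficient of `Xⁱ` is a sum of products of `k - i` constants `1 - q^m`, each of norm at
most `s`. -/
theorem norm_coeff_newton_le (hq1 : ‖q‖ ≤ 1) (hq : ‖q - 1‖ ≤ s) (k i : ℕ) (h : i ≤ k) :
    ‖(newton q k).coeff i‖ ≤ s ^ (k - i) := by
  have hs : 0 ≤ s := (norm_nonneg _).trans hq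
  induction k generalizing i with
  | zero => simp [newton, Nat.le_zero.1 h]
  | succ k ih =>
    rw [newton_succ, mul_add, Polynomial.coeff_add, Polynomial.coeff_mul_C]
    refine (IsUltrametricDist.norm_add_le_max _ _).trans (max_le ?_ ?_)
    · rcases i with _ | i
      · simpa using by positivity
      · rw [Polynomial.coeff_mul_X, Nat.succ_sub_succ]
        exact ih i (Nat.succ_le_succ_iff.1 h)
    · rcases Nat.lt_or_ge k i with hlt | hge
      · rw [coeff_newton_eq_zero hlt, zero_mul, norm_zero]
        positivity
      · rw [norm_mul, Nat.succ_sub hge, pow_succ]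
        exact mul_le_mul (ih i hge) (norm_one_sub_pow_le hq1 hq k) (norm_nonneg _)
          (pow_nonneg hs _)

theorem sum_coeff_newton (q z : K) (k : ℕ) :
    ∑ i ∈ Finset.range (k + 1), (newton q k).coeff i * z ^ i = (newton q k).eval z :=
  (Polynomial.eval_eq_sum_range' (Nat.lt_succ_of_le (natDegree_newton_le q k)) z).symm

/-- The coefficients of `Xⁱ` in the basis of Newton polynomials. -/
noncomputable def newtonInv (q : K) : ℕ → ℕ → K
  | 0, j => if j = 0 then 1 else 0
  | i + 1, 0 => -(1 - q ^ 0) * newtonInv q i 0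
  | i + 1, j + 1 => newtonInv q i j - (1 - q ^ (j + 1)) * newtonInv q i (j + 1)

theorem newtonInv_eq_zero {i j : ℕ} (h : i < j) : newtonInv q i j = 0 := by
  induction i generalizing j with
  | zero => simp [newtonInv, Nat.ne_of_gt h]
  | succ i ih =>
    rcases j with _ | j
    · omega
    · rw [newtonInv, ih (by omega), ih (by omega), mul_zero, sub_zero]

theorem norm_newtonInv_le (hq1 : ‖q‖ ≤ 1) (hq : ‖q - 1‖ ≤ s) (i j : ℕ) (h : j ≤ i) :
    ‖newtonInv q i j‖ ≤ s ^ (i - j) := by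
  have hs : 0 ≤ s := (norm_nonneg _).trans hq
  induction i generalizing j with
  | zero => simp [newtonInv, Nat.le_zero.1 h]
  | succ i ih =>
    rcases j with _ | j
    · simp only [newtonInv, pow_zero, sub_self, neg_zero, zero_mul, norm_zero]
      positivity
    · rw [newtonInv, sub_eq_add_neg]
      refine (IsUltrametricDist.norm_add_le_max _ _).trans (max_le ?_ ?_)
      · rw [Nat.succ_sub_succ]
        exact ih j (Nat.succ_le_succ_iff.1 h)
      · rcases Nat.lt_or_ge i (j + 1) with hlt | hge
        · rw [newtonInv_eq_zero hlt, mul_zero, neg_zero, norm_zero]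
          positivity
        · rw [norm_neg, norm_mul, Nat.succ_sub hge, pow_succ' s]
          exact mul_le_mul (norm_one_sub_pow_le hq1 hq _) (ih _ hge) (norm_nonneg _) hs

/-- Writing `P_j` for the Newton polynomials, the recursion defining `newtonInv` is `z P_j = P_{j+1}
- (1 - qʲ) P_j`. The index shift in the second sum is free: the term `j = 0` carries the factor `1 -
q⁰ = 0`, and the new top term vanishes by triangularity. -/
theorem sum_newtonInv (q z : K) (i : ℕ) :
    ∑ j ∈ Finset.range (i + 1), newtonInv q i j * (newton q j).eval z = z ^ i := by
  induction i with
  | zero => simp [newtonInv, newton]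
  | succ i ih =>
    have h1 : ∀ j, (newton q (j + 1)).eval z = (newton q j).eval z * (z + (1 - q ^ j)) := by
      intro j; rw [newton_succ]; simp
    have h2 : z ^ (i + 1) = ∑ j ∈ Finset.range (i + 1), newtonInv q i j * (newton q (j + 1)).eval z
        - ∑ j ∈ Finset.range (i + 1), (1 - q ^ j) * newtonInv q i j * (newton q j).eval z := by
      rw [pow_succ, ← ih, Finset.sum_mul, ← Finset.sum_sub_distrib]
      refine Finset.sum_congr rfl fun j _ => ?_
      rw [h1]; ring
    have h3 : ∑ j ∈ Finset.range (i + 1), (1 - q ^ j) * newtonInv q i j * (newton q j).eval z =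
        ∑ j ∈ Finset.range (i + 1),
          (1 - q ^ (j + 1)) * newtonInv q i (j + 1) * (newton q (j + 1)).eval z := by
      rw [Finset.sum_range_succ', Finset.sum_range_succ _ i, newtonInv_eq_zero (Nat.lt_succ_self i)]
      simp
    rw [Finset.sum_range_succ', h2, h3, ← Finset.sum_sub_distrib]
    simp only [newtonInv, pow_zero, sub_self, neg_zero, zero_mul, add_zero]
    exact Finset.sum_congr rfl fun j _ => by ring

theorem norm_eval_newton_le (hq1 : ‖q‖ ≤ 1) (hq : ‖q - 1‖ ≤ s) {z : K} (hz : ‖z‖ ≤ s) (k : ℕ) :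
    ‖(newton q k).eval z‖ ≤ s ^ k := by
  rw [eval_newton, norm_prod]
  refine (Finset.prod_le_prod (fun _ _ => norm_nonneg _) (g := fun _ => s) fun m _ => ?_).trans_eq
    (by simp)
  rw [add_sub_assoc]
  exact (IsUltrametricDist.norm_add_le_max _ _).trans (max_le hz (norm_one_sub_pow_le hq1 hq m))

/-- The factor `m = n` vanishes. A Newton series is thus a finite sum at each node `qⁿ - 1`,
whatever its convergence elsewhere. -/
theorem eval_newton_pow_eq_zero {n k : ℕ} (h : n < k) : (newton q k).eval (q ^ n - 1) = 0 := by
  rw [eval_newton]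
  exact Finset.prod_eq_zero (Finset.mem_range.2 h) (by ring)

theorem pow_sub_pow_ne_zero (hq0 : q ≠ 0) (hu : ∀ m : ℕ, 0 < m → q ^ m ≠ 1) {n m : ℕ} (h : m < n) :
    q ^ n - q ^ m ≠ 0 := by
  have e : q ^ n = q ^ m * q ^ (n - m) := by rw [← pow_add]; congr 1; omega
  rw [e, sub_ne_zero]
  intro h2
  exact hu (n - m) (by omega) (mul_left_cancel₀ (pow_ne_zero m hq0) (by rw [h2, mul_one]))

theorem eval_newton_pow_ne_zero (hq0 : q ≠ 0) (hu : ∀ m : ℕ, 0 < m → q ^ m ≠ 1) (n : ℕ) :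
    (newton q n).eval (q ^ n - 1) ≠ 0 := by
  rw [eval_newton, Finset.prod_ne_zero_iff]
  intro m hm
  rw [sub_add_cancel]
  exact pow_sub_pow_ne_zero hq0 hu (Finset.mem_range.1 hm)

/-- A sequence is determined by the values `∑ₖ (newton q k)(qⁿ - 1) • N k`. -/
theorem newton_unique {E : Type*} [AddCommGroup E] [Module K E] (hq0 : q ≠ 0)
    (hu : ∀ m : ℕ, 0 < m → q ^ m ≠ 1) {N N' : ℕ → E}
    (h : ∀ n : ℕ, ∑ k ∈ Finset.range (n + 1), (newton q k).eval (q ^ n - 1) • N k =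
      ∑ k ∈ Finset.range (n + 1), (newton q k).eval (q ^ n - 1) • N' k) : N = N' := by
  funext n
  induction n using Nat.strong_induction_on with
  | _ n ih =>
  have h1 := h n
  rw [Finset.sum_range_succ, Finset.sum_range_succ,
    Finset.sum_congr rfl fun k hk => by rw [ih k (Finset.mem_range.1 hk)]] at h1
  exact smul_right_injective E (eval_newton_pow_ne_zero hq0 hu n) (add_left_cancel h1)

theorem tsum_newton {E : Type*} [NormedAddCommGroup E] [NormedSpace K E] (N : ℕ → E) (n : ℕ) :
    ∑' k, (newton q k).eval (q ^ n - 1) • N k =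
      ∑ k ∈ Finset.range (n + 1), (newton q k).eval (q ^ n - 1) • N k :=
  tsum_eq_sum fun k hk => by
    rw [eval_newton_pow_eq_zero (by simpa using hk), zero_smul]

end Newton

/-! ### The Banach algebra of Laurent series converging on `|T| = ρ` -/

section Lau

variable (K : Type u) [NormedField K]

/-- The Laurent series with `‖aᵢ‖ ρⁱ → 0`, as a subspace of `ℤ → K`. -/
def lauSubmodule (ρ : Set.Ioi (0 : ℝ)) : Submodule K (ℤ → K) where
  carrier := {a | ConvAt (ρ : ℝ) a}
  zero_mem' := ConvAt.zero
  add_mem' := ConvAt.add ρ.2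
  smul_mem' c a ha := by
    have h := Tendsto.const_mul ‖c‖ ha
    rw [mul_zero] at h
    simpa [ConvAt, mul_assoc] using h

/-- The Laurent series with `‖aᵢ‖ ρⁱ → 0`. -/
def Lau (ρ : Set.Ioi (0 : ℝ)) : Type u := lauSubmodule K ρ

namespace Lau

variable {K} {ρ : Set.Ioi (0 : ℝ)}

theorem zpow_pos (i : ℤ) : 0 < (ρ : ℝ) ^ i := _root_.zpow_pos ρ.2 i

/-- The coefficients of a Laurent series. -/
def coeff (f : Lau K ρ) : ℤ → K := f.1

theorem conv_coeff (f : Lau K ρ) : ConvAt (ρ : ℝ) f.coeff := f.2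

/-- The Laurent series with given coefficients. -/
def mk (a : ℤ → K) (ha : ConvAt (ρ : ℝ) a) : Lau K ρ := ⟨a, ha⟩

@[simp] theorem coeff_mk (a : ℤ → K) (ha : ConvAt (ρ : ℝ) a) : (mk a ha).coeff = a := rfl

theorem ext {f g : Lau K ρ} (h : ∀ i, f.coeff i = g.coeff i) : f = g := Subtype.ext (funext h)

instance : AddCommGroup (Lau K ρ) := inferInstanceAs (AddCommGroup (lauSubmodule K ρ))

noncomputable instance : Module K (Lau K ρ) := inferInstanceAs (Module K (lauSubmodule K ρ))

@[simp] theorem coeff_add (f g : Lau K ρ) (i : ℤ) : (f + g).coeff i = f.coeff i + g.coeff i := rfl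

@[simp] theorem coeff_sub (f g : Lau K ρ) (i : ℤ) : (f - g).coeff i = f.coeff i - g.coeff i := rfl

@[simp] theorem coeff_neg (f : Lau K ρ) (i : ℤ) : (-f).coeff i = -f.coeff i := rfl

@[simp] theorem coeff_zero (i : ℤ) : (0 : Lau K ρ).coeff i = 0 := rfl

@[simp] theorem coeff_smul (c : K) (f : Lau K ρ) (i : ℤ) : (c • f).coeff i = c * f.coeff i := rfl

noncomputable instance : Norm (Lau K ρ) := ⟨fun f => ⨆ i, ‖f.coeff i‖ * (ρ : ℝ) ^ i⟩

theorem bddAbove (f : Lau K ρ) : BddAbove (Set.range fun i => ‖f.coeff i‖ * (ρ : ℝ) ^ i) := by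
  obtain ⟨C, -, hC⟩ := f.conv_coeff.bdd
  exact ⟨C, by rintro _ ⟨i, rfl⟩; exact hC i⟩

theorem le_norm (f : Lau K ρ) (i : ℤ) : ‖f.coeff i‖ * (ρ : ℝ) ^ i ≤ ‖f‖ := le_ciSup f.bddAbove i

theorem norm_le {f : Lau K ρ} {C : ℝ} (h : ∀ i, ‖f.coeff i‖ * (ρ : ℝ) ^ i ≤ C) : ‖f‖ ≤ C :=
  ciSup_le h

theorem norm_nonneg' (f : Lau K ρ) : 0 ≤ ‖f‖ :=
  (mul_nonneg (norm_nonneg _) (zpow_pos 0).le).trans (f.le_norm 0)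

/-- The norm of `Lau K ρ` makes it a normed group. -/
@[reducible] noncomputable def normedGroup : NormedAddCommGroup (Lau K ρ) :=
  AddGroupNorm.toNormedAddCommGroup
    { toFun := fun f => ‖f‖
      map_zero' := le_antisymm (norm_le fun i => by simp) (norm_nonneg' _)
      add_le' := fun f g => norm_le fun i => by
        refine le_trans ?_ (add_le_add (f.le_norm i) (g.le_norm i))
        rw [← add_mul]
        exact mul_le_mul_of_nonneg_right (norm_add_le _ _) (zpow_pos i).le
      neg' := fun f => by simp [Norm.norm]
      eq_zero_of_map_eq_zero' := fun f hf => by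
        refine ext fun i => ?_
        have h := f.le_norm i
        rw [show ‖f‖ = 0 from hf] at h
        have h2 := nonpos_of_mul_nonpos_left h (zpow_pos i)
        simpa using h2 }

theorem norm_coeff_le (f : Lau K ρ) (i : ℤ) : ‖f.coeff i‖ ≤ ((ρ : ℝ) ^ i)⁻¹ * ‖f‖ := by
  rw [inv_mul_eq_div, le_div_iff₀ (zpow_pos i)]
  exact f.le_norm i

variable [CompleteSpace K] [IsUltrametricDist K]

noncomputable instance : CommRing (Lau K ρ) :=
  { (inferInstance : AddCommGroup (Lau K ρ)) with
    mul := fun f g => ⟨conv f.coeff g.coeff, f.2.conv ρ.2 g.2⟩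
    one := ⟨Pi.single 0 1, ConvAt.single 0 1⟩
    mul_assoc := fun f g h => Subtype.ext (conv_assoc ρ.2 f.2 g.2 h.2)
    mul_comm := fun _ _ => Subtype.ext (conv_comm _ _)
    one_mul := fun _ => Subtype.ext (one_conv _)
    mul_one := fun _ => Subtype.ext ((conv_comm _ _).trans (one_conv _))
    left_distrib := fun f g h => Subtype.ext (conv_add ρ.2 f.2 g.2 h.2)
    right_distrib := fun f g h => Subtype.ext (by
      change conv (f.coeff + g.coeff) h.coeff = conv f.coeff h.coeff + conv g.coeff h.coeff
      rw [conv_comm, conv_add ρ.2 h.conv_coeff f.conv_coeff g.conv_coeff, conv_comm,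
        conv_comm h.coeff])
    zero_mul := fun f => ext fun k => by
      change (∑' i, (0 : ℤ → K) i * f.coeff (k - i)) = 0
      simp
    mul_zero := fun f => ext fun k => by
      change (∑' i, f.coeff i * (0 : ℤ → K) (k - i)) = 0
      simp }

theorem coeff_mul (f g : Lau K ρ) : (f * g).coeff = conv f.coeff g.coeff := rfl

theorem coeff_one : (1 : Lau K ρ).coeff = Pi.single 0 1 := rfl

noncomputable instance : NormedCommRing (Lau K ρ) :=
  { normedGroup (K := K) (ρ := ρ), (inferInstance : CommRing (Lau K ρ)) with
    norm_mul_le := fun f g => norm_le fun k => by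
      have h : ‖(f * g).coeff k‖ ≤ ‖f‖ * ‖g‖ / (ρ : ℝ) ^ k := by
        refine norm_tsum_le_of_forall
          (div_nonneg (mul_nonneg (norm_nonneg' f) (norm_nonneg' g)) (zpow_pos k).le) fun i => ?_
        rw [le_div_iff₀ (zpow_pos k)]
        calc ‖f.coeff i * g.coeff (k - i)‖ * (ρ : ℝ) ^ k
            = (‖f.coeff i‖ * (ρ : ℝ) ^ i) * (‖g.coeff (k - i)‖ * (ρ : ℝ) ^ (k - i)) := by
              have : (ρ : ℝ) ^ k = (ρ : ℝ) ^ i * (ρ : ℝ) ^ (k - i) := by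
                rw [← zpow_add₀ (ne_of_gt ρ.2)]; congr 1; ring
              rw [this, norm_mul]; ring
          _ ≤ ‖f‖ * ‖g‖ := mul_le_mul (f.le_norm i) (g.le_norm _)
              (mul_nonneg (norm_nonneg _) (zpow_pos _).le) (norm_nonneg' f)
      rwa [le_div_iff₀ (zpow_pos k)] at h }

instance : IsUltrametricDist (Lau K ρ) :=
  IsUltrametricDist.isUltrametricDist_of_forall_norm_add_le_max_norm fun f g => norm_le fun i => by
    calc ‖(f + g).coeff i‖ * (ρ : ℝ) ^ i ≤ max ‖f.coeff i‖ ‖g.coeff i‖ * (ρ : ℝ) ^ i :=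
          mul_le_mul_of_nonneg_right (IsUltrametricDist.norm_add_le_max _ _) (zpow_pos i).le
      _ = max (‖f.coeff i‖ * (ρ : ℝ) ^ i) (‖g.coeff i‖ * (ρ : ℝ) ^ i) :=
          max_mul_of_nonneg _ _ (zpow_pos i).le
      _ ≤ _ := max_le_max (f.le_norm i) (g.le_norm i)

theorem smul_conv (c : K) (a b : ℤ → K) : conv (c • a) b = c • conv a b := by
  funext k
  simp only [conv, Pi.smul_apply, smul_eq_mul, mul_assoc]
  rw [tsum_mul_left]

noncomputable instance : Algebra K (Lau K ρ) :=
  Algebra.ofModule (fun c f g => Subtype.ext (smul_conv c f.coeff g.coeff))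
    (fun c f g => Subtype.ext (by
      change conv f.coeff (c • g.coeff) = c • conv f.coeff g.coeff
      rw [conv_comm, smul_conv, conv_comm]))

noncomputable instance : NormedAlgebra K (Lau K ρ) where
  norm_smul_le c f := norm_le fun i => by
    rw [coeff_smul, norm_mul, mul_assoc]
    exact mul_le_mul_of_nonneg_left (f.le_norm i) (norm_nonneg _)

/-- The `i`-th coefficient as a continuous linear form. -/
noncomputable def coeffL (i : ℤ) : Lau K ρ →L[K] K :=
  LinearMap.mkContinuous
    { toFun := fun f => f.coeff i
      map_add' := fun _ _ => rfl
      map_smul' := fun _ _ => rfl } (((ρ : ℝ) ^ i)⁻¹) fun f => f.norm_coeff_le i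

theorem hasSum_coeff {ι : Type*} {F : ι → Lau K ρ} {f : Lau K ρ} (h : HasSum F f) (i : ℤ) :
    HasSum (fun k => (F k).coeff i) (f.coeff i) := (coeffL i).hasSum h

/-- Decay of `‖aᵢ‖ ρⁱ` is closed under uniform approximation in the weighted sup norm. It serves
both the completeness of `Lau K ρ` and limits of series of elements of the base ring. -/
theorem _root_.QConf.ConvAt.of_approx {ρ : ℝ} (hρ : 0 < ρ) {a : ℤ → K}
    (h : ∀ η : ℝ, 0 < η → ∃ b : ℤ → K, ConvAt ρ b ∧ ∀ i, ‖b i - a i‖ * ρ ^ i ≤ η) :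
    ConvAt ρ a := by
  rw [ConvAt, Metric.tendsto_nhds]
  intro η hη
  obtain ⟨b, hb, hab⟩ := h (η / 2) (by positivity)
  have h1 : ∀ᶠ i in cofinite, ‖b i‖ * ρ ^ i < η / 2 := hb.eventually_lt_const (by positivity)
  filter_upwards [h1] with i hi
  rw [Real.dist_0_eq_abs, abs_of_nonneg (by positivity)]
  have h2 : ‖a i‖ ≤ ‖b i‖ + ‖b i - a i‖ := by
    have := norm_sub_le (b i) (b i - a i)
    rwa [sub_sub_cancel] at this
  calc ‖a i‖ * ρ ^ i ≤ (‖b i‖ + ‖b i - a i‖) * ρ ^ i := by gcongr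
    _ = ‖b i‖ * ρ ^ i + ‖b i - a i‖ * ρ ^ i := add_mul _ _ _
    _ < η := by linarith [hab i]

instance : CompleteSpace (Lau K ρ) := by
  refine Metric.complete_of_cauchySeq_tendsto fun u hu => ?_
  have hc : ∀ i, ∃ a, Tendsto (fun n => (u n).coeff i) atTop (𝓝 a) := fun i =>
    cauchySeq_tendsto_of_complete ((coeffL (ρ := ρ) (K := K) i).uniformContinuous.comp_cauchySeq hu)
  choose a ha using hc
  -- The limit is taken coefficient by coefficient; the Cauchy estimate is uniform in `i` and
  -- survives the limit in `m`.
  have key : ∀ η : ℝ, 0 < η → ∃ N, ∀ n ≥ N, ∀ i, ‖(u n).coeff i - a i‖ * (ρ : ℝ) ^ i ≤ η := by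
    intro η hη
    obtain ⟨N, hN⟩ := Metric.cauchySeq_iff.1 hu η hη
    refine ⟨N, fun n hn i => ?_⟩
    have h1 : Tendsto (fun m => ‖(u n).coeff i - (u m).coeff i‖ * (ρ : ℝ) ^ i) atTop
        (𝓝 (‖(u n).coeff i - a i‖ * (ρ : ℝ) ^ i)) :=
      ((ha i).const_sub _).norm.mul_const _
    refine le_of_tendsto h1 ?_
    filter_upwards [eventually_ge_atTop N] with m hm
    have h2 := hN n hn m hm
    rw [dist_eq_norm] at h2
    exact (le_norm (u n - u m) i).trans h2.le
  have hconv : ConvAt (ρ : ℝ) a := ConvAt.of_approx ρ.2 fun η hη => by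
    obtain ⟨N, hN⟩ := key η hη
    exact ⟨(u N).coeff, (u N).conv_coeff, hN N le_rfl⟩
  refine ⟨mk a hconv, Metric.tendsto_atTop.2 fun η hη => ?_⟩
  obtain ⟨N, hN⟩ := key (η / 2) (by positivity)
  refine ⟨N, fun n hn => ?_⟩
  rw [dist_eq_norm]
  exact (norm_le (f := u n - mk a hconv) (hN n hn)).trans_lt (by linarith)

/-- The monomial `c Tᵏ`. -/
noncomputable def mono (k : ℤ) (c : K) : Lau K ρ := mk (Pi.single k c) (ConvAt.single k c)

theorem coeff_mono_mul (k : ℤ) (c : K) (f : Lau K ρ) (i : ℤ) :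
    (mono k c * f).coeff i = c * f.coeff (i - k) := by
  rw [coeff_mul]
  change (∑' j, (Pi.single k c : ℤ → K) j * f.coeff (i - j)) = _
  rw [tsum_eq_single k (fun j hj => by simp [hj])]
  simp

theorem norm_mono_mul (k : ℤ) (f : Lau K ρ) : ‖mono k (1 : K) * f‖ = (ρ : ℝ) ^ k * ‖f‖ := by
  have hle : ∀ (k : ℤ) (f : Lau K ρ), ‖mono k (1 : K) * f‖ ≤ (ρ : ℝ) ^ k * ‖f‖ := by
    intro k f
    refine norm_le fun i => ?_
    rw [coeff_mono_mul, one_mul]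
    have : (ρ : ℝ) ^ i = (ρ : ℝ) ^ k * (ρ : ℝ) ^ (i - k) := by
      rw [← zpow_add₀ (ne_of_gt ρ.2)]; congr 1; ring
    rw [this, mul_left_comm]
    exact mul_le_mul_of_nonneg_left (f.le_norm _) (zpow_pos k).le
  refine le_antisymm (hle k f) ?_
  have h := hle (-k) (mono k (1 : K) * f)
  have e : mono (-k) (1 : K) * (mono k (1 : K) * f) = f := ext fun i => by
    rw [coeff_mono_mul, coeff_mono_mul]; simp
  rw [e, zpow_neg, inv_mul_eq_div, le_div_iff₀ (zpow_pos k), mul_comm] at h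
  exact h

/-- The operator `σ_q : f(T) ↦ f(qT)`. -/
noncomputable def sigma (q : Q K) : Lau K ρ →+* Lau K ρ where
  toFun f := mk (fun i => (q : K) ^ i * f.coeff i)
    (f.conv_coeff.of_le ρ.2 fun i => by
      have : ‖(q : K)‖ = 1 := by simp
      simp [this])
  map_one' := ext fun k => by
    change (q : K) ^ k * (Pi.single 0 1 : ℤ → K) k = (Pi.single 0 1 : ℤ → K) k
    by_cases hk : k = 0
    · subst hk; simp
    · simp [hk]
  map_mul' f g := ext fun k => by
    change (q : K) ^ k * conv f.coeff g.coeff k =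
      conv (fun i => (q : K) ^ i * f.coeff i) (fun i => (q : K) ^ i * g.coeff i) k
    have hq : (q : K) ≠ 0 := ne_zero_of_mem_unit_sphere q
    simp only [conv]
    rw [← tsum_mul_left]
    refine tsum_congr fun i => ?_
    have : (q : K) ^ k = (q : K) ^ i * (q : K) ^ (k - i) := by
      rw [← zpow_add₀ hq]; congr 1; ring
    rw [this]; ring
  map_zero' := ext fun k => by simp
  map_add' f g := ext fun k => by simp [mul_add]

@[simp] theorem coeff_sigma (q : Q K) (f : Lau K ρ) (i : ℤ) :
    (sigma q f).coeff i = (q : K) ^ i * f.coeff i := rfl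

theorem norm_sigma (q : Q K) (f : Lau K ρ) : ‖sigma q f‖ = ‖f‖ := by
  simp [Norm.norm]

theorem sigma_smul (q : Q K) (c : K) (f : Lau K ρ) : sigma q (c • f) = c • sigma q f :=
  ext fun i => by simp; ring

/-- The derivation `T d/dT`. -/
noncomputable def delta : Lau K ρ →L[K] Lau K ρ :=
  LinearMap.mkContinuous
    { toFun := fun f => mk (fun i => (i : K) * f.coeff i) (f.conv_coeff.of_le ρ.2 fun i => by
        rw [norm_mul]
        exact mul_le_of_le_one_left (norm_nonneg _) (IsUltrametricDist.norm_intCast_le_one K i))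
      map_add' := fun f g => ext fun i => by simp [mul_add]
      map_smul' := fun c f => ext fun i => by simp; ring } 1 fun f => by
    refine norm_le fun i => ?_
    rw [one_mul]
    refine le_trans (mul_le_mul_of_nonneg_right ?_ (zpow_pos i).le) (f.le_norm i)
    change ‖(i : K) * f.coeff i‖ ≤ _
    rw [norm_mul]
    exact mul_le_of_le_one_left (norm_nonneg _) (IsUltrametricDist.norm_intCast_le_one K i)

@[simp] theorem coeff_delta (f : Lau K ρ) (i : ℤ) : (delta f).coeff i = (i : K) * f.coeff i := rfl

theorem norm_delta_le (f : Lau K ρ) : ‖delta f‖ ≤ ‖f‖ := by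
  refine norm_le fun i => le_trans (mul_le_mul_of_nonneg_right ?_ (zpow_pos i).le) (f.le_norm i)
  rw [coeff_delta, norm_mul]
  exact mul_le_of_le_one_left (norm_nonneg _) (IsUltrametricDist.norm_intCast_le_one K i)

theorem delta_mul (f g : Lau K ρ) : delta (f * g) = delta f * g + f * delta g := by
  refine ext fun k => ?_
  have h1 := summable_conv ρ.2 (delta f).conv_coeff g.conv_coeff k
  have h2 := summable_conv ρ.2 f.conv_coeff (delta g).conv_coeff k
  change (k : K) * ∑' i, f.coeff i * g.coeff (k - i) =
    ∑' i, (delta f).coeff i * g.coeff (k - i) + ∑' i, f.coeff i * (delta g).coeff (k - i)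
  rw [← h1.tsum_add h2, ← tsum_mul_left]
  refine tsum_congr fun i => ?_
  simp only [coeff_delta]
  push_cast
  ring

theorem delta_one : delta (1 : Lau K ρ) = 0 := by
  have h := delta_mul (1 : Lau K ρ) 1
  rw [mul_one, mul_one, one_mul] at h
  exact left_eq_add.1 h

end Lau

/-! ### Binomial coefficients -/

theorem succ_mul_choose_succ (i : ℤ) (k : ℕ) :
    ((k : ℤ) + 1) * Ring.choose i (k + 1) = (i - k) * Ring.choose i k := by
  have h1 := Ring.descPochhammer_eq_factorial_smul_choose i (k + 1)
  have h2 := Ring.descPochhammer_eq_factorial_smul_choose i k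
  rw [descPochhammer_succ_right, Polynomial.smeval_mul, h2, Polynomial.smeval_sub,
    Polynomial.smeval_X, Polynomial.smeval_natCast, Nat.factorial_succ] at h1
  simp only [nsmul_eq_mul, pow_zero, pow_one, mul_one] at h1
  push_cast at h1
  have h3 : (k.factorial : ℤ) ≠ 0 := by exact_mod_cast Nat.factorial_ne_zero k
  apply mul_left_cancel₀ h3
  linear_combination -h1

variable {K}

/-- The binomial coefficient `i` choose `k`, for an integer `i`, in the field `K`. -/
noncomputable def binom (K : Type u) [NormedField K] (i : ℤ) (k : ℕ) : K := (Ring.choose i k : ℤ)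

theorem binom_zero (i : ℤ) : binom K i 0 = 1 := by simp [binom]

theorem succ_mul_binom_succ (i : ℤ) (k : ℕ) :
    ((k : K) + 1) * binom K i (k + 1) = (i - k) * binom K i k := by
  have h := congrArg (Int.cast : ℤ → K) (succ_mul_choose_succ i k)
  push_cast at h
  exact h

theorem binom_succ_succ (i : ℤ) (k : ℕ) :
    binom K (i + 1) (k + 1) = binom K i k + binom K i (k + 1) := by
  simp [binom, Ring.choose_succ_succ]

theorem norm_binom_le [IsUltrametricDist K] (i : ℤ) (k : ℕ) : ‖binom K i k‖ ≤ 1 :=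
  IsUltrametricDist.norm_intCast_le_one K _

/-- Pascal's rule says that the left side is multiplied by `1 + z` when `i` increases by one, as is
the right side. Both equal `1` at `i = 0`, and `1 + z` is invertible, so induction runs in both
directions. -/
theorem tsum_binom [IsUltrametricDist K] [CompleteSpace K] {z : K} (hz : ‖z‖ < 1) (i : ℤ) :
    ∑' k : ℕ, z ^ k * binom K i k = (1 + z) ^ i := by
  have hs : ∀ i : ℤ, Summable fun k : ℕ => z ^ k * binom K i k := fun i =>
    Summable.of_norm_bounded (summable_geometric_of_lt_one (norm_nonneg _) hz) fun k => by
      rw [norm_mul, norm_pow]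
      exact mul_le_of_le_one_right (pow_nonneg (norm_nonneg _) k) (norm_binom_le i k)
  have hz1 : 1 + z ≠ 0 := by
    intro h
    have : z = -1 := by linear_combination h
    simp [this] at hz
  have hrec : ∀ i : ℤ, ∑' k : ℕ, z ^ k * binom K (i + 1) k =
      (1 + z) * ∑' k : ℕ, z ^ k * binom K i k := by
    intro i
    have h1 := (hs i).tsum_mul_left z
    have h2 := (summable_nat_add_iff (f := fun k : ℕ => z ^ k * binom K i k) 1).2 (hs i)
    have h3 := (hs i).mul_left z
    rw [(hs (i + 1)).tsum_eq_zero_add, one_add_mul, ← h1]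
    conv_rhs => rw [(hs i).tsum_eq_zero_add]
    rw [binom_zero, binom_zero, add_assoc, ← h2.tsum_add h3]
    congr 1
    refine tsum_congr fun k => ?_
    rw [binom_succ_succ]
    ring
  have h0 : ∑' k : ℕ, z ^ k * binom K 0 k = 1 := by
    rw [tsum_eq_single 0]
    · simp [binom_zero]
    · intro k hk
      simp [binom, Ring.choose_zero_pos ℤ (Nat.pos_of_ne_zero hk)]
  induction i using Int.induction_on with
  | zero => simpa using h0
  | succ n ih => rw [hrec, ih, zpow_add_one₀ hz1, mul_comm]
  | pred n ih =>
    have h := hrec (-n - 1)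
    rw [sub_add_cancel, ih] at h
    apply mul_left_cancel₀ hz1
    rw [← h, zpow_sub_one₀ hz1]
    field_simp

end Lau

/-! ### Taylor expansions and the differential equation -/

section Taylor

open PowerSeries

variable {K : Type u} [NormedField K] [CompleteSpace K] [IsUltrametricDist K]
  {ρ : Set.Ioi (0 : ℝ)}

namespace Lau

/-- The operator `Tᵏ (d/dT)ᵏ / k!`. -/
noncomputable def hasse (k : ℕ) (f : Lau K ρ) : Lau K ρ :=
  mk (fun i => binom K i k * f.coeff i) (f.conv_coeff.of_le ρ.2 fun i => by
    rw [norm_mul]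
    exact mul_le_of_le_one_left (norm_nonneg _) (norm_binom_le i k))

@[simp] theorem coeff_hasse (k : ℕ) (f : Lau K ρ) (i : ℤ) :
    (hasse k f).coeff i = binom K i k * f.coeff i := rfl

theorem norm_hasse_le (k : ℕ) (f : Lau K ρ) : ‖hasse k f‖ ≤ ‖f‖ := by
  refine norm_le fun i => le_trans (mul_le_mul_of_nonneg_right ?_ (zpow_pos i).le) (f.le_norm i)
  rw [coeff_hasse, norm_mul]
  exact mul_le_of_le_one_left (norm_nonneg _) (norm_binom_le i k)

theorem hasse_zero (f : Lau K ρ) : hasse 0 f = f := ext fun i => by simp [binom_zero]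

theorem hasse_add (k : ℕ) (f g : Lau K ρ) : hasse k (f + g) = hasse k f + hasse k g :=
  ext fun i => by simp [mul_add]

theorem succ_smul_hasse (k : ℕ) (f : Lau K ρ) :
    ((k : K) + 1) • hasse (k + 1) f = delta (hasse k f) - (k : K) • hasse k f :=
  ext fun i => by
    have h := succ_mul_binom_succ (K := K) i k
    simp only [coeff_smul, coeff_hasse, coeff_sub, coeff_delta]
    linear_combination (f.coeff i) * h

end Lau

/-- The derivation `(1 + z) d/dz - T d/dT` of the ring of power series in `z`. -/
noncomputable def Lop : (Lau K ρ)⟦X⟧ →+ (Lau K ρ)⟦X⟧ where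
  toFun F := PowerSeries.mk fun k =>
    ((k : K) + 1) • coeff (k + 1) F + (k : K) • coeff k F - Lau.delta (coeff k F)
  map_zero' := by ext; simp
  map_add' F G := by
    ext k
    simp only [coeff_mk, map_add, smul_add]
    abel

theorem coeff_Lop (F : (Lau K ρ)⟦X⟧) (k : ℕ) : coeff k (Lop F) =
    ((k : K) + 1) • coeff (k + 1) F + (k : K) • coeff k F - Lau.delta (coeff k F) := by
  simp [Lop]

theorem Lop_eq (F : (Lau K ρ)⟦X⟧) : Lop F = (1 + X) * derivative (Lau K ρ) F -
    PowerSeries.mk (fun k => Lau.delta (coeff k F)) := by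
  have hcast : ∀ (n : ℕ) (f : Lau K ρ), (n : K) • f = f * (n : Lau K ρ) := fun n f => by
    rw [Nat.cast_smul_eq_nsmul, nsmul_eq_mul, mul_comm]
  ext k
  rw [coeff_Lop, map_sub, coeff_mk, add_mul, one_mul, map_add, coeff_derivative]
  congr 1
  rcases k with _ | k
  · simp
  · rw [coeff_succ_X_mul, coeff_derivative, hcast]
    push_cast
    rw [add_smul, one_smul, add_smul, one_smul, hcast]
    ring

/-- In the coordinates `y = T`, `x = (1+z)T`, the operator `Lop` is `-y ∂/∂y` at fixed `x`. Hence it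
is a derivation, kills functions of `x` alone (`Lop_taylorHom`) and acts as `-δ₁` on functions of
`y` alone (`Lop_C`). -/
theorem Lop_mul (F G : (Lau K ρ)⟦X⟧) : Lop (F * G) = Lop F * G + F * Lop G := by
  have h : (PowerSeries.mk fun k => Lau.delta (coeff k (F * G)) : (Lau K ρ)⟦X⟧) =
      (PowerSeries.mk fun k => Lau.delta (coeff k F)) * G +
        F * (PowerSeries.mk fun k => Lau.delta (coeff k G)) := by
    ext k
    simp only [coeff_mk, map_add, coeff_mul, map_sum, Lau.delta_mul, Finset.sum_add_distrib]
  rw [Lop_eq, Lop_eq, Lop_eq, h, Derivation.leibniz]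
  simp only [smul_eq_mul]
  ring

theorem Lop_C (f : Lau K ρ) : Lop (C f) = -C (Lau.delta f) := by
  ext k
  rw [coeff_Lop]
  rcases k with _ | k <;> simp [coeff_C]

variable [CharZero K]

/-- The coefficient of `zᵏ` in `Lop F` is `(k+1) F_{k+1}` plus an expression in `F_k`, and `k + 1`
is invertible in characteristic `0`. So a solution of a linear system for `Lop` is determined by its
constant term. -/
theorem eq_zero_of_Lop {ι : Type*} [Fintype ι] {F : ι → (Lau K ρ)⟦X⟧} {g : ι → ι → Lau K ρ}
    (h : ∀ i, Lop (F i) = ∑ j, F j * C (g j i)) (h0 : ∀ i, coeff 0 (F i) = 0) (i : ι) :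
    F i = 0 := by
  ext k
  rw [map_zero]
  induction k generalizing i with
  | zero => exact h0 i
  | succ k ih =>
    have h1 := congrArg (coeff k) (h i)
    rw [coeff_Lop, map_sum] at h1
    simp only [coeff_mul_C, ih, zero_mul, Finset.sum_const_zero, smul_zero, map_zero, add_zero,
      sub_zero] at h1
    exact (smul_eq_zero.1 h1).resolve_left (by exact_mod_cast Nat.succ_ne_zero k)

theorem Lop_hasse (f : Lau K ρ) : Lop (PowerSeries.mk fun k => Lau.hasse k f) = 0 := by
  ext k
  rw [coeff_Lop, coeff_mk, coeff_mk, Lau.succ_smul_hasse]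
  simp

/-- The Taylor expansion `f((1+z)T)`. -/
noncomputable def taylorHom : Lau K ρ →+* (Lau K ρ)⟦X⟧ :=
  RingHom.mk'
    { toFun := fun f => PowerSeries.mk fun k => Lau.hasse k f
      map_one' := by
        -- Multiplicativity of the Taylor expansion is deduced from uniqueness: the difference of
        -- the two sides is killed by `Lop` and has constant term `0`.
        rw [← sub_eq_zero]
        refine eq_zero_of_Lop (ι := Unit) (g := fun _ _ => 0)
          (F := fun _ => (PowerSeries.mk fun k => Lau.hasse k (1 : Lau K ρ)) - 1) ?_ ?_ ()
        · intro _
          have h1 : Lop (1 : (Lau K ρ)⟦X⟧) = 0 := by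
            rw [← map_one (C (R := Lau K ρ)), Lop_C, Lau.delta_one, map_zero, neg_zero]
          simp [Lop_hasse, h1]
        · simp [Lau.hasse_zero]
      map_mul' := fun f g => by
        rw [← sub_eq_zero]
        refine eq_zero_of_Lop (ι := Unit) (g := fun _ _ => 0)
          (F := fun _ => (PowerSeries.mk fun k => Lau.hasse k (f * g)) -
            (PowerSeries.mk fun k => Lau.hasse k f) * PowerSeries.mk fun k => Lau.hasse k g)
          ?_ ?_ ()
        · intro _
          simp [Lop_hasse, Lop_mul]
        · simp [Lau.hasse_zero] }
    fun f g => by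
      ext k
      simp [Lau.hasse_add]

@[simp] theorem coeff_taylorHom (f : Lau K ρ) (k : ℕ) : coeff k (taylorHom f) = Lau.hasse k f :=
  coeff_mk k fun k => Lau.hasse k f

theorem Lop_taylorHom (f : Lau K ρ) : Lop (taylorHom f) = 0 := Lop_hasse f

theorem isRestricted_taylorHom {s : ℝ} (h0 : 0 ≤ s) (h1 : s < 1) (f : Lau K ρ) :
    (taylorHom f).IsRestricted s := by
  rw [isRestricted_iff_decays]
  have h := (tendsto_pow_atTop_nhds_zero_of_lt_one h0 h1).const_mul ‖f‖
  rw [mul_zero] at h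
  refine squeeze_zero (fun _ => by positivity) (fun k => ?_) h
  simp only [coeff_taylorHom]
  exact mul_le_mul_of_nonneg_right (Lau.norm_hasse_le k f) (pow_nonneg h0 k)

/-- On the coefficient of `Tⁱ` this is the binomial series for `(1 + (q - 1))ⁱ`. -/
theorem ev_taylorHom {q : Q K} (hq : ‖(q : K) - 1‖ < 1) (f : Lau K ρ) :
    ev ((q : K) - 1) (taylorHom f) = Lau.sigma q f := by
  refine Lau.ext fun i => ?_
  have h0 := hasSum_ev (z := (q : K) - 1) le_rfl (isRestricted_taylorHom (norm_nonneg _) hq f)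
  have h := Lau.hasSum_coeff h0 i
  rw [← h.tsum_eq, Lau.coeff_sigma]
  have h2 := tsum_binom hq i
  rw [add_sub_cancel] at h2
  rw [← h2, ← tsum_mul_right]
  refine tsum_congr fun k => ?_
  simp only [coeff_taylorHom, Lau.coeff_smul, Lau.coeff_hasse]
  ring

/-! ### The substitution `z ↦ w(1+z) - 1` -/

/-- The coefficients of `(w z + (w - 1))ᵏ`. -/
noncomputable def affCoeff (w : K) (k i : ℕ) : K := (k.choose i : K) * w ^ i * (w - 1) ^ (k - i)

theorem affCoeff_eq_zero (w : K) {k i : ℕ} (h : k < i) : affCoeff w k i = 0 := by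
  simp [affCoeff, Nat.choose_eq_zero_of_lt h]

theorem norm_affCoeff_le {s : ℝ} {w : K} (hw1 : ‖w‖ ≤ 1) (hw : ‖w - 1‖ ≤ s) (k i : ℕ) :
    ‖affCoeff w k i‖ ≤ s ^ (k - i) := by
  rw [affCoeff, norm_mul, norm_mul, norm_pow]
  calc ‖(k.choose i : K)‖ * ‖w‖ ^ i * ‖(w - 1) ^ (k - i)‖ ≤ 1 * 1 * s ^ (k - i) := by
        gcongr
        · exact IsUltrametricDist.norm_natCast_le_one K _
        · exact pow_le_one₀ (norm_nonneg _) hw1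
        · exact norm_pow_le_pow hw _
    _ = _ := by ring

theorem sum_affCoeff (w z : K) (k : ℕ) :
    ∑ i ∈ Finset.range (k + 1), affCoeff w k i * z ^ i = (w * (1 + z) - 1) ^ k := by
  have : w * (1 + z) - 1 = w * z + (w - 1) := by ring
  rw [this, add_pow]
  refine Finset.sum_congr rfl fun i _ => ?_
  rw [affCoeff, mul_pow]
  ring

/-- With `u = w(1+z) - 1` one has `(1+z) d/dz u^{k+1} = (k+1)(uᵏ + u^{k+1})`; this is its
coefficient of `zⁱ`. It expresses that `(1+z) d/dz` is invariant under the substitution. -/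
theorem affCoeff_rec (w : K) (k i : ℕ) :
    ((i : K) + 1) * affCoeff w (k + 1) (i + 1) + (i : K) * affCoeff w (k + 1) i =
      ((k : K) + 1) * (affCoeff w k i + affCoeff w (k + 1) i) := by
  rcases lt_or_ge k i with h | h
  · rcases eq_or_lt_of_le (Nat.succ_le_of_lt h) with rfl | h'
    · rw [affCoeff_eq_zero w (Nat.lt_succ_self (k + 1)), affCoeff_eq_zero w (Nat.lt_succ_self k)]
      push_cast
      ring
    · rw [affCoeff_eq_zero w h, affCoeff_eq_zero w (show k + 1 < i + 1 by omega),
        affCoeff_eq_zero w h']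
      ring
  · obtain ⟨d, rfl⟩ := Nat.exists_eq_add_of_le h
    have e1 : ((i : K) + 1) * ((i + d + 1).choose (i + 1) : K) =
        ((i : K) + d + 1) * ((i + d).choose i : K) := by
      have := Nat.add_one_mul_choose_eq (i + d) i
      have h2 := congrArg (Nat.cast : ℕ → K) this
      push_cast at h2
      linear_combination -h2
    have e2 : ((d : K) + 1) * ((i + d + 1).choose i : K) =
        ((i : K) + d + 1) * ((i + d).choose i : K) := by
      have := Nat.choose_mul_succ_eq (i + d) i
      have h2 := congrArg (Nat.cast : ℕ → K) this
      rw [show i + d + 1 - i = d + 1 by omega] at h2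
      push_cast at h2
      linear_combination -h2
    simp only [affCoeff]
    rw [show i + d + 1 - (i + 1) = d by omega, show i + d - i = d by omega,
      show i + d + 1 - i = d + 1 by omega]
    push_cast
    linear_combination (w ^ (i + 1) * (w - 1) ^ d) * e1 - (w ^ i * (w - 1) ^ (d + 1)) * e2

/-- The power series `F(w(1+z) - 1)`. -/
noncomputable def affine (w : K) (F : (Lau K ρ)⟦X⟧) : (Lau K ρ)⟦X⟧ :=
  PowerSeries.mk (transform (affCoeff w) fun k => coeff k F)

section Affine

variable {s : ℝ} {w : K} {F : (Lau K ρ)⟦X⟧}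

theorem hasSum_affine (hs : 0 < s) (hw1 : ‖w‖ ≤ 1) (hw : ‖w - 1‖ ≤ s) (hF : F.IsRestricted s)
    (i : ℕ) : HasSum (fun k => affCoeff w k i • coeff k F) (coeff i (affine w F)) := by
  rw [affine, coeff_mk]
  exact hasSum_transform hs (fun _ _ => affCoeff_eq_zero w)
    (fun k i _ => norm_affCoeff_le hw1 hw k i) (isRestricted_iff_decays.1 hF) i

theorem isRestricted_affine (hs : 0 < s) (hw1 : ‖w‖ ≤ 1) (hw : ‖w - 1‖ ≤ s)
    (hF : F.IsRestricted s) : (affine w F).IsRestricted s :=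
  isRestricted_mk.2 (decays_transform hs (fun _ _ => affCoeff_eq_zero w)
    (fun k i _ => norm_affCoeff_le hw1 hw k i) (isRestricted_iff_decays.1 hF))

theorem ev_affine (hs : 0 < s) (hw1 : ‖w‖ ≤ 1) (hw : ‖w - 1‖ ≤ s) (hF : F.IsRestricted s) {z : K}
    (hz : ‖z‖ ≤ s) : ev z (affine w F) = ev (w * (1 + z) - 1) F := by
  have h := tsum_transform hs (fun _ _ => affCoeff_eq_zero w)
    (fun k i _ => norm_affCoeff_le hw1 hw k i) (isRestricted_iff_decays.1 hF) (norm_pow_le_pow hz)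
  simp only [ev, affine, coeff_mk]
  rw [h]
  exact tsum_congr fun k => by rw [sum_affCoeff]

theorem coeff_zero_affine (w : K) (F : (Lau K ρ)⟦X⟧) : coeff 0 (affine w F) = ev (w - 1) F := by
  simp [affine, transform, ev, affCoeff]

theorem affine_mul_C (w : K) (F : (Lau K ρ)⟦X⟧) (g : Lau K ρ) (hs : 0 < s) (hw1 : ‖w‖ ≤ 1)
    (hw : ‖w - 1‖ ≤ s) (hF : F.IsRestricted s) : affine w (F * C g) = affine w F * C g := by
  ext i
  have h := (hasSum_affine hs hw1 hw hF i).mul_right g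
  rw [coeff_mul_C, ← h.tsum_eq, affine, coeff_mk, transform]
  exact tsum_congr fun k => by rw [coeff_mul_C, smul_mul_assoc]

theorem affine_sum {ι : Type*} {t : Finset ι} {F : ι → (Lau K ρ)⟦X⟧} (hs : 0 < s) (hw1 : ‖w‖ ≤ 1)
    (hw : ‖w - 1‖ ≤ s) (hF : ∀ j ∈ t, (F j).IsRestricted s) :
    affine w (∑ j ∈ t, F j) = ∑ j ∈ t, affine w (F j) := by
  ext i
  have h := hasSum_sum fun j hj => hasSum_affine hs hw1 hw (hF j hj) i
  rw [map_sum, ← h.tsum_eq, affine, coeff_mk, transform]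
  exact tsum_congr fun k => by rw [map_sum, Finset.smul_sum]

/-- Integers have norm at most `1`, and `δ₁` does not increase norms, so differentiation costs
nothing in the radius. -/
theorem isRestricted_Lop (hs : 0 < s) (hF : F.IsRestricted s) : (Lop F).IsRestricted s := by
  have h := isRestricted_iff_decays.1 hF
  rw [isRestricted_iff_decays]
  have hn : ∀ (n : ℕ) (f : Lau K ρ), ‖(n : K) • f‖ ≤ ‖f‖ := fun n f => by
    rw [norm_smul]
    exact mul_le_of_le_one_left (norm_nonneg _) (IsUltrametricDist.norm_natCast_le_one K n)
  have h1 : Decays s fun k => coeff (k + 1) F := by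
    have := ((tendsto_add_atTop_iff_nat 1).2 h).mul_const s⁻¹
    rw [zero_mul] at this
    refine this.congr fun k => ?_
    rw [pow_succ]
    field_simp
  have h2 : Decays s fun k => ((k : K) + 1) • coeff (k + 1) F :=
    h1.mono hs.le fun k => by simpa using hn (k + 1) (coeff (k + 1) F)
  have h3 : Decays s fun k => (k : K) • coeff k F := h.mono hs.le fun k => hn k _
  have h4 : Decays s fun k => Lau.delta (coeff k F) := h.mono hs.le fun k => Lau.norm_delta_le _
  simp only [coeff_Lop]
  exact (h2.add hs.le h3).sub hs.le h4

theorem Lop_affine (hs : 0 < s) (hw1 : ‖w‖ ≤ 1) (hw : ‖w - 1‖ ≤ s) (hF : F.IsRestricted s) :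
    Lop (affine w F) = affine w (Lop F) := by
  ext i
  have hL := hasSum_affine hs hw1 hw (isRestricted_Lop hs hF) i
  have h0 := hasSum_affine hs hw1 hw hF i
  have hv := (hasSum_affine hs hw1 hw (F := PowerSeries.mk fun k => (k : K) • coeff k F)
    (isRestricted_mk.2 ((isRestricted_iff_decays.1 hF).mono hs.le fun k => by
      rw [norm_smul]
      exact mul_le_of_le_one_left (norm_nonneg _) (IsUltrametricDist.norm_natCast_le_one K k))) i)
  simp only [coeff_mk] at hv
  have hu := ((hasSum_affine hs hw1 hw hF (i + 1)).const_smul ((i : K) + 1)).add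
    (h0.const_smul (i : K))
  have hd := Lau.delta.hasSum h0
  -- `affCoeff_rec` relates the coefficients of index `k + 1` to those of index `k`, so the sums are
  -- shifted by one. The terms dropped at `k = 0` vanish.
  have hu' := (hasSum_nat_add_iff' 1).2 hu
  have hv' := (hasSum_nat_add_iff' 1).2 hv
  have hu0 : ((i : K) + 1) • affCoeff w 0 (i + 1) • coeff 0 F +
      (i : K) • affCoeff w 0 i • coeff 0 F = 0 := by
    rcases i with _ | i
    · simp [affCoeff_eq_zero w Nat.one_pos]
    · rw [affCoeff_eq_zero w (Nat.succ_pos i), affCoeff_eq_zero w (Nat.succ_pos _)]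
      simp
  rw [Finset.sum_range_one, hu0, sub_zero] at hu'
  rw [Finset.sum_range_one, Nat.cast_zero, zero_smul, smul_zero, sub_zero] at hv'
  have hl := ((hu'.sub hv').add hv).sub hd
  rw [sub_add_cancel] at hl
  rw [coeff_Lop]
  refine hl.unique (hL.congr_fun fun k => ?_)
  have h := affCoeff_rec w k i
  rw [coeff_Lop, map_smul, smul_smul, smul_smul, smul_smul, ← add_smul, h]
  push_cast
  module

end Affine

end Taylor

/-! ### Matrices of restricted power series -/

section MatrixSeries

open PowerSeries

variable {K : Type u} [NormedField K] [CompleteSpace K] [IsUltrametricDist K] [CharZero K]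
  {ρ : Set.Ioi (0 : ℝ)} {l m n : Type*} [Fintype l] [Fintype m] [Fintype n] [DecidableEq l] [DecidableEq m]
  [DecidableEq n] {s : ℝ}

theorem Lau.sigma_one (f : Lau K ρ) : Lau.sigma 1 f = f := Lau.ext fun i => by simp

theorem Lau.sigma_mul (q q' : Q K) (f : Lau K ρ) :
    Lau.sigma (q * q') f = Lau.sigma q (Lau.sigma q' f) :=
  Lau.ext fun i => by simp [mul_zpow, mul_assoc]

/-- The entries of `V` are restricted power series for the radius `s`. -/
def MRes (s : ℝ) (V : Matrix m n (Lau K ρ)⟦X⟧) : Prop := ∀ i j, (V i j).IsRestricted s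

theorem MRes.mul {V : Matrix l m (Lau K ρ)⟦X⟧} {W : Matrix m n (Lau K ρ)⟦X⟧} (hV : MRes s V)
    (hW : MRes s W) : MRes s (V * W) := fun i j => by
  rw [Matrix.mul_apply]
  exact isRestricted_sum fun k _ => isRestricted.mul s (hV i k) (hW k j)

theorem MRes.const (A : Matrix m n (Lau K ρ)) : MRes s (A.map (C (R := Lau K ρ))) :=
  fun i j => isRestricted_C s (A i j)

theorem MRes.taylor (h0 : 0 ≤ s) (h1 : s < 1) (A : Matrix m n (Lau K ρ)) :
    MRes s (A.map taylorHom) := fun i j => isRestricted_taylorHom h0 h1 (A i j)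

theorem map_ev_mul {z : K} (hz : ‖z‖ ≤ s) {V : Matrix l m (Lau K ρ)⟦X⟧}
    {W : Matrix m n (Lau K ρ)⟦X⟧} (hV : MRes s V) (hW : MRes s W) :
    (V * W).map (ev z) = V.map (ev z) * W.map (ev z) := by
  ext1 i j
  rw [Matrix.map_apply, Matrix.mul_apply, Matrix.mul_apply,
    ev_sum hz fun k _ => isRestricted.mul s (hV i k) (hW k j)]
  exact Finset.sum_congr rfl fun k _ => ev_mul hz (hV i k) (hW k j)

theorem map_ev_const (z : K) (A : Matrix m n (Lau K ρ)) :
    (A.map (C (R := Lau K ρ))).map (ev z) = A := by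
  ext1 i j
  exact ev_C z (A i j)

theorem map_ev_taylor {q : Q K} (hq : ‖(q : K) - 1‖ < 1) (A : Matrix m n (Lau K ρ)) :
    (A.map taylorHom).map (ev ((q : K) - 1)) = A.map (Lau.sigma q) := by
  ext1 i j
  exact ev_taylorHom hq (A i j)

theorem map_Lop_mul (V : Matrix l m (Lau K ρ)⟦X⟧) (W : Matrix m n (Lau K ρ)⟦X⟧) :
    (V * W).map Lop = V.map Lop * W + V * W.map Lop := by
  ext1 i j
  simp only [Matrix.map_apply, Matrix.add_apply, Matrix.mul_apply, map_sum, Lop_mul,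
    Finset.sum_add_distrib]

theorem coeff_zero_mul' (F H : (Lau K ρ)⟦X⟧) : coeff 0 (F * H) = coeff 0 F * coeff 0 H := by
  simp [coeff_zero_eq_constantCoeff]

/-! ### Solutions of the differential equation -/

/-- The system couples only the entries within a row, so `eq_zero_of_Lop` applies to each row of `V
- V'`. -/
theorem ode_unique {V V' : Matrix m n (Lau K ρ)⟦X⟧} {G : Matrix n n (Lau K ρ)}
    (h : V.map Lop = V * G.map (C (R := Lau K ρ))) (h' : V'.map Lop = V' * G.map (C (R := Lau K ρ)))
    (h0 : ∀ i j, coeff 0 (V i j) = coeff 0 (V' i j)) : V = V' := by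
  ext1 i j
  rw [← sub_eq_zero]
  refine eq_zero_of_Lop (F := fun j => V i j - V' i j) (g := G) (fun j => ?_) (fun j => ?_) j
  · have e := congrFun (congrFun h i) j
    have e' := congrFun (congrFun h' i) j
    rw [Matrix.map_apply, Matrix.mul_apply] at e e'
    rw [map_sub, e, e', ← Finset.sum_sub_distrib]
    exact Finset.sum_congr rfl fun k _ => (sub_mul _ _ _).symm
  · rw [map_sub, h0, sub_self]

/-- The matrices `Tᵏ G_{[k]} / k!`. -/
noncomputable def wSeq (G : Matrix n n (Lau K ρ)) : ℕ → Matrix n n (Lau K ρ)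
  | 0 => 1
  | k + 1 => ((k : K) + 1)⁻¹ • ((wSeq G k).map Lau.delta - (k : K) • wSeq G k + wSeq G k * G)

/-- The Taylor solution `∑ Tᵏ G_{[k]} / k! zᵏ` of the differential equation. -/
noncomputable def wSer (G : Matrix n n (Lau K ρ)) : Matrix n n (Lau K ρ)⟦X⟧ :=
  fun i j => PowerSeries.mk fun k => wSeq G k i j

theorem coeff_wSer (G : Matrix n n (Lau K ρ)) (k : ℕ) (i j : n) :
    coeff k (wSer G i j) = wSeq G k i j := by simp [wSer]

/-- The recursion for `wSeq` is this equation read coefficient by coefficient. The matrix `G` acts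
on the right because `Y(x,y)` is differentiated in `y`: `-y ∂Y/∂y = Y G(y)`. -/
theorem wSer_ode (G : Matrix n n (Lau K ρ)) :
    (wSer G).map Lop = wSer G * G.map (C (R := Lau K ρ)) := by
  ext i j k
  have hk : (k : K) + 1 ≠ 0 := by exact_mod_cast Nat.succ_ne_zero k
  rw [Matrix.map_apply, coeff_Lop, Matrix.mul_apply, map_sum, coeff_wSer, coeff_wSer]
  simp only [Matrix.map_apply, coeff_mul_C, coeff_wSer]
  rw [wSeq, Matrix.smul_apply, smul_smul, mul_inv_cancel₀ hk, one_smul, Matrix.add_apply,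
    Matrix.sub_apply, Matrix.mul_apply, Matrix.map_apply, Matrix.smul_apply]
  abel

theorem coeff_zero_wSer (G : Matrix n n (Lau K ρ)) (i j : n) :
    coeff 0 (wSer G i j) = (1 : Matrix n n (Lau K ρ)) i j := coeff_wSer G 0 i j

theorem wSer_unique {V : Matrix n n (Lau K ρ)⟦X⟧} {G : Matrix n n (Lau K ρ)}
    (h : V.map Lop = V * G.map (C (R := Lau K ρ)))
    (h0 : ∀ i j, coeff 0 (V i j) = (1 : Matrix n n (Lau K ρ)) i j) : V = wSer G :=
  ode_unique h (wSer_ode G) fun i j => by rw [h0, coeff_zero_wSer]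

theorem map_Lop_taylor (A : Matrix m n (Lau K ρ)) : (A.map taylorHom).map Lop = 0 := by
  ext1 i j
  exact Lop_taylorHom (A i j)

theorem taylor_mul_ode {G : Matrix n n (Lau K ρ)} (A : Matrix m n (Lau K ρ))
    {V : Matrix n n (Lau K ρ)⟦X⟧} (h : V.map Lop = V * G.map (C (R := Lau K ρ))) :
    (A.map taylorHom * V).map Lop = A.map taylorHom * V * G.map (C (R := Lau K ρ)) := by
  rw [map_Lop_mul, map_Lop_taylor, Matrix.zero_mul, zero_add, h, Matrix.mul_assoc]

theorem coeff_zero_taylor_mul_wSer (A : Matrix m n (Lau K ρ)) (G : Matrix n n (Lau K ρ)) (i : m)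
    (j : n) : coeff 0 ((A.map taylorHom * wSer G) i j) = A i j := by
  rw [Matrix.mul_apply, map_sum]
  have : ∀ k, coeff 0 (A.map taylorHom i k * wSer G k j) = A i k * (1 : Matrix n n (Lau K ρ)) k j := by
    intro k
    rw [coeff_zero_mul', coeff_zero_wSer,
      Matrix.map_apply, coeff_taylorHom, Lau.hasse_zero]
  simp only [this, ← Matrix.mul_apply, Matrix.mul_one]

/-- A matrix commuting with the connections commutes with the Taylor solutions. -/
theorem wSer_mul_const {G : Matrix m m (Lau K ρ)} {G' : Matrix n n (Lau K ρ)}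
    {A : Matrix m n (Lau K ρ)} (h : G * A = A.map Lau.delta + A * G') :
    wSer G * A.map (C (R := Lau K ρ)) = A.map taylorHom * wSer G' := by
  -- `Lop` sends the constant matrix `A` to `-δ₁(A)`, and the hypothesis rewrites `G A - δ₁(A)` as
  -- `A G'`. Both sides then solve the system of `G'` with constant term `A`.
  refine ode_unique (G := G') ?_ (taylor_mul_ode A (wSer_ode G')) fun i j => ?_
  · have h1 : (A.map (C (R := Lau K ρ))).map Lop = -(A.map Lau.delta).map (C (R := Lau K ρ)) := by
      ext1 i j
      exact Lop_C (A i j)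
    have h2 := congrArg (fun B => B.map (C (R := Lau K ρ))) h
    simp only [Matrix.map_mul, Matrix.map_add _ (map_add (C (R := Lau K ρ)))] at h2
    rw [map_Lop_mul, h1, wSer_ode, Matrix.mul_assoc, h2, Matrix.mul_assoc]
    simp only [Matrix.mul_add, Matrix.mul_neg]
    abel
  · rw [coeff_zero_taylor_mul_wSer, Matrix.mul_apply, map_sum]
    simp only [Matrix.map_apply, coeff_mul_C, coeff_zero_wSer]
    rw [← Matrix.mul_apply, Matrix.one_mul]

/-- The cocycle property of the Taylor solution. -/
theorem wSer_affine (hs : 0 < s) {G : Matrix n n (Lau K ρ)} (hW : MRes s (wSer G)) {w : K}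
    (hw1 : ‖w‖ ≤ 1) (hw : ‖w - 1‖ ≤ s) :
    (wSer G).map (affine w) = ((wSer G).map (ev (w - 1))).map taylorHom * wSer G := by
  -- This is `Y(wx,y) = Y(wx,x) Y(x,y)`. The substitution in `z` commutes with `Lop` and fixes `G`,
  -- so the left side still solves the system; at `z = 0` both sides equal `Y(wy,y)`.
  refine ode_unique (G := G) ?_ (taylor_mul_ode _ (wSer_ode G)) fun i j => ?_
  · ext1 i j
    have e := congrFun (congrFun (wSer_ode G) i) j
    rw [Matrix.map_apply, Matrix.mul_apply] at e
    have hR : ∀ k ∈ Finset.univ, (wSer G i k * G.map (C (R := Lau K ρ)) k j).IsRestricted s :=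
      fun k _ => isRestricted.mul s (hW i k) (isRestricted_C s _)
    rw [Matrix.map_apply, Matrix.map_apply, Lop_affine hs hw1 hw (hW i j), e,
      affine_sum hs hw1 hw hR, Matrix.mul_apply]
    exact Finset.sum_congr rfl fun k _ => affine_mul_C w _ _ hs hw1 hw (hW i k)
  · rw [coeff_zero_taylor_mul_wSer, Matrix.map_apply, coeff_zero_affine, Matrix.map_apply]

theorem norm_mul_sub_one_le {w w' : K} (hw1 : ‖w‖ ≤ 1) (hw : ‖w - 1‖ ≤ s) (hw' : ‖w' - 1‖ ≤ s) :
    ‖w * w' - 1‖ ≤ s := by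
  have e : w * w' - 1 = w * (w' - 1) + (w - 1) := by ring
  rw [e]
  refine (IsUltrametricDist.norm_add_le_max _ _).trans (max_le ?_ hw)
  rw [norm_mul]
  exact (mul_le_of_le_one_left (norm_nonneg _) hw1).trans hw'

/-- Evaluate the cocycle property at `z = w' - 1`: the substitution sends this point to `ww' - 1`,
and the Taylor expansion becomes `σ_{w'}`. -/
theorem wSer_ev_mul (hs : 0 < s) (hs1 : s < 1) {G : Matrix n n (Lau K ρ)} (hW : MRes s (wSer G))
    {w w' : Q K} (hw : ‖(w : K) - 1‖ ≤ s) (hw' : ‖(w' : K) - 1‖ ≤ s) :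
    (wSer G).map (ev ((w : K) * w' - 1)) =
      ((wSer G).map (ev ((w : K) - 1))).map (Lau.sigma w') * (wSer G).map (ev ((w' : K) - 1)) := by
  have hw1 : ‖(w : K)‖ ≤ 1 := by simp
  have h := congrArg (fun V => V.map (ev ((w' : K) - 1))) (wSer_affine hs hW hw1 hw)
  rw [map_ev_mul hw' (MRes.taylor hs.le hs1 _) hW, map_ev_taylor (hw'.trans_lt hs1)] at h
  rw [← h]
  ext1 i j
  rw [Matrix.map_apply, Matrix.map_apply, Matrix.map_apply, ev_affine hs hw1 hw (hW i j) hw',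
    add_sub_cancel]

/-! ### Interpolation of the iterates of a `q`-difference system -/

/-- The matrices `σ^{n-1}(A) ⋯ σ(A) A` of the iterates `σ_q^n`. -/
noncomputable def cocyc (q : Q K) (A : Matrix n n (Lau K ρ)) : ℕ → Matrix n n (Lau K ρ)
  | 0 => 1
  | k + 1 => (cocyc q A k).map (Lau.sigma q) * A

theorem cocyc_one (q : Q K) (A : Matrix n n (Lau K ρ)) : cocyc q A 1 = A := by
  simp [cocyc]

theorem cocyc_add (q : Q K) (A : Matrix n n (Lau K ρ)) (a b : ℕ) :
    cocyc q A (a + b) = (cocyc q A a).map (Lau.sigma (q ^ b)) * cocyc q A b := by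
  induction b with
  | zero =>
    have : (Lau.sigma (q ^ 0) : Lau K ρ → Lau K ρ) = id := funext fun f => by
      rw [pow_zero, Lau.sigma_one]; rfl
    rw [this, Matrix.map_id, cocyc, Matrix.mul_one, add_zero]
  | succ b ih =>
    rw [← add_assoc, cocyc, ih, cocyc, Matrix.map_mul, Matrix.mul_assoc, Matrix.map_map]
    congr 2
    funext f
    rw [pow_succ', Lau.sigma_mul]
    rfl

/-- `W` is restricted for the radius `s` and takes at `qⁿ - 1` the value `A_n`. -/
def Interp (s : ℝ) (q : Q K) (A : Matrix n n (Lau K ρ)) (W : Matrix n n (Lau K ρ)⟦X⟧) : Prop :=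
  MRes s W ∧ ∀ k : ℕ, W.map (ev ((q : K) ^ k - 1)) = cocyc q A k

theorem norm_coe_pow_sub_one_le {q : Q K} (hq : ‖(q : K) - 1‖ ≤ s) (k : ℕ) :
    ‖(q : K) ^ k - 1‖ ≤ s := (norm_pow_sub_one_le (by simp) k).trans hq

theorem Interp.ev_eq {q : Q K} {A : Matrix n n (Lau K ρ)} {W : Matrix n n (Lau K ρ)⟦X⟧}
    (h : Interp s q A W) : W.map (ev ((q : K) - 1)) = A := by
  have := h.2 1
  rwa [pow_one, cocyc_one] at this

theorem ev_zero_eq_coeff (F : (Lau K ρ)⟦X⟧) : ev (0 : K) F = coeff 0 F := by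
  rw [ev, tsum_eq_single 0 (fun k hk => by simp [hk])]
  simp

theorem Interp.coeff_zero {q : Q K} {A : Matrix n n (Lau K ρ)} {W : Matrix n n (Lau K ρ)⟦X⟧}
    (h : Interp s q A W) (i j : n) : coeff 0 (W i j) = (1 : Matrix n n (Lau K ρ)) i j := by
  have := congrFun (congrFun (h.2 0) i) j
  rwa [pow_zero, sub_self, Matrix.map_apply, ev_zero_eq_coeff] at this

/-- This is the passage from the differential equation to `σ_q`: once the matrix of `σ_q` is the
value at `q - 1`, the cocycle property forces the values at all `qᵏ - 1`. -/
theorem interp_wSer (hs : 0 < s) (hs1 : s < 1) {G : Matrix n n (Lau K ρ)} (hW : MRes s (wSer G))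
    {q : Q K} (hq : ‖(q : K) - 1‖ ≤ s) :
    Interp s q ((wSer G).map (ev ((q : K) - 1))) (wSer G) := by
  refine ⟨hW, fun k => ?_⟩
  induction k with
  | zero =>
    ext1 i j
    rw [pow_zero, sub_self, Matrix.map_apply, ev_zero_eq_coeff, coeff_zero_wSer, cocyc]
  | succ k ih =>
    have h := wSer_ev_mul hs hs1 hW (w := q ^ k) (w' := q)
      (by simpa using norm_coe_pow_sub_one_le hq k) hq
    rw [cocyc, ← ih, pow_succ]
    simpa using h

/-! ### The identity principle at the nodes `qⁿ - 1` and its consequences -/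

section Identity

variable {p : ℕ} [Fact p.Prime] {q : Q K}

theorem not_isRootOfUnity_iff : ¬ IsRootOfUnity q ↔ ∀ m : ℕ, 0 < m → (q : K) ^ m ≠ 1 := by
  have : ∀ m : ℕ, q ^ m = 1 ↔ (q : K) ^ m = 1 := fun m => by
    rw [← Subtype.coe_inj]; simp
  simp [IsRootOfUnity, this]

/-- Among the nodes are the `q^{pᵃ} - 1`, which are nonzero because `q` is not a root of unity and
tend to `0`. Isolated zeros conclude. -/
theorem mres_ext (hp : ‖(p : K)‖ < 1) (hu : ¬ IsRootOfUnity q) (hq : ‖(q : K) - 1‖ ≤ s)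
    (hs : 0 < s) (hs1 : s < 1) {V V' : Matrix m n (Lau K ρ)⟦X⟧} (hV : MRes s V) (hV' : MRes s V')
    (h : ∀ k : ℕ, V.map (ev ((q : K) ^ k - 1)) = V'.map (ev ((q : K) ^ k - 1))) : V = V' := by
  ext1 i j
  rw [← sub_eq_zero]
  have hr : (V i j - V' i j).IsRestricted s := by
    rw [sub_eq_add_neg]
    exact isRestricted.add s (hV i j) (isRestricted.neg s (hV' i j))
  refine eq_zero_of_ev_eq_zero hs hr (w := fun a => (q : K) ^ p ^ a - 1)
    (tendsto_pow_prime_pow hp (hq.trans_lt hs1)) (fun a => ?_) fun a => ?_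
  · exact sub_ne_zero.2 (not_isRootOfUnity_iff.1 hu _ (pow_pos (Fact.out : p.Prime).pos a))
  · rw [ev_sub (norm_coe_pow_sub_one_le hq _) (hV i j) (hV' i j), sub_eq_zero]
    exact congrFun (congrFun (h (p ^ a)) i) j

theorem map_ev_mul_const {z : K} (hz : ‖z‖ ≤ s) {V : Matrix l m (Lau K ρ)⟦X⟧} (hV : MRes s V)
    (A : Matrix m n (Lau K ρ)) :
    (V * A.map (C (R := Lau K ρ))).map (ev z) = V.map (ev z) * A := by
  rw [map_ev_mul hz hV (MRes.const A), map_ev_const]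

theorem map_ev_taylor_pow_mul (hq : ‖(q : K) - 1‖ ≤ s) (hs : 0 < s) (hs1 : s < 1)
    {V : Matrix m n (Lau K ρ)⟦X⟧} (hV : MRes s V) (A : Matrix l m (Lau K ρ)) (k : ℕ) :
    (A.map taylorHom * V).map (ev ((q : K) ^ k - 1)) =
      A.map (Lau.sigma (q ^ k)) * V.map (ev ((q : K) ^ k - 1)) := by
  have hk := norm_coe_pow_sub_one_le hq k
  rw [map_ev_mul hk (MRes.taylor hs.le hs1 A) hV]
  have h := map_ev_taylor (ρ := ρ) (q := q ^ k) (by simpa using hk.trans_lt hs1) A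
  rw [← h]
  simp

theorem cocyc_intertwine {A : Matrix m m (Lau K ρ)} {A' : Matrix n n (Lau K ρ)}
    {B : Matrix m n (Lau K ρ)} (h : A * B = B.map (Lau.sigma q) * A') (k : ℕ) :
    cocyc q A k * B = B.map (Lau.sigma (q ^ k)) * cocyc q A' k := by
  induction k with
  | zero =>
    have : (Lau.sigma (q ^ 0) : Lau K ρ → Lau K ρ) = id := funext fun f => by
      rw [pow_zero, Lau.sigma_one]; rfl
    rw [this, Matrix.map_id, cocyc, cocyc, Matrix.mul_one, Matrix.one_mul]
  | succ k ih =>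
    have h2 := congrArg (fun M => M.map (Lau.sigma q)) ih
    simp only [Matrix.map_mul, Matrix.map_map] at h2
    rw [cocyc, cocyc, Matrix.mul_assoc, h, ← Matrix.mul_assoc, h2, Matrix.mul_assoc]
    congr 2
    funext f
    rw [pow_succ', Lau.sigma_mul]
    rfl

/-- A matrix commuting with `σ_q` commutes with the interpolations. -/
theorem interp_mul_const (hp : ‖(p : K)‖ < 1) (hu : ¬ IsRootOfUnity q) (hq : ‖(q : K) - 1‖ ≤ s)
    (hs : 0 < s) (hs1 : s < 1) {A : Matrix m m (Lau K ρ)} {A' : Matrix n n (Lau K ρ)}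
    {W : Matrix m m (Lau K ρ)⟦X⟧} {W' : Matrix n n (Lau K ρ)⟦X⟧} (hW : Interp s q A W)
    (hW' : Interp s q A' W') {B : Matrix m n (Lau K ρ)}
    (h : A * B = B.map (Lau.sigma q) * A') :
    W * B.map (C (R := Lau K ρ)) = B.map taylorHom * W' := by
  refine mres_ext hp hu hq hs hs1 (hW.1.mul (MRes.const B))
    ((MRes.taylor hs.le hs1 B).mul hW'.1) fun k => ?_
  rw [map_ev_mul_const (norm_coe_pow_sub_one_le hq k) hW.1,
    map_ev_taylor_pow_mul hq hs hs1 hW'.1, hW.2, hW'.2]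
  exact cocyc_intertwine h k

/-- The interpolation is transported by a change of basis. -/
theorem Interp.change_basis (hq : ‖(q : K) - 1‖ ≤ s)
    (hs : 0 < s) (hs1 : s < 1) {A : Matrix m m (Lau K ρ)} {A' : Matrix n n (Lau K ρ)}
    {W : Matrix m m (Lau K ρ)⟦X⟧} (hW : Interp s q A W)
    {B : Matrix m n (Lau K ρ)} {B' : Matrix n m (Lau K ρ)} (hB : B' * B = 1)
    (h : A * B = B.map (Lau.sigma q) * A') :
    Interp s q A' (B'.map taylorHom * W * B.map (C (R := Lau K ρ))) := by
  have h1 := (MRes.taylor (ρ := ρ) hs.le hs1 B').mul hW.1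
  refine ⟨h1.mul (MRes.const B), fun k => ?_⟩
  rw [map_ev_mul_const (norm_coe_pow_sub_one_le hq k) h1, map_ev_taylor_pow_mul hq hs hs1 hW.1,
    hW.2, Matrix.mul_assoc, cocyc_intertwine h k, ← Matrix.mul_assoc, ← Matrix.map_mul, hB]
  simp

/-- The interpolation of the iterates of `σ_q` is a Taylor solution of a differential equation. -/
theorem Interp.eq_wSer (hp : ‖(p : K)‖ < 1) (hu : ¬ IsRootOfUnity q) (hq : ‖(q : K) - 1‖ ≤ s)
    (hs : 0 < s) (hs1 : s < 1) {A : Matrix n n (Lau K ρ)} {W : Matrix n n (Lau K ρ)⟦X⟧}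
    (hW : Interp s q A W) : W = wSer (W.map fun F => coeff 1 F) := by
  set G := W.map fun F => coeff 1 F with hG
  have hq1 : ‖(q : K)‖ ≤ 1 := by simp
  have hLres : MRes s (W.map Lop) := fun i j => isRestricted_Lop hs (hW.1 i j)
  -- The constant term of `W` is the identity matrix, which `δ₁` kills, so only the coefficient of
  -- `z` remains.
  have hL0 : ∀ i j, coeff 0 (Lop (W i j)) = G i j := fun i j => by
    rw [coeff_Lop, hW.coeff_zero]
    by_cases hij : i = j
    · subst hij; simp [hG, Lau.delta_one]
    · simp [hG, hij]
  refine wSer_unique ?_ hW.coeff_zero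
  refine mres_ext hp hu hq hs hs1 hLres (hW.1.mul (MRes.const G)) fun k => ?_
  have hk := norm_coe_pow_sub_one_le hq k
  have hk1 : ‖(q : K) ^ k‖ ≤ 1 := by simp
  -- The cocycle relation, first at the nodes: the substitution sends `q^b - 1` to `q^{k+b} - 1`,
  -- where it is `cocyc_add`. The identity principle extends it to all `z`.
  have haff : W.map (affine ((q : K) ^ k)) = (cocyc q A k).map taylorHom * W := by
    refine mres_ext hp hu hq hs hs1 (fun i j => isRestricted_affine hs hk1 hk (hW.1 i j))
      ((MRes.taylor hs.le hs1 _).mul hW.1) fun b => ?_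
    rw [map_ev_taylor_pow_mul hq hs hs1 hW.1, hW.2, ← cocyc_add, ← hW.2]
    ext1 i j
    rw [Matrix.map_apply, Matrix.map_apply, Matrix.map_apply,
      ev_affine hs hk1 hk (hW.1 i j) (norm_coe_pow_sub_one_le hq b), add_sub_cancel, ← pow_add]
  rw [map_ev_mul_const hk hW.1, hW.2]
  -- Apply `Lop` to the relation and take constant terms. On the left this is the value of `Lop W`
  -- at `qᵏ - 1`; on the right it is `A_k G`, since `Lop` kills Taylor expansions. So the
  -- differential equation holds at every node.
  have h2 := congrArg (fun V => (V.map Lop).map fun F => coeff 0 F) haff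
  rw [map_Lop_mul, map_Lop_taylor, Matrix.zero_mul, zero_add] at h2
  ext1 i j
  have h3 := congrFun (congrFun h2 i) j
  rw [Matrix.map_apply, Matrix.map_apply, Matrix.map_apply, Lop_affine hs hk1 hk (hW.1 i j),
    coeff_zero_affine, Matrix.map_apply, Matrix.mul_apply, map_sum] at h3
  rw [Matrix.map_apply, Matrix.map_apply, h3, Matrix.mul_apply]
  refine Finset.sum_congr rfl fun a _ => ?_
  rw [coeff_zero_mul', Matrix.map_apply, Matrix.map_apply,
    coeff_taylorHom, Lau.hasse_zero, hL0]

end Identity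

/-! ### Newton coefficients -/

/-- The matrices `Tᵏ H_k / [k]_q^!`. -/
noncomputable def nSeq (q : Q K) (A : Matrix n n (Lau K ρ)) : ℕ → Matrix n n (Lau K ρ)
  | 0 => 1
  | k + 1 => ((q : K) ^ (k + 1) - 1)⁻¹ •
      (((q : K) ^ k)⁻¹ • ((nSeq q A k).map (Lau.sigma q) * A) - nSeq q A k)

/-- The power series `∑ₖ (newton q k)(z) N_k`. -/
noncomputable def newtonSer (q : K) (N : ℕ → Matrix n n (Lau K ρ)) : Matrix n n (Lau K ρ)⟦X⟧ :=
  fun i j => PowerSeries.mk (transform (fun k i => (newton q k).coeff i) fun k => N k i j)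

variable {q : Q K}

theorem coe_ne_zero (q : Q K) : (q : K) ≠ 0 := ne_zero_of_mem_unit_sphere q

/-- This is the rule `d_q (x-y)_{q,k+1} = [k+1]_q (x-y)_{q,k}` at the nodes. Both values of the
polynomial of degree `k + 1` are multiples of the one of degree `k`. -/
theorem eval_newton_succ_pow (q : K) (n k : ℕ) :
    (newton q (k + 1)).eval (q ^ (n + 1) - 1) =
      q ^ (k + 1) * (newton q (k + 1)).eval (q ^ n - 1) +
        q ^ k * (q ^ (k + 1) - 1) * (newton q k).eval (q ^ n - 1) := by
  have h1 : (newton q (k + 1)).eval (q ^ (n + 1) - 1) =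
      q ^ k * (newton q k).eval (q ^ n - 1) * (q ^ (n + 1) - 1) := by
    rw [eval_newton, eval_newton, Finset.prod_range_succ']
    congr 1
    · have : q ^ k = ∏ _m ∈ Finset.range k, q := by simp
      rw [this, ← Finset.prod_mul_distrib]
      exact Finset.prod_congr rfl fun m _ => by ring
    · ring
  have h2 : (newton q (k + 1)).eval (q ^ n - 1) =
      (newton q k).eval (q ^ n - 1) * (q ^ n - q ^ k) := by
    rw [newton_succ]; simp
  rw [h1, h2]
  ring

theorem nSeq_rec (hu : ¬ IsRootOfUnity q) (A : Matrix n n (Lau K ρ)) (k : ℕ) :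
    (nSeq q A k).map (Lau.sigma q) * A =
      (q : K) ^ k • nSeq q A k + ((q : K) ^ k * ((q : K) ^ (k + 1) - 1)) • nSeq q A (k + 1) := by
  have h1 : (q : K) ^ (k + 1) - 1 ≠ 0 :=
    sub_ne_zero.2 (not_isRootOfUnity_iff.1 hu _ (Nat.succ_pos k))
  have h2 : (q : K) ^ k ≠ 0 := pow_ne_zero k (coe_ne_zero q)
  rw [nSeq, smul_smul, mul_assoc, mul_inv_cancel₀ h1, mul_one, smul_sub, smul_smul,
    mul_inv_cancel₀ h2, one_smul]
  abel

/-- The `nSeq q A k` are the divided differences of the iterates of `σ_q`. Passing from `a` to `a +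
1` applies `σ_q` and multiplies by `A`; `nSeq_rec` on the coefficients matches
`eval_newton_succ_pow` on the polynomials. -/
theorem sum_newton_nSeq (hu : ¬ IsRootOfUnity q) (A : Matrix n n (Lau K ρ)) (a : ℕ) :
    ∑ k ∈ Finset.range (a + 1), (newton (q : K) k).eval ((q : K) ^ a - 1) • nSeq q A k =
      cocyc q A a := by
  induction a with
  | zero => simp [newton, nSeq, cocyc]
  | succ a ih =>
    set P := fun k => (newton (q : K) k).eval ((q : K) ^ a - 1) with hP
    have hP0 : P (a + 1) = 0 := eval_newton_pow_eq_zero (Nat.lt_succ_self a)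
    have hsig : ∀ (c : K) (M : Matrix n n (Lau K ρ)),
        (c • M).map (Lau.sigma q) = c • M.map (Lau.sigma q) := fun c M => by
      ext1 i j
      exact Lau.sigma_smul q c (M i j)
    have h1 : (cocyc q A a).map (Lau.sigma q) * A = ∑ k ∈ Finset.range (a + 1),
        (P k * (q : K) ^ k) • nSeq q A k + ∑ k ∈ Finset.range (a + 1),
        (P k * ((q : K) ^ k * ((q : K) ^ (k + 1) - 1))) • nSeq q A (k + 1) := by
      rw [← ih, ← Finset.sum_add_distrib]
      have : (∑ k ∈ Finset.range (a + 1), P k • nSeq q A k).map (Lau.sigma q) =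
          ∑ k ∈ Finset.range (a + 1), (P k • nSeq q A k).map (Lau.sigma q) := by
        ext1 i j
        simp [Matrix.sum_apply]
      rw [this, Finset.sum_mul]
      refine Finset.sum_congr rfl fun k _ => ?_
      rw [hsig, smul_mul_assoc, nSeq_rec hu, smul_add, smul_smul, smul_smul]
    -- The polynomial of index `a + 1` vanishes at `q^a - 1`, so the range may be extended by one
    -- before the term `k = 0` is split off.
    have h2 : ∑ k ∈ Finset.range (a + 1), (P k * (q : K) ^ k) • nSeq q A k =
        ∑ k ∈ Finset.range (a + 1), (P (k + 1) * (q : K) ^ (k + 1)) • nSeq q A (k + 1) +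
          nSeq q A 0 := by
      have : ∑ k ∈ Finset.range (a + 1), (P k * (q : K) ^ k) • nSeq q A k =
          ∑ k ∈ Finset.range (a + 2), (P k * (q : K) ^ k) • nSeq q A k := by
        rw [Finset.sum_range_succ _ (a + 1), hP0, zero_mul, zero_smul, add_zero]
      rw [this, Finset.sum_range_succ']
      simp [hP, newton]
    rw [cocyc, h1, h2, Finset.sum_range_succ', add_right_comm, ← Finset.sum_add_distrib]
    congr 1
    · refine Finset.sum_congr rfl fun k _ => ?_
      rw [eval_newton_succ_pow, ← add_smul]
      congr 1
      simp only [hP]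
      ring
    · simp [newton]

/-! ### Newton series and interpolations determine each other -/

section Newton

variable (hq : ‖(q : K) - 1‖ ≤ s) (hs : 0 < s)

include hq hs

/-- The Newton series is rearranged into powers of `z` by a weighted triangular matrix, which is
allowed because `|q - 1| ≤ s`. At a node it reduces to the finite sum `sum_newton_nSeq`. -/
theorem interp_newtonSer (hu : ¬ IsRootOfUnity q) {A : Matrix n n (Lau K ρ)}
    (hN : ∀ i j, Decays s fun k => nSeq q A k i j) :
    Interp s q A (newtonSer (q : K) (nSeq q A)) := by
  have hq1 : ‖(q : K)‖ ≤ 1 := by simp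
  refine ⟨fun i j => isRestricted_mk.2 (decays_transform hs (fun _ _ => coeff_newton_eq_zero)
    (norm_coeff_newton_le hq1 hq) (hN i j)), fun a => ?_⟩
  rw [← sum_newton_nSeq hu]
  ext1 i j
  have h := tsum_transform hs (fun _ _ => coeff_newton_eq_zero) (norm_coeff_newton_le hq1 hq)
    (hN i j) (norm_pow_le_pow (norm_coe_pow_sub_one_le hq a))
  rw [Matrix.map_apply, newtonSer, ev]
  simp only [coeff_mk]
  rw [h, Matrix.sum_apply]
  simp only [sum_coeff_newton, Matrix.smul_apply]
  exact tsum_newton _ a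

/-- Conversely `W` is expanded in Newton polynomials with the inverse triangular matrix. The
coefficients obtained have the same values at the nodes as `nSeq`, and those values determine them.
-/
theorem Interp.decays (hu : ¬ IsRootOfUnity q) {A : Matrix n n (Lau K ρ)}
    {W : Matrix n n (Lau K ρ)⟦X⟧} (hW : Interp s q A W) (i j : n) :
    Decays s fun k => nSeq q A k i j := by
  have hq1 : ‖(q : K)‖ ≤ 1 := by simp
  have hD := isRestricted_iff_decays.1 (hW.1 i j)
  have e : (fun k => nSeq q A k i j) = transform (newtonInv (q : K)) fun k => coeff k (W i j) := by
    refine newton_unique (coe_ne_zero q) (not_isRootOfUnity_iff.1 hu) fun a => ?_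
    have h := tsum_transform hs (fun _ _ => newtonInv_eq_zero) (norm_newtonInv_le hq1 hq) hD
      (norm_eval_newton_le hq1 hq (norm_coe_pow_sub_one_le hq a))
    rw [tsum_newton] at h
    rw [h]
    simp only [sum_newtonInv]
    have h2 := congrFun (congrFun ((hW.2 a).trans (sum_newton_nSeq hu A a).symm) i) j
    rw [Matrix.map_apply, Matrix.sum_apply] at h2
    exact h2.symm
  rw [e]
  exact decays_transform hs (fun _ _ => newtonInv_eq_zero) (norm_newtonInv_le hq1 hq) hD

theorem Interp.eq_newtonSer {p : ℕ} [Fact p.Prime] (hp : ‖(p : K)‖ < 1) (hs1 : s < 1)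
    (hu : ¬ IsRootOfUnity q) {A : Matrix n n (Lau K ρ)}
    {W : Matrix n n (Lau K ρ)⟦X⟧} (hW : Interp s q A W) :
    W = newtonSer (q : K) (nSeq q A) := by
  have h := interp_newtonSer hq hs hu (hW.decays hq hs hu)
  exact mres_ext hp hu hq hs hs1 hW.1 h.1 fun k => by rw [hW.2, h.2]

end Newton

end MatrixSeries

/-! ### From the base ring to the Banach algebras `Lau K ρ` -/

section Translation

open PowerSeries (X C)

variable {B : Base} {K : Type u} [NormedField K] [CompleteSpace K] [IsUltrametricDist K]
  {ρ : Set.Ioi (0 : ℝ)}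

/-- The elements of the base ring which converge on `|T| = ρ`. -/
noncomputable def convSubring (B : Base) (K : Type u) [NormedField K] [CompleteSpace K]
    [IsUltrametricDist K] (ρ : Set.Ioi (0 : ℝ)) : Subring (Fn B K) where
  carrier := {f | ConvAt (ρ : ℝ) f.coeff}
  mul_mem' hf hg := hf.conv ρ.2 hg
  one_mem' := ConvAt.single 0 1
  add_mem' hf hg := hf.add ρ.2 hg
  zero_mem' := ConvAt.zero
  neg_mem' hf := hf.neg

theorem mono_mem (k : ℤ) (c : K) : (mono k c : Fn B K) ∈ convSubring B K ρ := ConvAt.single k c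

theorem sigma_mem {q : Q K} {f : Fn B K} (hf : f ∈ convSubring B K ρ) :
    sigma q f ∈ convSubring B K ρ := (Lau.sigma q (Lau.mk f.coeff hf)).conv_coeff

theorem delta_mem {f : Fn B K} (hf : f ∈ convSubring B K ρ) :
    delta f ∈ convSubring B K ρ := (Lau.delta (Lau.mk f.coeff hf)).conv_coeff

open Classical in
/-- The Laurent series of `f` as an element of `Lau K ρ` (zero if it does not converge). -/
noncomputable def toLau (ρ : Set.Ioi (0 : ℝ)) (f : Fn B K) : Lau K ρ :=
  if h : f ∈ convSubring B K ρ then Lau.mk f.coeff h else 0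

theorem toLau_eq {f : Fn B K} (hf : f ∈ convSubring B K ρ) : toLau ρ f = Lau.mk f.coeff hf :=
  dif_pos hf

theorem coeff_toLau {f : Fn B K} (hf : f ∈ convSubring B K ρ) : (toLau ρ f).coeff = f.coeff := by
  rw [toLau_eq hf]; rfl

theorem toLau_inj {f g : Fn B K} (hf : f ∈ convSubring B K ρ) (hg : g ∈ convSubring B K ρ)
    (h : toLau ρ f = toLau ρ g) : f = g :=
  Fn.ext (by rw [← coeff_toLau hf, ← coeff_toLau hg, h])

theorem toLau_zero : toLau ρ (0 : Fn B K) = 0 := (toLau_eq (zero_mem _)).trans rfl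

theorem toLau_one : toLau ρ (1 : Fn B K) = 1 := (toLau_eq (one_mem _)).trans rfl

theorem toLau_add {f g : Fn B K} (hf : f ∈ convSubring B K ρ) (hg : g ∈ convSubring B K ρ) :
    toLau ρ (f + g) = toLau ρ f + toLau ρ g := by
  rw [toLau_eq hf, toLau_eq hg, toLau_eq (add_mem hf hg)]; rfl

theorem toLau_sub {f g : Fn B K} (hf : f ∈ convSubring B K ρ) (hg : g ∈ convSubring B K ρ) :
    toLau ρ (f - g) = toLau ρ f - toLau ρ g := by
  rw [toLau_eq hf, toLau_eq hg, toLau_eq (sub_mem hf hg)]; rfl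

theorem toLau_mul {f g : Fn B K} (hf : f ∈ convSubring B K ρ) (hg : g ∈ convSubring B K ρ) :
    toLau ρ (f * g) = toLau ρ f * toLau ρ g := by
  rw [toLau_eq hf, toLau_eq hg, toLau_eq (mul_mem hf hg)]; rfl

theorem toLau_sum {ι : Type*} {t : Finset ι} {f : ι → Fn B K}
    (hf : ∀ i ∈ t, f i ∈ convSubring B K ρ) :
    toLau ρ (∑ i ∈ t, f i) = ∑ i ∈ t, toLau ρ (f i) := by
  classical
  induction t using Finset.induction_on with
  | empty => simp [toLau_zero]
  | insert a t ha ih =>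
    have h1 := hf a (Finset.mem_insert_self a t)
    have h2 : ∀ i ∈ t, f i ∈ convSubring B K ρ := fun i hi => hf i (Finset.mem_insert_of_mem hi)
    rw [Finset.sum_insert ha, Finset.sum_insert ha, toLau_add h1 (sum_mem h2), ih h2]

theorem toLau_mono (k : ℤ) (c : K) : toLau ρ (mono k c : Fn B K) = Lau.mono k c :=
  (toLau_eq (mono_mem k c)).trans rfl

theorem toLau_mono_mul (k : ℤ) (c : K) {f : Fn B K} (hf : f ∈ convSubring B K ρ) :
    toLau ρ (mono k c * f) = Lau.mono k c * toLau ρ f := by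
  rw [toLau_mul (mono_mem k c) hf, toLau_mono]

theorem Lau.mono_mul_eq_smul (k : ℤ) (c : K) (f : Lau K ρ) :
    Lau.mono k c * f = c • (Lau.mono k 1 * f) :=
  Lau.ext fun i => by
    rw [Lau.coeff_smul, Lau.coeff_mono_mul, Lau.coeff_mono_mul, one_mul]

theorem Lau.mono_zero_mul (c : K) (f : Lau K ρ) : Lau.mono 0 c * f = c • f :=
  Lau.ext fun i => by
    rw [Lau.coeff_smul, Lau.coeff_mono_mul, sub_zero]

theorem Lau.mono_mul_mono_mul (j k : ℤ) (c d : K) (f : Lau K ρ) :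
    Lau.mono j c * (Lau.mono k d * f) = Lau.mono (j + k) (c * d) * f :=
  Lau.ext fun i => by
    rw [Lau.coeff_mono_mul, Lau.coeff_mono_mul, Lau.coeff_mono_mul, mul_assoc, sub_sub]

theorem toLau_sigma (q : Q K) {f : Fn B K} (hf : f ∈ convSubring B K ρ) :
    toLau ρ (sigma q f) = Lau.sigma q (toLau ρ f) := by
  rw [toLau_eq hf, toLau_eq (sigma_mem hf)]; rfl

theorem toLau_delta {f : Fn B K} (hf : f ∈ convSubring B K ρ) :
    toLau ρ (delta f) = Lau.delta (toLau ρ f) := by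
  rw [toLau_eq hf, toLau_eq (delta_mem hf)]; rfl

theorem ddT_mem {f : Fn B K} (hf : f ∈ convSubring B K ρ) : ddT f ∈ convSubring B K ρ :=
  mul_mem (mono_mem _ _) (delta_mem hf)

theorem ddT_iterate_mem {f : Fn B K} (hf : f ∈ convSubring B K ρ) (k : ℕ) :
    ddT^[k] f ∈ convSubring B K ρ := by
  induction k with
  | zero => exact hf
  | succ k ih =>
    rw [Function.iterate_succ_apply']
    exact ddT_mem ih

theorem Lau.delta_mono_mul (k : ℤ) (c : K) (f : Lau K ρ) :
    Lau.delta (Lau.mono k c * f) =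
      (k : K) • (Lau.mono k c * f) + Lau.mono k c * Lau.delta f :=
  Lau.ext fun i => by
    rw [Lau.coeff_delta, Lau.coeff_add, Lau.coeff_smul, Lau.coeff_mono_mul, Lau.coeff_mono_mul,
      Lau.coeff_delta]
    push_cast
    ring

theorem Lau.sigma_mono_mul (q : Q K) (k : ℤ) (c : K) (f : Lau K ρ) :
    Lau.sigma q (Lau.mono k c * f) = (q : K) ^ k • (Lau.mono k c * Lau.sigma q f) :=
  Lau.ext fun i => by
    rw [Lau.coeff_sigma, Lau.coeff_smul, Lau.coeff_mono_mul, Lau.coeff_mono_mul, Lau.coeff_sigma]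
    have : (q : K) ^ i = (q : K) ^ k * (q : K) ^ (i - k) := by
      rw [← zpow_add₀ (ne_zero_of_mem_unit_sphere q)]; congr 1; ring
    rw [this]
    ring

variable [CharZero K]

/-- `Tᵏ (d/dT)ᵏ f / k!` is the `k`-th Taylor coefficient. -/
theorem mono_mul_ddT_iterate {f : Fn B K} (hf : f ∈ convSubring B K ρ) (k : ℕ) :
    Lau.mono k ((k.factorial : K)⁻¹) * toLau ρ (ddT^[k] f) = Lau.hasse k (toLau ρ f) := by
  induction k with
  | zero => rw [Nat.factorial_zero, Nat.cast_one, inv_one, Nat.cast_zero, Lau.mono_zero_mul,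
      one_smul, Lau.hasse_zero]; rfl
  | succ k ih =>
    have hk : (k : K) + 1 ≠ 0 := by exact_mod_cast Nat.succ_ne_zero k
    have h := Lau.succ_smul_hasse k (toLau ρ f)
    rw [← ih, Lau.delta_mono_mul, Int.cast_natCast, add_sub_cancel_left] at h
    have hmem := ddT_iterate_mem hf k
    rw [Function.iterate_succ_apply', ddT, toLau_mono_mul _ _ (delta_mem hmem), toLau_delta hmem,
      Lau.mono_mul_mono_mul]
    apply smul_right_injective (Lau K ρ) hk
    simp only
    rw [h, ← smul_one_mul]
    have e : ((k + 1 : ℕ) : ℤ) + -1 = k := by push_cast; ring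
    rw [e, mul_one, smul_one_mul, Lau.mono_mul_eq_smul, Lau.mono_mul_eq_smul (c := _⁻¹), smul_smul,
      Nat.factorial_succ]
    congr 1
    push_cast
    field_simp

/-! ### Matrices over the base ring -/

/-- The entries of `A` converge on `|T| = ρ`. -/
def MConv (ρ : Set.Ioi (0 : ℝ)) {m n : ℕ} (A : Matrix (Fin m) (Fin n) (Fn B K)) : Prop :=
  ∀ i j, A i j ∈ convSubring B K ρ

/-- The matrix of the `toLau ρ (A i j)`. -/
noncomputable def toLauM (ρ : Set.Ioi (0 : ℝ)) {m n : ℕ} (A : Matrix (Fin m) (Fin n) (Fn B K)) :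
    Matrix (Fin m) (Fin n) (Lau K ρ) := A.map (toLau ρ)

section Mat

variable {l m n : ℕ}

theorem toLauM_apply (A : Matrix (Fin m) (Fin n) (Fn B K)) (i : Fin m) (j : Fin n) :
    toLauM ρ A i j = toLau ρ (A i j) := rfl

theorem MConv.one : MConv ρ (1 : Matrix (Fin n) (Fin n) (Fn B K)) := fun i j => by
  rw [Matrix.one_apply]
  split_ifs
  exacts [one_mem _, zero_mem _]

theorem toLauM_one : toLauM ρ (1 : Matrix (Fin n) (Fin n) (Fn B K)) = 1 := by
  ext1 i j
  rw [toLauM_apply, Matrix.one_apply, Matrix.one_apply]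
  split_ifs
  exacts [toLau_one, toLau_zero]

theorem MConv.mul {A : Matrix (Fin l) (Fin m) (Fn B K)} {A' : Matrix (Fin m) (Fin n) (Fn B K)}
    (hA : MConv ρ A) (hA' : MConv ρ A') : MConv ρ (A * A') := fun i j => by
  rw [Matrix.mul_apply]
  exact sum_mem fun k _ => mul_mem (hA i k) (hA' k j)

theorem toLauM_mul {A : Matrix (Fin l) (Fin m) (Fn B K)} {A' : Matrix (Fin m) (Fin n) (Fn B K)}
    (hA : MConv ρ A) (hA' : MConv ρ A') : toLauM ρ (A * A') = toLauM ρ A * toLauM ρ A' := by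
  ext1 i j
  rw [toLauM_apply, Matrix.mul_apply, toLau_sum fun k _ => mul_mem (hA i k) (hA' k j),
    Matrix.mul_apply]
  exact Finset.sum_congr rfl fun k _ => toLau_mul (hA i k) (hA' k j)

theorem toLauM_inj {A A' : Matrix (Fin m) (Fin n) (Fn B K)} (hA : MConv ρ A) (hA' : MConv ρ A')
    (h : toLauM ρ A = toLauM ρ A') : A = A' := by
  ext1 i j
  exact toLau_inj (hA i j) (hA' i j) (congrFun (congrFun h i) j)

theorem toLauM_sigma (q : Q K) {A : Matrix (Fin m) (Fin n) (Fn B K)} (hA : MConv ρ A) :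
    toLauM ρ (A.map (sigma q)) = (toLauM ρ A).map (Lau.sigma q) := by
  ext1 i j
  exact toLau_sigma q (hA i j)

theorem toLauM_delta {A : Matrix (Fin m) (Fin n) (Fn B K)} (hA : MConv ρ A) :
    toLauM ρ (A.map delta) = (toLauM ρ A).map Lau.delta := by
  ext1 i j
  exact toLau_delta (hA i j)

theorem toLauM_add {A A' : Matrix (Fin m) (Fin n) (Fn B K)} (hA : MConv ρ A) (hA' : MConv ρ A') :
    toLauM ρ (A + A') = toLauM ρ A + toLauM ρ A' := by
  ext1 i j
  exact toLau_add (hA i j) (hA' i j)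

/-- The matrices `Tᵏ H_k / [k]_q^!`. -/
noncomputable def nMat (q : Q K) (A : Matrix (Fin n) (Fin n) (Fn B K)) (k : ℕ) :
    Matrix (Fin n) (Fin n) (Fn B K) :=
  (mono k ((qFactorial (q : K) k)⁻¹) : Fn B K) • Hmat q A k

/-- The matrices `Tᵏ G_{[k]} / k!`. -/
noncomputable def wMat (G : Matrix (Fin n) (Fin n) (Fn B K)) (k : ℕ) :
    Matrix (Fin n) (Fin n) (Fn B K) :=
  (mono k ((k.factorial : K)⁻¹) : Fn B K) • Gmat G k

/-- The two terms in `σ_q(H_k)` without the factor `A` cancel. The remaining form corresponds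
directly to the recursion of `nSeq`. -/
theorem Hmat_succ (q : Q K) (A : Matrix (Fin n) (Fin n) (Fn B K)) (k : ℕ) :
    Hmat q A (k + 1) = (mono (-1) ((q : K) - 1)⁻¹ : Fn B K) •
      ((Hmat q A k).map (sigma q) * A - Hmat q A k) := by
  have h : (Hmat q A k).map (dq q) = (mono (-1) ((q : K) - 1)⁻¹ : Fn B K) •
      ((Hmat q A k).map (sigma q) - Hmat q A k) := rfl
  rw [Hmat, h, Matrix.mul_smul, ← smul_add, Matrix.mul_sub, Matrix.mul_one]
  congr 1
  abel

theorem MConv.smul_mono {A : Matrix (Fin m) (Fin n) (Fn B K)} (hA : MConv ρ A) (k : ℤ) (c : K) :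
    MConv ρ ((mono k c : Fn B K) • A) := fun i j => mul_mem (mono_mem k c) (hA i j)

theorem toLauM_mono_smul {A : Matrix (Fin m) (Fin n) (Fn B K)} (hA : MConv ρ A) (k : ℤ) (c : K) :
    toLauM ρ ((mono k c : Fn B K) • A) = c • (toLauM ρ A).map (fun f => Lau.mono k 1 * f) := by
  ext1 i j
  rw [toLauM_apply, Matrix.smul_apply, smul_eq_mul, toLau_mono_mul _ _ (hA i j),
    Lau.mono_mul_eq_smul, Matrix.smul_apply, Matrix.map_apply, toLauM_apply]

theorem MConv.Hmat {A : Matrix (Fin n) (Fin n) (Fn B K)} (hA : MConv ρ A) (q : Q K) (k : ℕ) :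
    MConv ρ (Hmat q A k) := by
  induction k with
  | zero => exact MConv.one
  | succ k ih =>
    rw [Hmat_succ]
    refine MConv.smul_mono (fun i j => ?_) _ _
    exact sub_mem (MConv.mul (A := (QConf.Hmat q A k).map (sigma q))
      (fun i j => sigma_mem (ih i j)) hA i j) (ih i j)

theorem Gmat_succ (G : Matrix (Fin n) (Fin n) (Fn B K)) (k : ℕ) :
    Gmat G (k + 1) = (mono (-1) 1 : Fn B K) • ((Gmat G k).map delta + Gmat G k * G) := by
  rw [Gmat, Matrix.mul_smul, smul_add]
  rfl

theorem MConv.Gmat {G : Matrix (Fin n) (Fin n) (Fn B K)} (hG : MConv ρ G) (k : ℕ) :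
    MConv ρ (Gmat G k) := by
  induction k with
  | zero => exact MConv.one
  | succ k ih =>
    rw [Gmat_succ]
    refine MConv.smul_mono (fun i j => ?_) _ _
    exact add_mem (delta_mem (ih i j)) (ih.mul hG i j)

theorem qFactorial_succ (q : K) (k : ℕ) :
    qFactorial q (k + 1) = qFactorial q k * ∑ j ∈ Finset.range (k + 1), q ^ j :=
  Finset.prod_range_succ _ _

theorem geom_ne_zero {q : Q K} (hu : ¬ IsRootOfUnity q) (k : ℕ) :
    ∑ j ∈ Finset.range (k + 1), (q : K) ^ j ≠ 0 := by
  intro h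
  have := geom_sum_mul (q : K) (k + 1)
  rw [h, zero_mul, eq_comm, sub_eq_zero] at this
  exact not_isRootOfUnity_iff.1 hu _ (Nat.succ_pos k) this

theorem qFactorial_ne_zero {q : Q K} (hu : ¬ IsRootOfUnity q) (k : ℕ) :
    qFactorial (q : K) k ≠ 0 :=
  Finset.prod_ne_zero_iff.2 fun i _ => geom_ne_zero hu i

theorem mono_zero_one : (mono 0 1 : Fn B K) = 1 := rfl

theorem nMat_zero (q : Q K) (A : Matrix (Fin n) (Fin n) (Fn B K)) : nMat q A 0 = 1 := by
  rw [nMat, Hmat, qFactorial, Finset.range_zero, Finset.prod_empty, inv_one, Nat.cast_zero,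
    mono_zero_one, one_smul]

theorem wMat_zero (G : Matrix (Fin n) (Fin n) (Fn B K)) : wMat G 0 = 1 := by
  rw [wMat, Gmat, Nat.factorial_zero, Nat.cast_one, inv_one, Nat.cast_zero,
    mono_zero_one, one_smul]

/-- Multiplication by `Tᵏ` makes the coefficients homogeneous in `z`. The factor `q^{-k}` in `nSeq`
compensates `σ_q(Tᵏ) = qᵏ Tᵏ`, and `(q - 1)` times the `q`-integer of `k + 1` is `q^{k+1} - 1`. -/
theorem toLauM_nMat {A : Matrix (Fin n) (Fin n) (Fn B K)} (hA : MConv ρ A) {q : Q K}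
    (hu : ¬ IsRootOfUnity q) (k : ℕ) : toLauM ρ (nMat q A k) = nSeq q (toLauM ρ A) k := by
  have hq1 : (q : K) - 1 ≠ 0 := by
    have := not_isRootOfUnity_iff.1 hu 1 one_pos
    rw [pow_one] at this
    exact sub_ne_zero.2 this
  induction k with
  | zero => rw [nMat_zero, toLauM_one, nSeq]
  | succ k ih =>
    have hH := hA.Hmat q k
    have hHs : MConv ρ ((Hmat q A k).map (sigma q)) := fun i j => sigma_mem (hH i j)
    rw [nSeq, ← ih]
    have e1 : toLauM ρ (nMat q A k) =
        (qFactorial (q : K) k)⁻¹ • (toLauM ρ (Hmat q A k)).map (fun f => Lau.mono k 1 * f) := by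
      rw [nMat, toLauM_mono_smul hH]
    have e2 : (toLauM ρ (nMat q A k)).map (Lau.sigma q) * toLauM ρ A =
        ((q : K) ^ k * (qFactorial (q : K) k)⁻¹) •
          (toLauM ρ ((Hmat q A k).map (sigma q) * A)).map (fun f => Lau.mono k 1 * f) := by
      rw [toLauM_mul hHs hA, toLauM_sigma q hH, e1]
      ext1 i j
      rw [Matrix.mul_apply, Matrix.smul_apply, Matrix.map_apply, Matrix.mul_apply, Finset.mul_sum,
        Finset.smul_sum]
      refine Finset.sum_congr rfl fun a _ => ?_
      rw [Matrix.map_apply, Matrix.smul_apply, Matrix.map_apply, Lau.sigma_smul,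
        Lau.sigma_mono_mul, zpow_natCast, Matrix.map_apply, smul_smul, mul_comm (_⁻¹),
        smul_mul_assoc, mul_assoc]
    rw [e2, e1]
    ext1 i j
    have hmem : ((Hmat q A k).map (sigma q) * A - Hmat q A k) i j ∈ convSubring B K ρ :=
      sub_mem (hHs.mul hA i j) (hH i j)
    rw [toLauM_apply, nMat, Hmat_succ, Matrix.smul_apply, Matrix.smul_apply, smul_eq_mul,
      smul_eq_mul, toLau_mono_mul _ _ (mul_mem (mono_mem _ _) hmem), toLau_mono_mul _ _ hmem,
      Lau.mono_mul_mono_mul, Matrix.sub_apply, toLau_sub (hHs.mul hA i j) (hH i j)]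
    have e : ((k + 1 : ℕ) : ℤ) + -1 = k := by push_cast; ring
    have hk0 : (q : K) ^ k ≠ 0 := pow_ne_zero k (coe_ne_zero q)
    rw [e, Lau.mono_mul_eq_smul, mul_sub, smul_smul, inv_mul_cancel_left₀ hk0, ← smul_sub,
      smul_smul, Matrix.smul_apply]
    congr 1
    rw [← geom_sum_mul, qFactorial_succ, mul_inv, mul_inv]
    ring

/-- The analogue for the connection: the term `-k` in the recursion of `wSeq` compensates `δ₁(Tᵏ) =
k Tᵏ`. -/
theorem toLauM_wMat {G : Matrix (Fin n) (Fin n) (Fn B K)} (hG : MConv ρ G) (k : ℕ) :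
    toLauM ρ (wMat G k) = wSeq (toLauM ρ G) k := by
  induction k with
  | zero => rw [wMat_zero, toLauM_one, wSeq]
  | succ k ih =>
    have hH := hG.Gmat k
    rw [wSeq, ← ih]
    have e1 : toLauM ρ (wMat G k) =
        (k.factorial : K)⁻¹ • (toLauM ρ (Gmat G k)).map (fun f => Lau.mono k 1 * f) := by
      rw [wMat, toLauM_mono_smul hH]
    have e2 : toLauM ρ (wMat G k) * toLauM ρ G = (k.factorial : K)⁻¹ •
          (toLauM ρ (Gmat G k * G)).map (fun f => Lau.mono k 1 * f) := by
      rw [toLauM_mul hH hG, e1]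
      ext1 i j
      rw [Matrix.mul_apply, Matrix.smul_apply, Matrix.map_apply, Matrix.mul_apply, Finset.mul_sum,
        Finset.smul_sum]
      refine Finset.sum_congr rfl fun a _ => ?_
      rw [Matrix.smul_apply, Matrix.map_apply, smul_mul_assoc, mul_assoc]
    rw [e2, e1]
    ext1 i j
    have hd := delta_mem (hH i j)
    have hm := hH.mul hG i j
    rw [toLauM_apply, wMat, Gmat_succ, Matrix.smul_apply, Matrix.smul_apply, smul_eq_mul,
      smul_eq_mul, Matrix.add_apply, Matrix.map_apply,
      toLau_mono_mul _ _ (mul_mem (mono_mem _ _) (add_mem hd hm)),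
      toLau_mono_mul _ _ (add_mem hd hm), Lau.mono_mul_mono_mul, toLau_add hd hm,
      toLau_delta (hH i j)]
    have e : ((k + 1 : ℕ) : ℤ) + -1 = k := by push_cast; ring
    have h3 := Lau.delta_mono_mul (ρ := ρ) k 1 (toLau ρ (Gmat G k i j))
    rw [Int.cast_natCast] at h3
    simp only [Matrix.smul_apply, Matrix.add_apply, Matrix.sub_apply, Matrix.map_apply,
      toLauM_apply, map_smul, h3]
    rw [e, Lau.mono_mul_eq_smul, mul_add, Nat.factorial_succ]
    push_cast
    rw [mul_inv]
    module

end Mat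

end Translation

/-! ### Convergence at generic points -/

section Sums

open PowerSeries (X C)

/-- Convergent partial sums have general term tending to `0`, which in a complete ultrametric group
already gives unconditional summability. -/
theorem hasSum_iff_tendsto_range {E : Type*} [NormedAddCommGroup E] [CompleteSpace E]
    [IsUltrametricDist E] {f : ℕ → E} {a : E} :
    HasSum f a ↔ Tendsto (fun N => ∑ k ∈ Finset.range N, f k) atTop (𝓝 a) := by
  refine ⟨fun h => h.tendsto_sum_nat, fun h => ?_⟩
  have h0 : Tendsto f cofinite (𝓝 0) := by
    rw [Nat.cofinite_eq_atTop]
    have h1 := ((tendsto_add_atTop_iff_nat 1).2 h).sub h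
    rw [sub_self] at h1
    exact h1.congr fun N => by rw [Finset.sum_range_succ, add_sub_cancel_left]
  have hs := NonarchimedeanAddGroup.summable_of_tendsto_cofinite_zero h0
  rw [tendsto_nhds_unique h hs.hasSum.tendsto_sum_nat]
  exact hs.hasSum

variable {B : Base} {K : Type u} [NormedField K] [CompleteSpace K] [IsUltrametricDist K]
  {ρ : Set.Ioi (0 : ℝ)} {l m n : ℕ}

theorem gaussNorm_eq {f : Fn B K} (hf : f ∈ convSubring B K ρ) :
    gaussNorm (ρ : ℝ) f = ENNReal.ofReal ‖toLau ρ f‖ := by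
  have hc := coeff_toLau hf
  refine le_antisymm (iSup_le fun i => ENNReal.ofReal_le_ofReal ?_) ?_
  · rw [← hc]
    exact Lau.le_norm _ i
  · have hlt : gaussNorm (ρ : ℝ) f ≠ ⊤ := by
      refine ne_top_of_le_ne_top (ENNReal.ofReal_ne_top (r := ‖toLau ρ f‖))
        (iSup_le fun i => ENNReal.ofReal_le_ofReal ?_)
      rw [← hc]
      exact Lau.le_norm _ i
    refine ENNReal.ofReal_le_of_le_toReal (Lau.norm_le fun i => ?_)
    rw [hc, ← ENNReal.ofReal_le_iff_le_toReal hlt]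
    exact le_iSup (fun i : ℤ => ENNReal.ofReal (‖f.coeff i‖ * (ρ : ℝ) ^ i)) i

theorem gaussNorm_le_matNorm (r : ℝ) (A : Matrix (Fin n) (Fin n) (Fn B K)) (i j : Fin n) :
    gaussNorm r (A i j) ≤ matNorm r A :=
  le_iSup₂ (f := fun i j => gaussNorm r (A i j)) i j

theorem matNorm_le_sum (r : ℝ) (A : Matrix (Fin n) (Fin n) (Fn B K)) :
    matNorm r A ≤ ∑ i, ∑ j, gaussNorm r (A i j) :=
  iSup₂_le fun i j => (Finset.single_le_sum (f := fun j => gaussNorm r (A i j))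
    (fun _ _ => zero_le) (Finset.mem_univ j)).trans
    (Finset.single_le_sum (f := fun i => ∑ j, gaussNorm r (A i j))
    (fun _ _ => zero_le) (Finset.mem_univ i))

theorem tendsto_matNorm_zero {ι : Type*} {l : Filter ι} {r : ℝ}
    {A : ι → Matrix (Fin n) (Fin n) (Fn B K)} :
    Tendsto (fun a => matNorm r (A a)) l (𝓝 0) ↔
      ∀ i j, Tendsto (fun a => gaussNorm r (A a i j)) l (𝓝 0) := by
  refine ⟨fun h i j => ?_, fun h => ?_⟩
  · exact tendsto_of_tendsto_of_tendsto_of_le_of_le tendsto_const_nhds h (fun _ => zero_le)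
      fun a => gaussNorm_le_matNorm r (A a) i j
  · have h1 : Tendsto (fun a => ∑ i, ∑ j, gaussNorm r (A a i j)) l (𝓝 0) := by
      have := tendsto_finsetSum (Finset.univ : Finset (Fin n)) fun i _ =>
        tendsto_finsetSum (Finset.univ : Finset (Fin n)) fun j _ => h i j
      simpa using this
    exact tendsto_of_tendsto_of_tendsto_of_le_of_le tendsto_const_nhds h1 (fun _ => zero_le)
      fun a => matNorm_le_sum r (A a)

theorem sumsAt_iff_hasSum {F : ℕ → Matrix (Fin n) (Fin n) (Fn B K)}
    {L : Matrix (Fin n) (Fin n) (Fn B K)} (hF : ∀ k, MConv ρ (F k)) (hL : MConv ρ L) :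
    SumsAt (ρ : ℝ) F L ↔ ∀ i j, HasSum (fun k => toLau ρ (F k i j)) (toLau ρ (L i j)) := by
  rw [SumsAt, tendsto_matNorm_zero]
  refine forall₂_congr fun i j => ?_
  rw [hasSum_iff_tendsto_range, tendsto_iff_norm_sub_tendsto_zero]
  have e : ∀ N, gaussNorm (ρ : ℝ) ((∑ k ∈ Finset.range N, F k - L) i j) =
      ENNReal.ofReal ‖∑ k ∈ Finset.range N, toLau ρ (F k i j) - toLau ρ (L i j)‖ := by
    intro N
    have hS : ∑ k ∈ Finset.range N, F k i j ∈ convSubring B K ρ := sum_mem fun k _ => hF k i j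
    rw [Matrix.sub_apply, Matrix.sum_apply, gaussNorm_eq (sub_mem hS (hL i j)),
      toLau_sub hS (hL i j), toLau_sum fun k _ => hF k i j]
  simp only [e]
  refine ⟨fun h => ?_, fun h => ?_⟩
  · have := (ENNReal.tendsto_toReal ENNReal.zero_ne_top).comp h
    simpa [Function.comp_def] using this
  · simpa using ENNReal.tendsto_ofReal h

/-- A series of elements of the base ring which converges on all circles of an annulus. -/
theorem exists_hasSum {ε : ℝ} (h0 : 0 < ε) (h1 : ε < 1) {F : ℕ → Fn B K}
    (hF : ∀ ρ : Set.Ioi (0 : ℝ), (ρ : ℝ) ∈ B.I ε → ∀ k, F k ∈ convSubring B K ρ)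
    (hs : ∀ ρ : Set.Ioi (0 : ℝ), (ρ : ℝ) ∈ B.I ε → Summable fun k => toLau ρ (F k)) :
    ∃ L : Fn B K, ∀ ρ : Set.Ioi (0 : ℝ), (ρ : ℝ) ∈ B.I ε →
      L ∈ convSubring B K ρ ∧ HasSum (fun k => toLau ρ (F k)) (toLau ρ L) := by
  -- The coefficients of the sum are computed in `K` by a formula that does not involve `ρ`. The
  -- sums on the different circles are therefore one and the same Laurent series.
  have key : ∀ ρ : Set.Ioi (0 : ℝ), (ρ : ℝ) ∈ B.I ε →
      (fun i => ∑' k, (F k).coeff i) = (∑' k, toLau ρ (F k)).coeff := by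
    intro ρ hρ
    funext i
    have h := Lau.hasSum_coeff (hs ρ hρ).hasSum i
    rw [← h.tsum_eq]
    exact tsum_congr fun k => by rw [coeff_toLau (hF ρ hρ k)]
  obtain ⟨L, hL⟩ : ∃ L : Fn B K, L.coeff = fun i => ∑' k, (F k).coeff i :=
    ⟨⟨fun i => ∑' k, (F k).coeff i, ε, h0, h1, fun r hr => by
      rw [key ⟨r, B.pos_of_mem h1 hr⟩ hr]
      exact Lau.conv_coeff _⟩, rfl⟩
  refine ⟨L, fun ρ hρ => ?_⟩
  have hmem : L ∈ convSubring B K ρ := by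
    change ConvAt (ρ : ℝ) L.coeff
    rw [hL, key ρ hρ]
    exact Lau.conv_coeff _
  have : toLau ρ L = ∑' k, toLau ρ (F k) :=
    Lau.ext fun i => by rw [coeff_toLau hmem, hL, ← key ρ hρ]
  rw [this]
  exact ⟨hmem, (hs ρ hρ).hasSum⟩

/-- The matrix version of `exists_hasSum`. -/
theorem exists_hasSum_matrix {ε : ℝ} (h0 : 0 < ε) (h1 : ε < 1)
    {F : ℕ → Matrix (Fin m) (Fin n) (Fn B K)}
    (hF : ∀ ρ : Set.Ioi (0 : ℝ), (ρ : ℝ) ∈ B.I ε → ∀ k, MConv ρ (F k))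
    (hs : ∀ ρ : Set.Ioi (0 : ℝ), (ρ : ℝ) ∈ B.I ε → ∀ i j, Summable fun k => toLau ρ (F k i j)) :
    ∃ L : Matrix (Fin m) (Fin n) (Fn B K), ∀ ρ : Set.Ioi (0 : ℝ), (ρ : ℝ) ∈ B.I ε →
      MConv ρ L ∧ ∀ i j, HasSum (fun k => toLau ρ (F k i j)) (toLau ρ (L i j)) := by
  have h := fun i j => exists_hasSum h0 h1 (F := fun k => F k i j)
    (fun ρ hρ k => hF ρ hρ k i j) (fun ρ hρ => hs ρ hρ i j)
  choose L hL using h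
  exact ⟨L, fun ρ hρ => ⟨fun i j => (hL i j ρ hρ).1, fun i j => (hL i j ρ hρ).2⟩⟩

variable [CharZero K]

theorem hasSum_mono_mul_iff (i : ℤ) {f : ℕ → Lau K ρ} {g : Lau K ρ} :
    HasSum (fun k => Lau.mono (-i) 1 * f k) g ↔ HasSum f (Lau.mono i 1 * g) := by
  constructor
  · intro h
    have := h.mul_left (Lau.mono i 1)
    refine this.congr_fun fun k => ?_
    rw [Lau.mono_mul_mono_mul, add_neg_cancel, mul_one, Lau.mono_zero_mul, one_smul]
  · intro h
    have := h.mul_left (Lau.mono (-i) 1)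
    rwa [Lau.mono_mul_mono_mul, neg_add_cancel, mul_one, Lau.mono_zero_mul, one_smul] at this

/-- With `x - y = zy`, the factor `Tⁱ` converts coefficients in powers of `x - y` into coefficients
in powers of `z`, and `(x-y)_{q,k}` becomes `yᵏ` times the Newton polynomial. -/
theorem isQTaylor_iff {s : ℝ} (hs : 0 < s) {q : Q K} (hq : ‖(q : K) - 1‖ ≤ s)
    (hu : ¬ IsRootOfUnity q) {A : Matrix (Fin n) (Fin n) (Fn B K)} (hA : MConv ρ A)
    (hN : ∀ i j, Decays s fun k => nSeq q (toLauM ρ A) k i j)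
    {Y : ℕ → Matrix (Fin n) (Fin n) (Fn B K)} (hY : ∀ i, MConv ρ (Y i)) :
    IsQTaylor (ρ : ℝ) q A Y ↔ ∀ (i : ℕ) (a b : Fin n),
      PowerSeries.coeff i (newtonSer (q : K) (nSeq q (toLauM ρ A)) a b) =
        Lau.mono i 1 * toLau ρ (Y i a b) := by
  have hq1 : ‖(q : K)‖ ≤ 1 := by simp
  refine forall_congr' fun i => ?_
  rw [sumsAt_iff_hasSum (fun k => (hA.Hmat q k).smul_mono _ _) (hY i)]
  refine forall₂_congr fun a b => ?_
  have hS := hasSum_transform hs (fun _ _ => coeff_newton_eq_zero) (norm_coeff_newton_le hq1 hq)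
    (hN a b) i
  have e : ∀ k : ℕ, toLau ρ (((mono ((k : ℤ) - i) ((qFactorial (q : K) k)⁻¹ *
      (∏ m ∈ Finset.range k, (Polynomial.X + Polynomial.C (1 - (q : K) ^ m))).coeff i)
      : Fn B K) • Hmat q A k) a b) =
      Lau.mono (-(i : ℤ)) 1 * ((newton (q : K) k).coeff i • nSeq q (toLauM ρ A) k a b) := by
    intro k
    rw [Matrix.smul_apply, smul_eq_mul, toLau_mono_mul _ _ (hA.Hmat q k a b),
      ← toLauM_nMat hA hu, nMat, toLauM_mono_smul (hA.Hmat q k), Matrix.smul_apply,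
      Matrix.map_apply, toLauM_apply, smul_smul, ← Lau.mono_mul_eq_smul, Lau.mono_mul_mono_mul, one_mul, newton,
      mul_comm (_⁻¹), sub_eq_neg_add]
  refine (iff_of_eq (congrArg (fun f : ℕ → Lau K ρ => HasSum f _) (funext e))).trans ?_
  rw [hasSum_mono_mul_iff, newtonSer, PowerSeries.coeff_mk]
  exact ⟨fun h => hS.unique h, fun h => h ▸ hS⟩

/-- In the variable `z` the map `x ↦ qx` is `z ↦ q(1+z) - 1`, so the left side of the equation has
coefficients given by `affCoeff`, and the right side is the product with the Taylor expansion of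
`A`. -/
theorem solves_iff {q : Q K} {A : Matrix (Fin n) (Fin n) (Fn B K)} (hA : MConv ρ A)
    {F : ℕ → Matrix (Fin n) (Fin n) (Fn B K)} (hF : ∀ i, MConv ρ (F i))
    {Z : Matrix (Fin n) (Fin n) (PowerSeries (Lau K ρ))}
    (hZ : ∀ k a b, PowerSeries.coeff k (Z a b) = Lau.mono k 1 * toLau ρ (F k a b)) :
    Solves (ρ : ℝ) q A F ↔ ∀ (i : ℕ) (a b : Fin n),
      HasSum (fun k => affCoeff (q : K) k i • PowerSeries.coeff k (Z a b))
        (PowerSeries.coeff i (((toLauM ρ A).map taylorHom * Z) a b)) := by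
  refine forall_congr' fun i => ?_
  have hD : ∀ k, MConv ρ (A.map (ddT^[k])) := fun k a b => ddT_iterate_mem (hA a b) k
  have hterm : ∀ x : ℕ × ℕ, MConv ρ (((mono 0 ((x.1.factorial : K)⁻¹) : Fn B K) •
      A.map (ddT^[x.1])) * F x.2) := fun x => ((hD x.1).smul_mono _ _).mul (hF x.2)
  have hR : MConv ρ (∑ x ∈ Finset.HasAntidiagonal.antidiagonal i,
      ((mono 0 ((x.1.factorial : K)⁻¹) : Fn B K) • A.map (ddT^[x.1])) * F x.2) := by
    intro a b
    rw [Matrix.sum_apply]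
    exact sum_mem fun x _ => hterm x a b
  rw [sumsAt_iff_hasSum (fun k => (hF k).smul_mono _ _) hR]
  refine forall₂_congr fun a b => ?_
  have e : ∀ k : ℕ, toLau ρ (((mono ((k : ℤ) - i)
      ((k.choose i : K) * (q : K) ^ i * ((q : K) - 1) ^ (k - i)) : Fn B K) • F k) a b) =
      Lau.mono (-(i : ℤ)) 1 * (affCoeff (q : K) k i • PowerSeries.coeff k (Z a b)) := by
    intro k
    rw [hZ, Matrix.smul_apply, smul_eq_mul, toLau_mono_mul _ _ (hF k a b), ← Lau.mono_mul_eq_smul,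
      Lau.mono_mul_mono_mul, one_mul, affCoeff, sub_eq_neg_add]
  have eR : Lau.mono i 1 * toLau ρ ((∑ x ∈ Finset.HasAntidiagonal.antidiagonal i,
      ((mono 0 ((x.1.factorial : K)⁻¹) : Fn B K) • A.map (ddT^[x.1])) * F x.2) a b) =
      PowerSeries.coeff i (((toLauM ρ A).map taylorHom * Z) a b) := by
    rw [Matrix.sum_apply, toLau_sum fun x _ => hterm x a b, Finset.mul_sum, Matrix.mul_apply,
      map_sum]
    simp only [PowerSeries.coeff_mul]
    rw [Finset.sum_comm]
    refine Finset.sum_congr rfl fun x hx => ?_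
    have hx' : (i : ℤ) = (x.1 : ℤ) + x.2 := by
      rw [← Finset.HasAntidiagonal.mem_antidiagonal.1 hx]; push_cast; rfl
    rw [Matrix.mul_apply, toLau_sum fun c _ => mul_mem ((hD x.1).smul_mono _ _ a c) (hF x.2 c b),
      Finset.mul_sum]
    refine Finset.sum_congr rfl fun c _ => ?_
    rw [toLau_mul ((hD x.1).smul_mono _ _ a c) (hF x.2 c b), Matrix.smul_apply, smul_eq_mul,
      toLau_mono_mul _ _ (hD x.1 a c), hZ, Matrix.map_apply, Matrix.map_apply, coeff_taylorHom,
      toLauM_apply, ← mono_mul_ddT_iterate (hA a c)]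
    have e1 : ∀ f g : Lau K ρ, Lau.mono i 1 * (f * g) =
        (Lau.mono x.1 1 * f) * (Lau.mono x.2 1 * g) := by
      intro f g
      have : (Lau.mono (i : ℤ) 1 : Lau K ρ) = Lau.mono x.1 1 * Lau.mono x.2 1 := by
        have h2 := Lau.mono_mul_mono_mul (ρ := ρ) (x.1 : ℤ) x.2 (1 : K) 1 1
        rw [mul_one, mul_one, mul_one, ← hx'] at h2
        exact h2.symm
      rw [this]
      ring
    rw [e1, Lau.mono_mul_mono_mul, add_zero, one_mul]
  refine (iff_of_eq (congrArg (fun f : ℕ → Lau K ρ => HasSum f _) (funext e))).trans ?_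
  rw [hasSum_mono_mul_iff, eR]

theorem MConv.dTaylor {G : Matrix (Fin n) (Fin n) (Fn B K)} (hG : MConv ρ G) (i : ℕ) :
    MConv ρ (dTaylor G i) := (hG.Gmat i).smul_mono _ _

theorem coeff_wSer_eq {G : Matrix (Fin n) (Fin n) (Fn B K)} (hG : MConv ρ G) (k : ℕ)
    (a b : Fin n) : PowerSeries.coeff k (wSer (toLauM ρ G) a b) =
      Lau.mono k 1 * toLau ρ (dTaylor G k a b) := by
  rw [coeff_wSer, ← toLauM_wMat hG, wMat, toLauM_mono_smul (hG.Gmat k), dTaylor,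
    ← toLauM_apply, toLauM_mono_smul (hG.Gmat k), Matrix.smul_apply, Matrix.smul_apply,
    Matrix.map_apply, Matrix.map_apply, Lau.mono_zero_mul, one_smul, mul_smul_comm]

/-- Only the coefficient of order `0` of the equation is used. Convergence at `q - 1` is part of
that equation, so no radius is assumed. -/
theorem hasSum_wSer_of_solves {q : Q K} {A : Matrix (Fin n) (Fin n) (Fn B K)} (hA : MConv ρ A)
    {F : ℕ → Matrix (Fin n) (Fin n) (Fn B K)} (hF : ∀ i, MConv ρ (F i))
    {G : Matrix (Fin n) (Fin n) (Lau K ρ)}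
    (hZ : ∀ k a b, PowerSeries.coeff k (wSer G a b) = Lau.mono k 1 * toLau ρ (F k a b))
    (h : Solves (ρ : ℝ) q A F) : (wSer G).map (ev ((q : K) - 1)) = toLauM ρ A := by
  ext1 a b
  have h1 := (solves_iff hA hF hZ).1 h 0 a b
  rw [coeff_zero_taylor_mul_wSer] at h1
  rw [← h1.tsum_eq, Matrix.map_apply, ev]
  exact tsum_congr fun k => by simp [affCoeff]

/-- The single equality at `q - 1` implies the whole functional equation, since the cocycle property
gives all its coefficients at once. -/
theorem solves_dTaylor_iff {s : ℝ} (hs : 0 < s) {q : Q K} (hq : ‖(q : K) - 1‖ ≤ s)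
    {A G : Matrix (Fin n) (Fin n) (Fn B K)} (hA : MConv ρ A) (hG : MConv ρ G)
    (hW : MRes s (wSer (toLauM ρ G))) :
    Solves (ρ : ℝ) q A (dTaylor G) ↔
      (wSer (toLauM ρ G)).map (ev ((q : K) - 1)) = toLauM ρ A := by
  refine ⟨hasSum_wSer_of_solves hA hG.dTaylor (coeff_wSer_eq hG), fun h => ?_⟩
  rw [solves_iff hA hG.dTaylor (coeff_wSer_eq hG), ← h]
  have hq1 : ‖(q : K)‖ ≤ 1 := by simp
  intro i a b
  rw [← wSer_affine hs hW hq1 hq]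
  exact hasSum_affine hs hq1 hq (hW a b) i

end Sums

/-! ### Radius of convergence -/

section Radius

variable {B : Base} {K : Type u} [NormedField K] [CompleteSpace K] [IsUltrametricDist K]
  [CharZero K] {ρ : Set.Ioi (0 : ℝ)} {n : ℕ}

theorem le_rpow_neg_inv_iff {c y : ℝ≥0∞} {k : ℕ} (hk : k ≠ 0) :
    c ≤ y ^ (-(1 / (k : ℝ))) ↔ y ≤ (c⁻¹) ^ k := by
  have hk0 : (0 : ℝ) < k := by exact_mod_cast Nat.pos_of_ne_zero hk
  rw [ENNReal.rpow_neg, ENNReal.le_inv_iff_le_inv, one_div, ENNReal.rpow_inv_le_iff hk0,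
    ENNReal.rpow_natCast]

/-- The radius of convergence `liminf (|H_k|_ρ / |u_k|)^{-1/k}`, bounded by `ρ`. -/
noncomputable def rad (H : ℕ → Matrix (Fin n) (Fin n) (Fn B K)) (u : ℕ → K) (ρ : ℝ) : ℝ≥0∞ :=
  min (liminf (fun k : ℕ => (matNorm ρ (H k) / ENNReal.ofReal ‖u k‖) ^ (-(1 / (k : ℝ)))) atTop)
    (ENNReal.ofReal ρ)

/-- The matrices `Tᵏ H_k / u_k`. -/
noncomputable def scaled (H : ℕ → Matrix (Fin n) (Fin n) (Fn B K)) (u : ℕ → K) (k : ℕ) :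
    Matrix (Fin n) (Fin n) (Fn B K) := (mono k ((u k)⁻¹) : Fn B K) • H k

theorem matNorm_le_ofReal_iff {A : Matrix (Fin n) (Fin n) (Fn B K)} (hA : MConv ρ A) {c : ℝ}
    (hc : 0 ≤ c) : matNorm (ρ : ℝ) A ≤ ENNReal.ofReal c ↔ ∀ i j, ‖toLau ρ (A i j)‖ ≤ c := by
  rw [matNorm, iSup₂_le_iff]
  refine forall₂_congr fun i j => ?_
  rw [gaussNorm_eq (hA i j), ENNReal.ofReal_le_ofReal_iff hc]

theorem norm_toLau_scaled {H : ℕ → Matrix (Fin n) (Fin n) (Fn B K)} {u : ℕ → K} {k : ℕ}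
    (hH : MConv ρ (H k)) (i j : Fin n) :
    ‖toLau ρ (scaled H u k i j)‖ = ‖u k‖⁻¹ * ((ρ : ℝ) ^ k * ‖toLau ρ (H k i j)‖) := by
  rw [scaled, Matrix.smul_apply, smul_eq_mul, toLau_mono_mul _ _ (hH i j), Lau.mono_mul_eq_smul,
    norm_smul, norm_inv, Lau.norm_mono_mul, zpow_natCast]

/-- The normalisation by `Tᵏ` contributes a factor `ρᵏ`: a radius `ρ s` in the variable `x - y` is a
radius `s` in `z = (x-y)/y`. The case `k = 0` is excluded, the exponent `1/k` being then `0`. -/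
theorem ofReal_le_term_iff {H : ℕ → Matrix (Fin n) (Fin n) (Fn B K)} {u : ℕ → K} {k : ℕ}
    (hk : k ≠ 0) (hH : MConv ρ (H k)) (hu : u k ≠ 0) {s : ℝ} (hs : 0 < s) :
    ENNReal.ofReal (ρ * s) ≤ (matNorm (ρ : ℝ) (H k) / ENNReal.ofReal ‖u k‖) ^ (-(1 / (k : ℝ))) ↔
      ∀ i j, ‖toLau ρ (scaled H u k i j)‖ * s ^ k ≤ 1 := by
  have hρ : 0 < (ρ : ℝ) := ρ.2
  have hu' : 0 < ‖u k‖ := norm_pos_iff.2 hu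
  have hc : 0 < (ρ : ℝ) * s := mul_pos hρ hs
  rw [le_rpow_neg_inv_iff hk, ← ENNReal.ofReal_inv_of_pos hc,
    ← ENNReal.ofReal_pow (inv_nonneg.2 hc.le),
    ENNReal.div_le_iff (ENNReal.ofReal_pos.2 hu').ne' ENNReal.ofReal_ne_top,
    ← ENNReal.ofReal_mul (by positivity), matNorm_le_ofReal_iff hH (by positivity)]
  refine forall₂_congr fun i j => ?_
  rw [norm_toLau_scaled hH]
  have e : ((ρ : ℝ) * s)⁻¹ ^ k * ‖u k‖ = ((‖u k‖)⁻¹ * ((ρ : ℝ) ^ k * s ^ k))⁻¹ := by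
    simp only [mul_inv, inv_inv, inv_pow, mul_pow]
    ring
  rw [e, ← one_div, le_div_iff₀ (by positivity)]
  constructor <;> intro h <;> linarith

variable {H H' : ℕ → Matrix (Fin n) (Fin n) (Fn B K)} {u u' : ℕ → K} {s : ℝ}

theorem decays_of_lt_liminf (hH : ∀ k, MConv ρ (H k)) (hu : ∀ k, u k ≠ 0) (hs : 0 < s)
    (h : ENNReal.ofReal (ρ * s) < liminf (fun k : ℕ =>
      (matNorm (ρ : ℝ) (H k) / ENNReal.ofReal ‖u k‖) ^ (-(1 / (k : ℝ)))) atTop) (i j : Fin n) :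
    Decays s fun k => toLau ρ (scaled H u k i j) := by
  have hρ : 0 < (ρ : ℝ) := ρ.2
  obtain ⟨c, hc0, hc1, hc2⟩ := ENNReal.lt_iff_exists_real_btwn.1 h
  have hlt : (ρ : ℝ) * s < c := (ENNReal.ofReal_lt_ofReal_iff_of_nonneg (by positivity)).1 hc1
  have hs' : s < c / ρ := by rw [lt_div_iff₀ hρ]; linarith
  have hcr : (ρ : ℝ) * (c / ρ) = c := by field_simp
  refine Decays.of_bdd (s' := c / ρ) (C := 1) hs.le hs' ?_
  filter_upwards [eventually_lt_of_lt_liminf hc2, eventually_ne_atTop 0] with k hk hk0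
  rw [← hcr] at hk
  exact (ofReal_le_term_iff hk0 (hH k) (hu k) (hs.trans hs')).1 hk.le i j

theorem le_liminf_of_decays (hH : ∀ k, MConv ρ (H k)) (hu : ∀ k, u k ≠ 0) (hs : 0 < s)
    (h : ∀ i j, Decays s fun k => toLau ρ (scaled H u k i j)) :
    ENNReal.ofReal (ρ * s) ≤ liminf (fun k : ℕ =>
      (matNorm (ρ : ℝ) (H k) / ENNReal.ofReal ‖u k‖) ^ (-(1 / (k : ℝ)))) atTop := by
  refine le_liminf_of_le (by isBoundedDefault) ?_
  have h1 : ∀ᶠ k in atTop, ∀ i j, ‖toLau ρ (scaled H u k i j)‖ * s ^ k ≤ 1 := by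
    refine eventually_all.2 fun i => eventually_all.2 fun j => ?_
    filter_upwards [(h i j).eventually_lt_const one_pos] with k hk using hk.le
  filter_upwards [h1, eventually_ne_atTop 0] with k hk hk0
  exact (ofReal_le_term_iff hk0 (hH k) (hu k) hs).2 hk

/-- Newton and power expansions are comparable only at radii `s ≥ |q - 1|`. That suffices: below the
threshold the bound comes from the decay already known at `s`. -/
theorem rad_le_rad (hH : ∀ k, MConv ρ (H k)) (hH' : ∀ k, MConv ρ (H' k)) (hu : ∀ k, u k ≠ 0)
    (hu' : ∀ k, u' k ≠ 0) (hs : 0 < s)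
    (h0 : ∀ i j, Decays s fun k => toLau ρ (scaled H' u' k i j))
    (h : ∀ s', s ≤ s' → (∀ i j, Decays s' fun k => toLau ρ (scaled H u k i j)) →
      ∀ i j, Decays s' fun k => toLau ρ (scaled H' u' k i j)) :
    rad H u (ρ : ℝ) ≤ rad H' u' (ρ : ℝ) := by
  have hρ : 0 < (ρ : ℝ) := ρ.2
  refine min_le_min_right _ (le_of_forall_lt fun c hc => ?_)
  obtain ⟨c', -, hc1, hc2⟩ := ENNReal.lt_iff_exists_real_btwn.1 hc
  refine hc1.trans_le ?_
  rcases le_total c' (ρ * s) with hle | hle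
  · exact (ENNReal.ofReal_le_ofReal hle).trans (le_liminf_of_decays hH' hu' hs h0)
  · have hs' : s ≤ c' / ρ := by rw [le_div_iff₀ hρ]; linarith
    have hcr : (ρ : ℝ) * (c' / ρ) = c' := by field_simp
    rw [← hcr] at hc2 ⊢
    exact le_liminf_of_decays hH' hu' (hs.trans_le hs')
      (h _ hs' (decays_of_lt_liminf hH hu (hs.trans_le hs') hc2))

/-- The condition depends on `ρ` only near `1`, and on `q` only through `|q - 1| < Ray` in the Robba
case, which follows from the limit being at least `r > |q' - 1|`. -/
theorem RadiusCond.congr {r : ℝ} {q q' : Q K} {R R' : ℝ → ℝ≥0∞} {ε : ℝ} (h0 : 0 < ε)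
    (h1 : ε < 1) (h : RadiusCond B r q R) (he : ∀ ρ ∈ B.I ε, R ρ = R' ρ)
    (hq' : ‖(q' : K) - 1‖ < r) : RadiusCond B r q' R' := by
  cases B with
  | robba =>
    obtain ⟨⟨L, hL, hR⟩, -⟩ := h
    have hmem : Set.Ioo (1 - ε) 1 ∈ 𝓝[<] (1 : ℝ) := Ioo_mem_nhdsLT (by linarith)
    have hR' : Tendsto R' (𝓝[<] 1) (𝓝 L) :=
      hR.congr' (by filter_upwards [hmem] with x hx using he x hx)
    refine ⟨⟨L, hL, hR'⟩, ?_⟩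
    have hlt : ENNReal.ofReal ‖(q' : K) - 1‖ < L :=
      ((ENNReal.ofReal_lt_ofReal_iff_of_nonneg (norm_nonneg _)).2 hq').trans_le hL
    have hev : {x : ℝ | ENNReal.ofReal ‖(q' : K) - 1‖ < R' x} ∈ 𝓝[<] (1 : ℝ) :=
      hR'.eventually_const_lt hlt
    obtain ⟨l, hl, hl'⟩ := (mem_nhdsLT_iff_exists_Ioo_subset).1 hev
    have hl1 : l < 1 := hl
    refine ⟨min ε (1 - l), lt_min h0 (by linarith), min_lt_of_left_lt h1, fun x hx => hl' ⟨?_, hx.2⟩⟩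
    have := min_le_right ε (1 - l)
    linarith [hx.1]
  | dagger =>
    have h1' : R 1 = R' 1 := he 1 ⟨by linarith, by linarith⟩
    change ENNReal.ofReal r ≤ R' 1
    rw [← h1']
    exact h

/-- Log-convexity of the Gauss norms, on the level of coefficients. -/
theorem norm_coeff_pow_le {f : Fn B K} {x x0 x1 : ℝ} {m : ℕ} (hm : m ≠ 0) (hx : 0 < x)
    (hx0 : 0 < x0) (h0 : x0 ≤ x ^ m) (h1 : x ^ m ≤ x1) {a b : ℝ}
    (ha : ∀ i, ‖f.coeff i‖ ≤ a)
    (hb0 : ∀ i, ‖f.coeff i‖ * x0 ^ i ≤ b) (hb1 : ∀ i, ‖f.coeff i‖ * x1 ^ i ≤ b) (i : ℤ) :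
    (‖f.coeff i‖ * x ^ i) ^ m ≤ a ^ (m - 1) * b := by
  obtain ⟨l, rfl⟩ := Nat.exists_eq_succ_of_ne_zero hm
  have e : (‖f.coeff i‖ * x ^ i) ^ (l + 1) = ‖f.coeff i‖ ^ l * (‖f.coeff i‖ * (x ^ (l + 1)) ^ i) := by
    rw [mul_pow, ← zpow_natCast (x ^ i), ← zpow_mul, mul_comm i, zpow_mul, zpow_natCast, pow_succ]
    ring
  have h2 : ‖f.coeff i‖ * (x ^ (l + 1)) ^ i ≤ b := by
    have hxp : 0 < x ^ (l + 1) := by positivity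
    rcases le_total 0 i with hi | hi
    · refine le_trans (mul_le_mul_of_nonneg_left ?_ (norm_nonneg _)) (hb1 i)
      exact zpow_le_zpow_left₀ hi hxp.le h1
    · refine le_trans (mul_le_mul_of_nonneg_left ?_ (norm_nonneg _)) (hb0 i)
      obtain ⟨j, rfl⟩ : ∃ j : ℕ, i = -j := ⟨i.natAbs, by omega⟩
      rw [zpow_neg, zpow_neg, zpow_natCast, zpow_natCast]
      exact inv_anti₀ (by positivity) (pow_le_pow_left₀ hx0.le h0 j)
  rw [e, Nat.succ_eq_add_one, Nat.add_sub_cancel]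
  have ha0 : 0 ≤ a := (norm_nonneg _).trans (ha 0)
  exact mul_le_mul (pow_le_pow_left₀ (norm_nonneg _) (ha i) l) h2 (by positivity) (by positivity)

/-- Decay of a sequence on the unit circle spreads to nearby circles, with a small loss. -/
theorem exists_decays_near_one {F : ℕ → Fn B K} {τ s ε : ℝ} (hτ : 0 < τ) (hτs : τ < s)
    (h0 : 0 < ε) (h1 : ε < 1) {ρ1 : Set.Ioi (0 : ℝ)} (hρ1 : (ρ1 : ℝ) = 1)
    (hF : ∀ ρ : Set.Ioi (0 : ℝ), (ρ : ℝ) ∈ Set.Ioo (1 - ε) (1 + ε) → ∀ k, F k ∈ convSubring B K ρ)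
    (hbd : ∀ ρ : Set.Ioi (0 : ℝ), (ρ : ℝ) ∈ Set.Ioo (1 - ε) (1 + ε) →
      ∃ C : ℝ, ∀ k, ‖toLau ρ (F k)‖ ≤ C ^ k)
    (hs : Decays s fun k => toLau ρ1 (F k)) :
    ∃ ε' : ℝ, 0 < ε' ∧ ε' ≤ ε ∧ ∀ ρ : Set.Ioi (0 : ℝ), (ρ : ℝ) ∈ Set.Ioo (1 - ε') (1 + ε') →
      Decays τ fun k => toLau ρ (F k) := by
  have hs0 : 0 < s := hτ.trans hτs
  -- Part of the gap between `τ` and `s` pays for leaving the unit circle, the rest turns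
  -- boundedness at `s'` into decay at `τ`.
  obtain ⟨s', hs1, hs2⟩ := exists_between hτs
  have hs'0 : 0 < s' := hτ.trans hs1
  obtain ⟨C0, hC0, hC0'⟩ := hs.bdd hs0.le
  have hlo0 : (0 : ℝ) < 1 - ε / 2 := by linarith
  have hhi0 : (0 : ℝ) < 1 + ε / 2 := by linarith
  set ρlo : Set.Ioi (0 : ℝ) := ⟨1 - ε / 2, hlo0⟩ with hlo
  set ρhi : Set.Ioi (0 : ℝ) := ⟨1 + ε / 2, hhi0⟩ with hhi
  have mlo : (ρlo : ℝ) ∈ Set.Ioo (1 - ε) (1 + ε) := by constructor <;> simp [hlo] <;> linarith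
  have mhi : (ρhi : ℝ) ∈ Set.Ioo (1 - ε) (1 + ε) := by constructor <;> simp [hhi] <;> linarith
  have m1 : (ρ1 : ℝ) ∈ Set.Ioo (1 - ε) (1 + ε) := by rw [hρ1]; constructor <;> linarith
  obtain ⟨Ca, hCa⟩ := hbd ρlo mlo
  obtain ⟨Cb, hCb⟩ := hbd ρhi mhi
  set C := max |Ca| |Cb| with hC
  have hCp : 0 ≤ C := (abs_nonneg _).trans (le_max_left _ _)
  have hlo' : ∀ k i, ‖(F k).coeff i‖ * (1 - ε / 2) ^ i ≤ C ^ k := fun k i => by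
    have h2 := Lau.le_norm (toLau ρlo (F k)) i
    rw [coeff_toLau (hF _ mlo k)] at h2
    refine (h2.trans (hCa k)).trans ((le_abs_self _).trans ?_)
    rw [abs_pow]
    exact pow_le_pow_left₀ (abs_nonneg _) (le_max_left _ _) k
  have hhi' : ∀ k i, ‖(F k).coeff i‖ * (1 + ε / 2) ^ i ≤ C ^ k := fun k i => by
    have h2 := Lau.le_norm (toLau ρhi (F k)) i
    rw [coeff_toLau (hF _ mhi k)] at h2
    refine (h2.trans (hCb k)).trans ((le_abs_self _).trans ?_)
    rw [abs_pow]
    exact pow_le_pow_left₀ (abs_nonneg _) (le_max_right _ _) k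
  have h1' : ∀ k i, ‖(F k).coeff i‖ ≤ C0 / s ^ k := fun k i => by
    have h2 := Lau.le_norm (toLau ρ1 (F k)) i
    rw [coeff_toLau (hF _ m1 k), hρ1, one_zpow, mul_one] at h2
    rw [le_div_iff₀ (by positivity)]
    exact (mul_le_mul_of_nonneg_right h2 (by positivity)).trans (hC0' k)
  -- On a circle with `ρᵐ` in `[1 - ε/2, 1 + ε/2]`, the `m`-th power of a term is at most `(C0 /
  -- sᵏ)^{m-1} Cᵏ`. Times `s'^{km}` this stays bounded in `k` as soon as `(s'/s)ᵐ C s ≤ 1`, which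
  -- holds for large `m` because `s' < s`.
  obtain ⟨m, hm0, hm⟩ : ∃ m : ℕ, m ≠ 0 ∧ (s' / s) ^ m * (C * s) ≤ 1 := by
    have ht := (tendsto_pow_atTop_nhds_zero_of_lt_one (div_nonneg hs'0.le hs0.le)
      ((div_lt_one hs0).2 hs2)).mul_const (C * s)
    rw [zero_mul] at ht
    obtain ⟨m, hm, hm0⟩ :=
      ((ht.eventually_lt_const one_pos).and (eventually_ne_atTop 0)).exists
    exact ⟨m, hm0, hm.le⟩
  have hcont : ∀ᶠ x : ℝ in 𝓝 1, x ^ m ∈ Set.Icc (1 - ε / 2) (1 + ε / 2) := by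
    have hc : Tendsto (fun x : ℝ => x ^ m) (𝓝 1) (𝓝 1) := by
      simpa using (continuous_pow m).tendsto (1 : ℝ)
    exact hc (Icc_mem_nhds (by linarith) (by linarith))
  obtain ⟨η, hη, hη'⟩ := Metric.eventually_nhds_iff.1 hcont
  refine ⟨min ε η, lt_min h0 hη, min_le_left _ _, fun ρ hρ => ?_⟩
  have hρε : (ρ : ℝ) ∈ Set.Ioo (1 - ε) (1 + ε) :=
    Set.Ioo_subset_Ioo (by linarith [min_le_left ε η]) (by linarith [min_le_left ε η]) hρ
  have hρm : (ρ : ℝ) ^ m ∈ Set.Icc (1 - ε / 2) (1 + ε / 2) := by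
    refine hη' ?_
    rw [Real.dist_eq, abs_lt]
    constructor <;> linarith [hρ.1, hρ.2, min_le_right ε η]
  refine Decays.of_bdd (s' := s') (C := max 1 C0) hτ.le hs1 (Eventually.of_forall fun k => ?_)
  rw [← le_div_iff₀ (by positivity)]
  refine Lau.norm_le fun i => ?_
  rw [coeff_toLau (hF ρ hρε k), le_div_iff₀ (by positivity)]
  have hM : 0 ≤ max 1 C0 := zero_le_one.trans (le_max_left _ _)
  have hρ0 : 0 < (ρ : ℝ) := ρ.2
  refine le_of_pow_le_pow_left₀ hm0 hM ?_
  have hpow := norm_coeff_pow_le hm0 hρ0 hlo0 hρm.1 hρm.2 (h1' k) (hlo' k) (hhi' k) i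
  obtain ⟨l, rfl⟩ := Nat.exists_eq_succ_of_ne_zero hm0
  rw [mul_pow]
  rw [Nat.succ_eq_add_one, Nat.add_sub_cancel] at *
  have e : (C0 / s ^ k) ^ l * C ^ k * (s' ^ k) ^ (l + 1) =
      C0 ^ l * ((s' / s) ^ (l + 1) * (C * s)) ^ k := by
    have hss : s ^ k * s⁻¹ ^ k = 1 := by rw [← mul_pow, mul_inv_cancel₀ hs0.ne', one_pow]
    linear_combination (-(C0 ^ l * s⁻¹ ^ (k * l) * C ^ k * s' ^ k * s' ^ (k * l))) * hss
  have hq : ((s' / s) ^ (l + 1) * (C * s)) ^ k ≤ 1 := pow_le_one₀ (by positivity) hm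
  have hl : C0 ^ l ≤ (max 1 C0) ^ (l + 1) :=
    (pow_le_pow_left₀ hC0 (le_max_right 1 C0) l).trans
      (pow_le_pow_right₀ (le_max_left 1 C0) (Nat.le_succ l))
  calc (‖(F k).coeff i‖ * (ρ : ℝ) ^ i) ^ (l + 1) * (s' ^ k) ^ (l + 1)
      ≤ (C0 / s ^ k) ^ l * C ^ k * (s' ^ k) ^ (l + 1) :=
        mul_le_mul_of_nonneg_right hpow (by positivity)
    _ = C0 ^ l * ((s' / s) ^ (l + 1) * (C * s)) ^ k := e
    _ ≤ C0 ^ l * 1 := mul_le_mul_of_nonneg_left hq (by positivity)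
    _ ≤ (max 1 C0) ^ (l + 1) := by rw [mul_one]; exact hl

theorem exists_uniform_eps {ι : Type*} [Finite ι] {ε : ℝ} (h0 : 0 < ε) {P : ι → ℝ → Prop}
    (h : ∀ i, ∃ ε' : ℝ, 0 < ε' ∧ ε' ≤ ε ∧ ∀ ρ ∈ B.I ε', P i ρ) :
    ∃ ε' : ℝ, 0 < ε' ∧ ε' ≤ ε ∧ ∀ ρ ∈ B.I ε', ∀ i, P i ρ := by
  choose e he0 he hP using h
  cases nonempty_fintype ι
  rcases isEmpty_or_nonempty ι with hι | hι
  · exact ⟨ε, h0, le_rfl, fun _ _ i => hι.elim i⟩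
  · refine ⟨Finset.univ.inf' Finset.univ_nonempty e, ?_, ?_, fun ρ hρ i => ?_⟩
    · exact (Finset.lt_inf'_iff _).2 fun i _ => he0 i
    · exact (Finset.inf'_le e (Finset.mem_univ (Classical.arbitrary ι))).trans (he _)
    · exact hP i ρ (B.I_mono (Finset.inf'_le e (Finset.mem_univ i)) hρ)

/-- The condition on the radius implies the uniform convergence of the Taylor solutions on the
disks of radius `τ < r`. -/
theorem RadiusCond.exists_decays {r τ ε : ℝ} {q : Q K} (h : RadiusCond B r q (rad H u))
    (hτ : 0 < τ) (hτr : τ < r) (h0 : 0 < ε) (h1 : ε < 1) (hu : ∀ k, u k ≠ 0)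
    (hH : ∀ ρ : Set.Ioi (0 : ℝ), (ρ : ℝ) ∈ B.I ε → ∀ k, MConv ρ (H k))
    (hbd : ∀ ρ : Set.Ioi (0 : ℝ), (ρ : ℝ) ∈ B.I ε →
      ∃ C : ℝ, ∀ k i j, ‖toLau ρ (scaled H u k i j)‖ ≤ C ^ k) :
    ∃ ε' : ℝ, 0 < ε' ∧ ε' ≤ ε ∧ ∀ ρ : Set.Ioi (0 : ℝ), (ρ : ℝ) ∈ B.I ε' →
      ∀ i j, Decays τ fun k => toLau ρ (scaled H u k i j) := by
  cases B with
  | robba =>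
    obtain ⟨⟨L, hL, hR⟩, -⟩ := h
    -- Here the limit of the radius exceeds `τ`, hence so does the radius on all circles close to
    -- `1`; as `ρ < 1`, also `ρ τ ≤ τ`.
    have hlt : ENNReal.ofReal τ < L :=
      ((ENNReal.ofReal_lt_ofReal_iff_of_nonneg hτ.le).2 hτr).trans_le hL
    have hev : {x : ℝ | ENNReal.ofReal τ < rad H u x} ∈ 𝓝[<] (1 : ℝ) :=
      hR.eventually_const_lt hlt
    obtain ⟨l, hl, hl'⟩ := (mem_nhdsLT_iff_exists_Ioo_subset).1 hev
    have hl1 : l < 1 := hl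
    refine ⟨min ε (1 - l), lt_min h0 (by linarith), min_le_left _ _, fun ρ hρ => ?_⟩
    have h2 : ENNReal.ofReal τ < rad H u (ρ : ℝ) :=
      hl' ⟨by linarith [hρ.1, min_le_right ε (1 - l)], hρ.2⟩
    refine decays_of_lt_liminf (hH ρ (Base.robba.I_mono (min_le_left _ _) hρ)) hu hτ
      (lt_of_le_of_lt (ENNReal.ofReal_le_ofReal ?_) (lt_of_lt_of_le h2 (min_le_left _ _)))
    exact mul_le_of_le_one_left hτ.le hρ.2.le
  | dagger =>
    obtain ⟨s, hs1, hs2⟩ := exists_between hτr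
    have hs0 : 0 < s := hτ.trans hs1
    set ρ1 : Set.Ioi (0 : ℝ) := ⟨1, Set.mem_Ioi.2 one_pos⟩ with hρ1
    have m1 : (ρ1 : ℝ) ∈ Base.dagger.I ε := ⟨by simp [hρ1, h0], by simp [hρ1, h0]⟩
    -- Only the circle `ρ = 1` is controlled. The growth bound `hbd` carries the decay to
    -- neighbouring circles, entry by entry.
    have hdec : ∀ i j, Decays s fun k => toLau ρ1 (scaled H u k i j) := by
      refine decays_of_lt_liminf (hH ρ1 m1) hu hs0 ?_
      refine lt_of_lt_of_le ?_ (le_trans (show ENNReal.ofReal r ≤ rad H u 1 from h)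
        (min_le_left _ _))
      rw [hρ1, one_mul]
      exact (ENNReal.ofReal_lt_ofReal_iff_of_nonneg hs0.le).2 hs2
    have key : ∀ x : Fin n × Fin n, ∃ ε' : ℝ, 0 < ε' ∧ ε' ≤ ε ∧
        ∀ ρ ∈ Base.dagger.I ε', ∀ h : 0 < ρ,
          Decays τ fun k => toLau ⟨ρ, h⟩ (scaled H u k x.1 x.2) := by
      rintro ⟨i, j⟩
      obtain ⟨ε', h2, h3, h4⟩ := exists_decays_near_one (F := fun k => scaled H u k i j) hτ hs1 h0
        h1 (ρ1 := ρ1) rfl (fun ρ hρ k => (hH ρ hρ k).smul_mono _ _ i j)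
        (fun ρ hρ => (hbd ρ hρ).imp fun C hC k => hC k i j) (hdec i j)
      exact ⟨ε', h2, h3, fun ρ hρ h => h4 ⟨ρ, h⟩ hρ⟩
    obtain ⟨ε', h2, h3, h4⟩ := exists_uniform_eps h0 key
    exact ⟨ε', h2, h3, fun ρ hρ i j => h4 ρ hρ (i, j) ρ.2⟩

end Radius

/-! ### Growth of Taylor coefficients and comparison of the two radii -/

section RadiusOfSystems

variable {B : Base} {K : Type u} [NormedField K] [CompleteSpace K] [IsUltrametricDist K]
  [CharZero K] {ρ : Set.Ioi (0 : ℝ)} {l n : ℕ} {p : ℕ} [Fact p.Prime] {q : Q K}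

theorem Lau.norm_one_le : ‖(1 : Lau K ρ)‖ ≤ 1 := Lau.norm_le fun i => by
  rw [Lau.coeff_one, Pi.single_apply]
  split_ifs with h
  · subst h; simp
  · simp

theorem Lau.norm_sub_le_max (f g : Lau K ρ) : ‖f - g‖ ≤ max ‖f‖ ‖g‖ := by
  simpa [sub_eq_add_neg] using IsUltrametricDist.norm_add_le_max f (-g)

theorem exists_norm_entry_le (A : Matrix (Fin n) (Fin n) (Lau K ρ)) :
    ∃ a : ℝ, 1 ≤ a ∧ ∀ i j, ‖A i j‖ ≤ a := by
  refine ⟨1 + ∑ i, ∑ j, ‖A i j‖, ?_, fun i j => ?_⟩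
  · have : 0 ≤ ∑ i, ∑ j, ‖A i j‖ := Finset.sum_nonneg fun i _ => Finset.sum_nonneg fun j _ =>
      norm_nonneg _
    linarith
  · have h1 := Finset.single_le_sum (f := fun j => ‖A i j‖) (fun _ _ => norm_nonneg _)
      (Finset.mem_univ j)
    have h2 := Finset.single_le_sum (f := fun i => ∑ j, ‖A i j‖)
      (fun _ _ => Finset.sum_nonneg fun j _ => norm_nonneg _) (Finset.mem_univ i)
    linarith

theorem norm_mul_entry_le {M A : Matrix (Fin n) (Fin n) (Lau K ρ)} {x a : ℝ}
    (hx : 0 ≤ x) (ha : 0 ≤ a) (hM : ∀ i j, ‖M i j‖ ≤ x) (hA : ∀ i j, ‖A i j‖ ≤ a) (i j : Fin n) :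
    ‖(M * A) i j‖ ≤ x * a := by
  rw [Matrix.mul_apply]
  refine IsUltrametricDist.norm_sum_le_of_forall_le_of_nonneg (mul_nonneg hx ha) fun k _ => ?_
  exact (norm_mul_le _ _).trans (mul_le_mul (hM i k) (hA k j) (norm_nonneg _) hx)

/-- The step to index `k + 1` divides by `q^{k+1} - 1`, whose norm is at least `c |k+1|`. The
accumulated denominator `cᵏ |k!|` is at least `(c |p|)ᵏ`. -/
theorem exists_norm_nSeq_le (hp : ‖(p : K)‖ < 1) (hq : ‖(q : K) - 1‖ < 1) (hu : ¬ IsRootOfUnity q)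
    (A : Matrix (Fin n) (Fin n) (Lau K ρ)) :
    ∃ C : ℝ, ∀ k i j, ‖nSeq q A k i j‖ ≤ C ^ k := by
  obtain ⟨a, ha1, ha⟩ := exists_norm_entry_le A
  obtain ⟨c, hc0, hc⟩ := exists_norm_pow_sub_one_ge hp hq (not_isRootOfUnity_iff.1 hu)
  have ha0 : 0 ≤ a := zero_le_one.trans ha1
  have hp0 : 0 < ‖(p : K)‖ := norm_pos_iff.2 (Nat.cast_ne_zero.2 (Fact.out : p.Prime).ne_zero)
  have key : ∀ k i j, ‖nSeq q A k i j‖ ≤ a ^ k / (c ^ k * ‖(k.factorial : K)‖) := by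
    intro k
    induction k with
    | zero =>
      intro i j
      rw [nSeq, Matrix.one_apply]
      split_ifs <;> simp [Lau.norm_one_le]
    | succ k ih =>
      intro i j
      have hk : 0 < ‖((k + 1 : ℕ) : K)‖ := norm_pos_iff.2 (Nat.cast_ne_zero.2 k.succ_ne_zero)
      have hkf : 0 < ‖(k.factorial : K)‖ :=
        norm_pos_iff.2 (Nat.cast_ne_zero.2 k.factorial_ne_zero)
      have hx : 0 ≤ a ^ k / (c ^ k * ‖(k.factorial : K)‖) := by positivity
      have h1 : ‖((nSeq q A k).map (Lau.sigma q) * A) i j‖ ≤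
          a ^ k / (c ^ k * ‖(k.factorial : K)‖) * a :=
        norm_mul_entry_le hx ha0 (fun i j => by
          rw [Matrix.map_apply, Lau.norm_sigma]
          exact ih i j) ha i j
      have h2 : ‖((q : K) ^ k)⁻¹ • ((nSeq q A k).map (Lau.sigma q) * A) i j - nSeq q A k i j‖ ≤
          a ^ k / (c ^ k * ‖(k.factorial : K)‖) * a := by
        refine (Lau.norm_sub_le_max _ _).trans (max_le ?_ ?_)
        · rw [norm_smul]
          simpa using h1
        · exact (ih i j).trans (le_mul_of_one_le_right hx ha1)
      rw [nSeq, Matrix.smul_apply, Matrix.sub_apply, Matrix.smul_apply, norm_smul, norm_inv]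
      have h3 : ‖(q : K) ^ (k + 1) - 1‖⁻¹ ≤ (c * ‖((k + 1 : ℕ) : K)‖)⁻¹ :=
        inv_anti₀ (mul_pos hc0 hk) (hc (k + 1))
      refine (mul_le_mul h3 h2 (norm_nonneg _) (by positivity)).trans (le_of_eq ?_)
      rw [Nat.factorial_succ, Nat.cast_mul, norm_mul, pow_succ, pow_succ]
      field_simp
  refine ⟨a / (c * ‖(p : K)‖), fun k i j => (key k i j).trans ?_⟩
  rw [div_pow, mul_pow]
  exact div_le_div_of_nonneg_left (by positivity) (by positivity)
    (mul_le_mul_of_nonneg_left (pow_le_norm_factorial hp k) (by positivity))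

/-- The only denominators are the integers `k + 1`, and `|k!| ≥ |p|ᵏ`. -/
theorem exists_norm_wSeq_le (hp : ‖(p : K)‖ < 1) (G : Matrix (Fin n) (Fin n) (Lau K ρ)) :
    ∃ C : ℝ, ∀ k i j, ‖wSeq G k i j‖ ≤ C ^ k := by
  obtain ⟨a, ha1, ha⟩ := exists_norm_entry_le G
  have ha0 : 0 ≤ a := zero_le_one.trans ha1
  have hp0 : 0 < ‖(p : K)‖ := norm_pos_iff.2 (Nat.cast_ne_zero.2 (Fact.out : p.Prime).ne_zero)
  have key : ∀ k i j, ‖wSeq G k i j‖ ≤ a ^ k / ‖(k.factorial : K)‖ := by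
    intro k
    induction k with
    | zero =>
      intro i j
      rw [wSeq, Matrix.one_apply]
      split_ifs <;> simp [Lau.norm_one_le]
    | succ k ih =>
      intro i j
      have hk : 0 < ‖((k + 1 : ℕ) : K)‖ := norm_pos_iff.2 (Nat.cast_ne_zero.2 k.succ_ne_zero)
      have hkf : 0 < ‖(k.factorial : K)‖ :=
        norm_pos_iff.2 (Nat.cast_ne_zero.2 k.factorial_ne_zero)
      have hx : 0 ≤ a ^ k / ‖(k.factorial : K)‖ := by positivity
      have hxa : a ^ k / ‖(k.factorial : K)‖ ≤ a ^ k / ‖(k.factorial : K)‖ * a :=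
        le_mul_of_one_le_right hx ha1
      have h1 : ‖(wSeq G k * G) i j‖ ≤ a ^ k / ‖(k.factorial : K)‖ * a :=
        norm_mul_entry_le hx ha0 ih ha i j
      have h2 : ‖Lau.delta (wSeq G k i j) - (k : K) • wSeq G k i j + (wSeq G k * G) i j‖ ≤
          a ^ k / ‖(k.factorial : K)‖ * a := by
        refine (IsUltrametricDist.norm_add_le_max _ _).trans (max_le
          ((Lau.norm_sub_le_max _ _).trans (max_le ?_ ?_)) h1)
        · exact ((Lau.norm_delta_le _).trans (ih i j)).trans hxa
        · rw [norm_smul]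
          exact ((mul_le_of_le_one_left (norm_nonneg _)
            (IsUltrametricDist.norm_natCast_le_one K k)).trans (ih i j)).trans hxa
      rw [wSeq, Matrix.smul_apply, Matrix.add_apply, Matrix.sub_apply, Matrix.smul_apply,
        Matrix.map_apply, norm_smul, norm_inv]
      have h3 : ‖(k : K) + 1‖⁻¹ = ‖((k + 1 : ℕ) : K)‖⁻¹ := by push_cast; rfl
      rw [h3]
      refine (mul_le_mul_of_nonneg_left h2 (by positivity)).trans (le_of_eq ?_)
      rw [Nat.factorial_succ, Nat.cast_mul, norm_mul, pow_succ]
      field_simp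
  refine ⟨a / ‖(p : K)‖, fun k i j => (key k i j).trans ?_⟩
  rw [div_pow]
  exact div_le_div_of_nonneg_left (by positivity) (by positivity) (pow_le_norm_factorial hp k)

theorem factorial_cast_ne_zero (k : ℕ) : ((k.factorial : ℕ) : K) ≠ 0 :=
  Nat.cast_ne_zero.2 k.factorial_ne_zero

theorem toLau_nMat {A : Matrix (Fin n) (Fin n) (Fn B K)} (hA : MConv ρ A)
    (hu : ¬ IsRootOfUnity q) (k : ℕ) (i j : Fin n) :
    toLau ρ (nMat q A k i j) = nSeq q (toLauM ρ A) k i j := by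
  rw [← toLauM_nMat hA hu, toLauM_apply]

theorem toLau_wMat {G : Matrix (Fin n) (Fin n) (Fn B K)} (hG : MConv ρ G)
    (k : ℕ) (i j : Fin n) :
    toLau ρ (wMat G k i j) = wSeq (toLauM ρ G) k i j := by
  rw [← toLauM_wMat hG, toLauM_apply]

theorem mres_wSer_iff {s : ℝ} {G : Matrix (Fin n) (Fin n) (Lau K ρ)} :
    MRes s (wSer G) ↔ ∀ i j, Decays s fun k => wSeq G k i j :=
  forall₂_congr fun _ _ => isRestricted_mk

/-- The Taylor solution of a `q`-difference equation converges on the disks of radius `τ < r`. -/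
theorem exists_decays_nSeq (hp : ‖(p : K)‖ < 1) {r τ ε : ℝ} {q' : Q K} (hq : ‖(q : K) - 1‖ < 1)
    (hu : ¬ IsRootOfUnity q) {A : Matrix (Fin n) (Fin n) (Fn B K)}
    (h : RadiusCond B r q' (qRay q A)) (hτ : 0 < τ) (hτr : τ < r) (h0 : 0 < ε) (h1 : ε < 1)
    (hA : ∀ ρ : Set.Ioi (0 : ℝ), (ρ : ℝ) ∈ B.I ε → MConv ρ A) :
    ∃ ε' : ℝ, 0 < ε' ∧ ε' ≤ ε ∧ ∀ ρ : Set.Ioi (0 : ℝ), (ρ : ℝ) ∈ B.I ε' →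
      ∀ i j, Decays τ fun k => nSeq q (toLauM ρ A) k i j := by
  have h' : RadiusCond B r q' (rad (Hmat q A) (qFactorial (q : K))) := h
  obtain ⟨ε', h2, h3, h4⟩ := h'.exists_decays hτ hτr h0 h1 (qFactorial_ne_zero hu)
    (fun ρ hρ k => (hA ρ hρ).Hmat q k) fun ρ hρ => by
      obtain ⟨C, hC⟩ := exists_norm_nSeq_le hp hq hu (toLauM ρ A)
      refine ⟨C, fun k i j => ?_⟩
      have := hC k i j
      rw [← toLau_nMat (hA ρ hρ) hu] at this
      exact this
  refine ⟨ε', h2, h3, fun ρ hρ i j => ?_⟩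
  have h5 := h4 ρ hρ i j
  have e : (fun k => nSeq q (toLauM ρ A) k i j) = fun k => toLau ρ (nMat q A k i j) :=
    funext fun k => (toLau_nMat (hA ρ (B.I_mono h3 hρ)) hu k i j).symm
  rw [e]
  exact h5

theorem exists_mres_wSer (hp : ‖(p : K)‖ < 1) {r τ ε : ℝ} {q' : Q K}
    {G : Matrix (Fin n) (Fin n) (Fn B K)} (h : RadiusCond B r q' (dRay G)) (hτ : 0 < τ)
    (hτr : τ < r) (h0 : 0 < ε) (h1 : ε < 1)
    (hG : ∀ ρ : Set.Ioi (0 : ℝ), (ρ : ℝ) ∈ B.I ε → MConv ρ G) :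
    ∃ ε' : ℝ, 0 < ε' ∧ ε' ≤ ε ∧ ∀ ρ : Set.Ioi (0 : ℝ), (ρ : ℝ) ∈ B.I ε' →
      MRes τ (wSer (toLauM ρ G)) := by
  have h' : RadiusCond B r q' (rad (Gmat G) fun k => ((k.factorial : ℕ) : K)) := h
  obtain ⟨ε', h2, h3, h4⟩ := h'.exists_decays hτ hτr h0 h1 factorial_cast_ne_zero
    (fun ρ hρ k => (hG ρ hρ).Gmat k) fun ρ hρ => by
      obtain ⟨C, hC⟩ := exists_norm_wSeq_le hp (toLauM ρ G)
      refine ⟨C, fun k i j => ?_⟩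
      have := hC k i j
      rw [← toLau_wMat (hG ρ hρ)] at this
      exact this
  refine ⟨ε', h2, h3, fun ρ hρ => mres_wSer_iff.2 fun i j => ?_⟩
  have h5 := h4 ρ hρ i j
  have e : (fun k => wSeq (toLauM ρ G) k i j) = fun k => toLau ρ (wMat G k i j) :=
    funext fun k => (toLau_wMat (hG ρ (B.I_mono h3 hρ)) k i j).symm
  rw [e]
  exact h5

/-- The generic radii of a `q`-difference equation and of a differential equation with the same
Taylor solution coincide. -/
theorem qRay_eq_dRay (hp : ‖(p : K)‖ < 1) {s : ℝ} (hs : 0 < s) (hs1 : s < 1)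
    (hq : ‖(q : K) - 1‖ ≤ s) (hu : ¬ IsRootOfUnity q) {A G : Matrix (Fin n) (Fin n) (Fn B K)}
    (hA : MConv ρ A) (hG : MConv ρ G) (hW : Interp s q (toLauM ρ A) (wSer (toLauM ρ G))) :
    qRay q A (ρ : ℝ) = dRay G (ρ : ℝ) := by
  have eN : ∀ i j, (fun k => nSeq q (toLauM ρ A) k i j) = fun k => toLau ρ (nMat q A k i j) :=
    fun i j => funext fun k => (toLau_nMat hA hu k i j).symm
  have eW : ∀ i j, (fun k => wSeq (toLauM ρ G) k i j) = fun k => toLau ρ (wMat G k i j) :=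
    fun i j => funext fun k => (toLau_wMat hG k i j).symm
  -- At every radius `s' ≥ s` the series is restricted if and only if its Newton coefficients decay:
  -- `h1` is one direction, `h2` the other.
  have h1 : ∀ s', s ≤ s' → MRes s' (wSer (toLauM ρ G)) →
      ∀ i j, Decays s' fun k => nSeq q (toLauM ρ A) k i j := fun s' hs' h =>
    Interp.decays (hq.trans hs') (hs.trans_le hs') hu (W := wSer (toLauM ρ G)) ⟨h, hW.2⟩
  have h2 : ∀ s', s ≤ s' → (∀ i j, Decays s' fun k => nSeq q (toLauM ρ A) k i j) →
      MRes s' (wSer (toLauM ρ G)) := fun s' hs' h => by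
    rw [hW.eq_newtonSer hq hs hp hs1 hu]
    exact (interp_newtonSer (hq.trans hs') (hs.trans_le hs') hu h).1
  simp only [mres_wSer_iff, eN, eW] at h1 h2
  have h3 : ∀ i j, Decays s fun k => toLau ρ (wMat G k i j) := by
    have := mres_wSer_iff.1 hW.1
    simpa only [eW] using this
  have hq0 := qFactorial_ne_zero hu
  exact le_antisymm
    (rad_le_rad (u := qFactorial (q : K)) (u' := fun k => ((k.factorial : ℕ) : K))
      (fun k => hA.Hmat q k) (fun k => hG.Gmat k) hq0 factorial_cast_ne_zero hs h3 h2)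
    (rad_le_rad (u' := qFactorial (q : K)) (u := fun k => ((k.factorial : ℕ) : K))
      (fun k => hG.Gmat k) (fun k => hA.Hmat q k) factorial_cast_ne_zero hq0 hs
      (h1 s le_rfl h3) h1)

theorem exists_eps_mConv (A : Matrix (Fin l) (Fin n) (Fn B K)) :
    ∃ ε : ℝ, 0 < ε ∧ ε < 1 ∧ ∀ ρ : Set.Ioi (0 : ℝ), (ρ : ℝ) ∈ B.I ε → MConv ρ A := by
  have h : ∀ x : Fin l × Fin n, ∃ ε' : ℝ, 0 < ε' ∧ ε' ≤ 1 / 2 ∧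
      ∀ ρ ∈ B.I ε', ConvAt ρ (A x.1 x.2).coeff := fun x => by
    obtain ⟨ε, h0, h1, h⟩ := (A x.1 x.2).2
    exact ⟨min ε (1 / 2), lt_min h0 (by norm_num), min_le_right _ _,
      fun ρ hρ => h ρ (B.I_mono (min_le_left _ _) hρ)⟩
  obtain ⟨ε, h0, h1, h2⟩ := exists_uniform_eps (by norm_num) h
  exact ⟨ε, h0, by linarith, fun ρ hρ i j => h2 ρ hρ (i, j)⟩

theorem EntriesIn.mConv {ε : ℝ} {A : Matrix (Fin n) (Fin n) (Fn B K)} (h : EntriesIn ε A)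
    (hρ : (ρ : ℝ) ∈ B.I ε) : MConv ρ A := fun i j => h i j ρ hρ

end RadiusOfSystems

/-! ### Deformation and confluence of systems -/

theorem coe_mul_sphere {K : Type u} [NormedField K] (q q' : Q K) :
    ((q * q' : Q K) : K) = q * q' := rfl

theorem coe_one_sphere {K : Type u} [NormedField K] : ((1 : Q K) : K) = 1 := rfl

section Systems

open PowerSeries (coeff C)

variable {B : Base} {K : Type u} [NormedField K] [CompleteSpace K] [IsUltrametricDist K]
  [CharZero K] {ρ : Set.Ioi (0 : ℝ)} {m n : ℕ} {p : ℕ} [Fact p.Prime] {q q' : Q K} {s r τ ε : ℝ}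

/-- In the definition of the `σ`-modules the common solution `Y` is not assumed to converge on the
circle; its convergence comes from being a Gauss norm limit. -/
theorem MConv.of_sumsAt {F : ℕ → Matrix (Fin n) (Fin n) (Fn B K)}
    {L : Matrix (Fin n) (Fin n) (Fn B K)} (hF : ∀ k, MConv ρ (F k)) (h : SumsAt (ρ : ℝ) F L) :
    MConv ρ L := by
  intro i j
  refine ConvAt.of_approx ρ.2 fun η hη => ?_
  have h1 := (tendsto_matNorm_zero.1 h i j).eventually_lt_const (ENNReal.ofReal_pos.2 hη)
  obtain ⟨N, hN⟩ := h1.exists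
  have hS : ∑ k ∈ Finset.range N, F k i j ∈ convSubring B K ρ := sum_mem fun k _ => hF k i j
  refine ⟨(∑ k ∈ Finset.range N, F k i j).coeff, hS, fun l => ?_⟩
  refine (ENNReal.ofReal_le_ofReal_iff hη.le).1 (le_trans ?_ hN.le)
  rw [Matrix.sub_apply, Matrix.sum_apply]
  exact le_iSup (fun l : ℤ => ENNReal.ofReal
    (‖(∑ k ∈ Finset.range N, F k i j - L i j).coeff l‖ * (ρ : ℝ) ^ l)) l

theorem IsQTaylor.mConv {A : Matrix (Fin n) (Fin n) (Fn B K)} (hA : MConv ρ A)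
    {Y : ℕ → Matrix (Fin n) (Fin n) (Fn B K)} (h : IsQTaylor (ρ : ℝ) q A Y) (i : ℕ) :
    MConv ρ (Y i) :=
  MConv.of_sumsAt (fun k => (hA.Hmat q k).smul_mono _ _) (h i)

/-- The Taylor solution of a `q`-difference equation is the interpolation of the iterates. -/
theorem Interp.coeff_eq (hp : ‖(p : K)‖ < 1) (hs : 0 < s) (hs1 : s < 1) (hq : ‖(q : K) - 1‖ ≤ s)
    (hu : ¬ IsRootOfUnity q) {A : Matrix (Fin n) (Fin n) (Fn B K)} (hA : MConv ρ A)
    {W : Matrix (Fin n) (Fin n) (PowerSeries (Lau K ρ))} (hW : Interp s q (toLauM ρ A) W)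
    {Y : ℕ → Matrix (Fin n) (Fin n) (Fn B K)} (h : IsQTaylor (ρ : ℝ) q A Y) (i : ℕ)
    (a b : Fin n) : coeff i (W a b) = Lau.mono i 1 * toLau ρ (Y i a b) := by
  rw [hW.eq_newtonSer hq hs hp hs1 hu]
  exact (isQTaylor_iff hs hq hu hA (hW.decays hq hs hu) (h.mConv hA)).1 h i a b

theorem Interp.isQTaylor (hp : ‖(p : K)‖ < 1) (hs : 0 < s) (hs1 : s < 1) (hq : ‖(q : K) - 1‖ ≤ s)
    (hu : ¬ IsRootOfUnity q) {A G : Matrix (Fin n) (Fin n) (Fn B K)} (hA : MConv ρ A)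
    (hG : MConv ρ G) (hW : Interp s q (toLauM ρ A) (wSer (toLauM ρ G))) :
    IsQTaylor (ρ : ℝ) q A (dTaylor G) := by
  refine (isQTaylor_iff hs hq hu hA (hW.decays hq hs hu) hG.dTaylor).2 fun i a b => ?_
  rw [← hW.eq_newtonSer hq hs hp hs1 hu]
  exact coeff_wSer_eq hG i a b

/-- If the Taylor solution of the equation given by `q` is also a solution of the equation given
by `q'`, then its value at `q' - 1` is the matrix of the latter. -/
theorem Interp.ev_eq_of_common (hp : ‖(p : K)‖ < 1) (hs : 0 < s) (hs1 : s < 1)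
    (hq : ‖(q : K) - 1‖ ≤ s) (hq' : ‖(q' : K) - 1‖ ≤ s) (hu : ¬ IsRootOfUnity q)
    {A A' : Matrix (Fin n) (Fin n) (Fn B K)} (hA : MConv ρ A) (hA' : MConv ρ A')
    {W : Matrix (Fin n) (Fin n) (PowerSeries (Lau K ρ))} (hW : Interp s q (toLauM ρ A) W)
    {Y : ℕ → Matrix (Fin n) (Fin n) (Fn B K)} (h : IsQTaylor (ρ : ℝ) q A Y)
    (h1 : ¬ IsRootOfUnity q' → IsQTaylor (ρ : ℝ) q' A' Y ∧ ∃ W', Interp s q' (toLauM ρ A') W')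
    (h2 : IsRootOfUnity q' → Solves (ρ : ℝ) q' A' Y) :
    W.map (ev ((q' : K) - 1)) = toLauM ρ A' := by
  have hc := hW.coeff_eq hp hs hs1 hq hu hA h
  -- For a root of unity there is no `q'`-Taylor series: `W` is recognised as the solution of a
  -- differential equation and the functional equation is read at order `0`. Otherwise both
  -- interpolations have the coefficients of `Y`, so they are equal.
  by_cases hu' : IsRootOfUnity q'
  · have hw := hW.eq_wSer hp hu hq hs hs1
    rw [hw]
    refine hasSum_wSer_of_solves hA' (h.mConv hA) (fun k a b => ?_) (h2 hu')
    rw [← hw]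
    exact hc k a b
  · obtain ⟨h3, W', hW'⟩ := h1 hu'
    have hc' := hW'.coeff_eq hp hs hs1 hq' hu' hA' h3
    have : W = W' := by
      ext1 a b
      ext1 i
      rw [hc, hc']
    rw [this, hW'.ev_eq]

theorem ev_intertwine (hs : 0 < s) (hs1 : s < 1) (hq : ‖(q : K) - 1‖ ≤ s)
    {W : Matrix (Fin m) (Fin m) (PowerSeries (Lau K ρ))}
    {W' : Matrix (Fin n) (Fin n) (PowerSeries (Lau K ρ))} (hW : MRes s W) (hW' : MRes s W')
    {D : Matrix (Fin m) (Fin n) (Lau K ρ)}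
    (h : W * D.map (C (R := Lau K ρ)) = D.map taylorHom * W') :
    W.map (ev ((q : K) - 1)) * D = D.map (Lau.sigma q) * W'.map (ev ((q : K) - 1)) := by
  rw [← map_ev_mul_const hq hW, h, map_ev_mul hq (MRes.taylor hs.le hs1 D) hW',
    map_ev_taylor (hq.trans_lt hs1)]

/-- Compare the coefficients of `z`: that of `wSer G` is `G`, and that of the Taylor expansion of
`D` is `δ₁(D)`. -/
theorem coeff_one_intertwine {G : Matrix (Fin m) (Fin m) (Lau K ρ)}
    {G' : Matrix (Fin n) (Fin n) (Lau K ρ)} {D : Matrix (Fin m) (Fin n) (Lau K ρ)}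
    (h : wSer G * D.map (C (R := Lau K ρ)) = D.map taylorHom * wSer G') :
    G * D = D.map Lau.delta + D * G' := by
  have h1 : ∀ {k : ℕ} (G : Matrix (Fin k) (Fin k) (Lau K ρ)), wSeq G 1 = G := fun G => by
    ext1 i j
    have : (wSeq G 0).map Lau.delta = 0 := by
      ext1 i j
      rw [wSeq, Matrix.map_apply, Matrix.one_apply]
      split_ifs
      · exact Lau.delta_one
      · exact map_zero _
    rw [wSeq, this]
    simp [wSeq]
  have h0 : wSeq G' 0 = 1 := rfl
  have h2 : ∀ f : Lau K ρ, Lau.hasse 1 f = Lau.delta f := fun f => by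
    have := Lau.succ_smul_hasse 0 f
    simpa [Lau.hasse_zero] using this
  ext1 i j
  have h3 := congrArg (coeff 1) (congrFun (congrFun h i) j)
  rw [Matrix.mul_apply, Matrix.mul_apply, map_sum, map_sum] at h3
  simp only [Matrix.map_apply, PowerSeries.coeff_mul_C, coeff_wSer, h1, PowerSeries.coeff_one_mul,
    coeff_taylorHom, h2, ← PowerSeries.coeff_zero_eq_constantCoeff_apply, Lau.hasse_zero,
    h0, Finset.sum_add_distrib] at h3
  rw [Matrix.mul_apply, h3, Matrix.add_apply, Matrix.mul_apply, Matrix.map_apply]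
  congr 1
  · simp [Matrix.one_apply]
  · exact Finset.sum_congr rfl fun k _ => mul_comm _ _

theorem toLau_mono_zero_smul (c : K) {A : Matrix (Fin n) (Fin n) (Fn B K)} (hA : MConv ρ A)
    (i j : Fin n) : toLau ρ (((mono 0 c : Fn B K) • A) i j) = c • toLau ρ (A i j) := by
  rw [Matrix.smul_apply, smul_eq_mul, toLau_mono_mul _ _ (hA i j), Lau.mono_zero_mul]

theorem MConv.nMat {A : Matrix (Fin n) (Fin n) (Fn B K)} (hA : MConv ρ A) (q : Q K) (k : ℕ) :
    MConv ρ (nMat q A k) := (hA.Hmat q k).smul_mono _ _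

theorem MConv.wMat {G : Matrix (Fin n) (Fin n) (Fn B K)} (hG : MConv ρ G) (k : ℕ) :
    MConv ρ (wMat G k) := (hG.Gmat k).smul_mono _ _

/-- For an object of `(σ_q,δ_q)-Mod^{[r]}` the solution of the differential equation interpolates
the iterates of `σ_q`. -/
theorem exists_interp (hp : ‖(p : K)‖ < 1) (hr : r ≤ 1) (hτ : 0 < τ) (hτr : τ < r)
    (hq : ‖(q : K) - 1‖ ≤ τ) {A G : Matrix (Fin n) (Fin n) (Fn B K)}
    (h : RadiusCond B r q' (dRay G)) (h0 : 0 < ε) (h1 : ε < 1)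
    (hS : ∀ ρ ∈ B.I ε, Solves ρ q A (dTaylor G)) :
    ∃ ε' : ℝ, 0 < ε' ∧ ε' < 1 ∧ ∀ ρ : Set.Ioi (0 : ℝ), (ρ : ℝ) ∈ B.I ε' →
      MConv ρ A ∧ MConv ρ G ∧ Interp τ q (toLauM ρ A) (wSer (toLauM ρ G)) := by
  obtain ⟨εA, hA0, hA1, hA⟩ := exists_eps_mConv A
  obtain ⟨εG, hG0, hG1, hG⟩ := exists_eps_mConv G
  obtain ⟨ε', hε0, hε1, hW⟩ := exists_mres_wSer hp h hτ hτr hG0 hG1 hG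
  refine ⟨min ε (min εA ε'), lt_min h0 (lt_min hA0 hε0), min_lt_of_left_lt h1, fun ρ hρ => ?_⟩
  have hρ1 := B.I_mono (min_le_left _ _) hρ
  have hρ2 := B.I_mono (min_le_right _ _) hρ
  have hρA := hA _ (B.I_mono (min_le_left _ _) hρ2)
  have hρ' := B.I_mono (min_le_right _ _) hρ2
  have hρG := hG _ (B.I_mono hε1 hρ')
  have hI := interp_wSer hτ (hτr.trans_le hr) (hW ρ hρ') hq
  rw [(solves_dTaylor_iff hτ hq hρA hρG (hW ρ hρ')).1 (hS ρ hρ1)] at hI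
  exact ⟨hρA, hρG, hI⟩

theorem exists_radius_between (hq : ‖(q : K) - 1‖ < r) :
    ∃ τ : ℝ, 0 < τ ∧ τ < r ∧ ‖(q : K) - 1‖ ≤ τ := by
  obtain ⟨τ, h1, h2⟩ := exists_between hq
  exact ⟨τ, (norm_nonneg _).trans_lt h1, h2, h1.le⟩

/-- Near `|T| = 1` the two equations have the same Taylor solution, so their radii coincide there,
and the condition only sees these circles. -/
theorem RadiusCond.qRay_of_dRay (hp : ‖(p : K)‖ < 1) (hr : r ≤ 1) (hq : ‖(q : K) - 1‖ < r)
    (hu : ¬ IsRootOfUnity q) {A G : Matrix (Fin n) (Fin n) (Fn B K)}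
    (h : RadiusCond B r q' (dRay G)) (h0 : 0 < ε) (h1 : ε < 1)
    (hS : ∀ ρ ∈ B.I ε, Solves ρ q A (dTaylor G)) : RadiusCond B r q (qRay q A) := by
  obtain ⟨τ, hτ0, hτr, hτq⟩ := exists_radius_between hq
  obtain ⟨ε', h0', h1', hI⟩ := exists_interp hp hr hτ0 hτr hτq h h0 h1 hS
  refine h.congr h0' h1' (fun ρ hρ => ?_) hq
  obtain ⟨hA, hG, hW⟩ := hI ⟨ρ, B.pos_of_mem h1' hρ⟩ hρ
  exact (qRay_eq_dRay hp hτ0 (hτr.trans_le hr) hτq hu hA hG hW).symm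

/-- Confluence: a `q`-difference equation with a good radius comes from a differential
equation. -/
theorem exists_connection (hp : ‖(p : K)‖ < 1) (hr : r ≤ 1) (hq : ‖(q : K) - 1‖ < r)
    (hu : ¬ IsRootOfUnity q) {A : Matrix (Fin n) (Fin n) (Fn B K)}
    (h : RadiusCond B r q (qRay q A)) :
    ∃ G : Matrix (Fin n) (Fin n) (Fn B K), RadiusCond B r q (dRay G) ∧
      ∃ ε : ℝ, 0 < ε ∧ ε < 1 ∧ ∀ ρ ∈ B.I ε, Solves ρ q A (dTaylor G) := by
  obtain ⟨τ, hτ0, hτr, hτq⟩ := exists_radius_between hq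
  have hτ1 := hτr.trans_le hr
  obtain ⟨εA, hA0, hA1, hA⟩ := exists_eps_mConv A
  obtain ⟨ε, h0, hle, hN⟩ := exists_decays_nSeq hp (hq.trans_le hr) hu h hτ0 hτr hA0 hA1
    hA
  have h1 : ε < 1 := hle.trans_lt hA1
  have hAc : ∀ ρ : Set.Ioi (0 : ℝ), (ρ : ℝ) ∈ B.I ε → MConv ρ A := fun ρ hρ =>
    hA _ (B.I_mono hle hρ)
  have hq1 : ‖(q : K)‖ ≤ 1 := by simp
  have hterm : ∀ ρ : Set.Ioi (0 : ℝ), (ρ : ℝ) ∈ B.I ε → ∀ (k : ℕ) (i j : Fin n),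
      toLau ρ (((mono 0 ((newton (q : K) k).coeff 1) : Fn B K) • nMat q A k) i j) =
        (newton (q : K) k).coeff 1 • nSeq q (toLauM ρ A) k i j := fun ρ hρ k i j => by
    exact (toLau_mono_zero_smul _ ((hAc ρ hρ).nMat q k) i j).trans
      (by rw [toLau_nMat (hAc ρ hρ) hu])
  -- The matrix `G` must be the coefficient of `z` in the Newton series. That coefficient is a
  -- convergent sum of elements of the base ring on each circle, and these sums glue.
  have hsum : ∀ ρ : Set.Ioi (0 : ℝ), (ρ : ℝ) ∈ B.I ε → ∀ i j : Fin n,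
      HasSum (fun k => toLau ρ (((mono 0 ((newton (q : K) k).coeff 1) : Fn B K) • nMat q A k) i j))
        (coeff 1 (newtonSer (q : K) (nSeq q (toLauM ρ A)) i j)) := fun ρ hρ i j => by
    rw [funext fun k => hterm ρ hρ k i j, newtonSer, PowerSeries.coeff_mk]
    exact hasSum_transform hτ0 (fun _ _ => coeff_newton_eq_zero)
      (norm_coeff_newton_le hq1 hτq) (hN ρ hρ i j) 1
  obtain ⟨G, hG⟩ := exists_hasSum_matrix h0 h1
    (F := fun k => (mono 0 ((newton (q : K) k).coeff 1) : Fn B K) • nMat q A k)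
    (fun ρ hρ k => ((hAc ρ hρ).nMat q k).smul_mono _ _)
    fun ρ hρ i j => (hsum ρ hρ i j).summable
  have hI : ∀ ρ : Set.Ioi (0 : ℝ), (ρ : ℝ) ∈ B.I ε →
      Interp τ q (toLauM ρ A) (wSer (toLauM ρ G)) := fun ρ hρ => by
    have h2 := interp_newtonSer hτq hτ0 hu (hN ρ hρ)
    have h3 := h2.eq_wSer hp hu hτq hτ0 hτ1
    have h4 : (newtonSer (q : K) (nSeq q (toLauM ρ A))).map (fun F => coeff 1 F) =
        toLauM ρ G := by
      ext1 i j
      exact (hsum ρ hρ i j).unique ((hG ρ hρ).2 i j)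
    rw [h4] at h3
    rw [← h3]
    exact h2
  refine ⟨G, h.congr h0 h1 (fun ρ hρ => ?_) hq, ε, h0, h1, fun ρ hρ => ?_⟩
  · have h5 := qRay_eq_dRay hp hτ0 hτ1 hτq hu (hAc ⟨ρ, B.pos_of_mem h1 hρ⟩ hρ)
      (hG ⟨ρ, B.pos_of_mem h1 hρ⟩ hρ).1 (hI ⟨ρ, B.pos_of_mem h1 hρ⟩ hρ)
    exact h5
  · have hI' := hI ⟨ρ, B.pos_of_mem h1 hρ⟩ hρ
    have h5 := (solves_dTaylor_iff hτ0 hτq (hAc ⟨ρ, B.pos_of_mem h1 hρ⟩ hρ)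
      (hG ⟨ρ, B.pos_of_mem h1 hρ⟩ hρ).1 hI'.1).2 hI'.ev_eq
    exact h5

/-- The value at `q - 1` of the solution of a differential equation. -/
theorem exists_ev_wSer (h0 : 0 < ε) (h1 : ε < 1) {G : Matrix (Fin n) (Fin n) (Fn B K)}
    (hG : ∀ ρ : Set.Ioi (0 : ℝ), (ρ : ℝ) ∈ B.I ε → MConv ρ G)
    (hW : ∀ ρ : Set.Ioi (0 : ℝ), (ρ : ℝ) ∈ B.I ε → MRes τ (wSer (toLauM ρ G)))
    (hq : ‖(q : K) - 1‖ ≤ τ) :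
    ∃ A : Matrix (Fin n) (Fin n) (Fn B K), ∀ ρ : Set.Ioi (0 : ℝ), (ρ : ℝ) ∈ B.I ε →
      MConv ρ A ∧ (wSer (toLauM ρ G)).map (ev ((q : K) - 1)) = toLauM ρ A := by
  have hterm : ∀ ρ : Set.Ioi (0 : ℝ), (ρ : ℝ) ∈ B.I ε → ∀ (k : ℕ) (i j : Fin n),
      toLau ρ (((mono 0 (((q : K) - 1) ^ k) : Fn B K) • wMat G k) i j) =
        ((q : K) - 1) ^ k • coeff k (wSer (toLauM ρ G) i j) := fun ρ hρ k i j => by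
    exact (toLau_mono_zero_smul _ ((hG ρ hρ).wMat k) i j).trans
      (by rw [toLau_wMat (hG ρ hρ), coeff_wSer])
  have hsum : ∀ ρ : Set.Ioi (0 : ℝ), (ρ : ℝ) ∈ B.I ε → ∀ i j : Fin n,
      HasSum (fun k => toLau ρ (((mono 0 (((q : K) - 1) ^ k) : Fn B K) • wMat G k) i j))
        (ev ((q : K) - 1) (wSer (toLauM ρ G) i j)) := fun ρ hρ i j => by
    rw [funext fun k => hterm ρ hρ k i j]
    exact hasSum_ev hq (hW ρ hρ i j)
  obtain ⟨A, hA⟩ := exists_hasSum_matrix h0 h1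
    (F := fun k => (mono 0 (((q : K) - 1) ^ k) : Fn B K) • wMat G k)
    (fun ρ hρ k => ((hG ρ hρ).wMat k).smul_mono _ _)
    fun ρ hρ i j => (hsum ρ hρ i j).summable
  refine ⟨A, fun ρ hρ => ⟨(hA ρ hρ).1, ?_⟩⟩
  ext1 i j
  exact (hsum ρ hρ i j).unique ((hA ρ hρ).2 i j)

/-- Deformation: the matrices `A(q)`, `q ∈ D⁻(1,r)`, of the `q`-difference equations deduced from a
differential equation with a good radius. -/
theorem exists_deformation (hp : ‖(p : K)‖ < 1) {G : Matrix (Fin n) (Fin n) (Fn B K)}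
    (h : RadiusCond B r q (dRay G)) :
    ∃ A : Q K → Matrix (Fin n) (Fin n) (Fn B K), ∀ τ : ℝ, 0 < τ → τ < r →
      ∃ ε : ℝ, 0 < ε ∧ ε < 1 ∧ ∀ ρ : Set.Ioi (0 : ℝ), (ρ : ℝ) ∈ B.I ε →
        MConv ρ G ∧ MRes τ (wSer (toLauM ρ G)) ∧ ∀ q' : Q K, ‖(q' : K) - 1‖ ≤ τ →
          MConv ρ (A q') ∧ (wSer (toLauM ρ G)).map (ev ((q' : K) - 1)) = toLauM ρ (A q') := by
  obtain ⟨εG, hG0, hG1, hG⟩ := exists_eps_mConv G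
  have hres := fun (τ : ℝ) (hτ : 0 < τ) (hτr : τ < r) =>
    exists_mres_wSer hp h hτ hτr hG0 hG1 hG
  have hA : ∀ q' : Q K, ∃ A : Matrix (Fin n) (Fin n) (Fn B K), ‖(q' : K) - 1‖ < r →
      ∃ ε : ℝ, 0 < ε ∧ ε < 1 ∧ ∀ ρ : Set.Ioi (0 : ℝ), (ρ : ℝ) ∈ B.I ε →
        MConv ρ A ∧ (wSer (toLauM ρ G)).map (ev ((q' : K) - 1)) = toLauM ρ A := fun q' => by
    by_cases hq' : ‖(q' : K) - 1‖ < r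
    · obtain ⟨τ, hτ0, hτr, hτq⟩ := exists_radius_between hq'
      obtain ⟨ε, h0, hle, hW⟩ := hres τ hτ0 hτr
      obtain ⟨A, hA⟩ := exists_ev_wSer h0 (hle.trans_lt hG1)
        (fun ρ hρ => hG _ (B.I_mono hle hρ)) hW hτq
      exact ⟨A, fun _ => ⟨ε, h0, hle.trans_lt hG1, hA⟩⟩
    · exact ⟨0, fun h => absurd h hq'⟩
  choose A hA using hA
  refine ⟨A, fun τ hτ0 hτr => ?_⟩
  obtain ⟨ε, h0, hle, hW⟩ := hres τ hτ0 hτr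
  have hGc : ∀ ρ : Set.Ioi (0 : ℝ), (ρ : ℝ) ∈ B.I ε → MConv ρ G := fun ρ hρ =>
    hG _ (B.I_mono hle hρ)
  refine ⟨ε, h0, hle.trans_lt hG1, fun ρ hρ => ⟨hGc ρ hρ, hW ρ hρ, fun q' hq' => ?_⟩⟩
  obtain ⟨A', hA'⟩ := exists_ev_wSer h0 (hle.trans_lt hG1) hGc hW hq'
  obtain ⟨ε', h0', h1', hA1⟩ := hA q' (hq'.trans_lt hτr)
  -- The chosen matrix and the one built on the annulus attached to `τ` are both the value at `q' -
  -- 1` on a common circle, and one circle determines a Laurent series.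
  have e : A q' = A' := by
    obtain ⟨x, hx⟩ := B.nonempty_I (lt_min h0 h0')
    have hx1 := B.I_mono (min_le_left _ _) hx
    have hx2 := B.I_mono (min_le_right _ _) hx
    have hA2 := hA' ⟨x, B.pos_of_mem h1' hx2⟩ hx1
    have hA3 := hA1 ⟨x, B.pos_of_mem h1' hx2⟩ hx2
    exact toLauM_inj hA3.1 hA2.1 (hA3.2.symm.trans hA2.2)
  rw [e]
  exact hA' ρ hρ

/-- The matrices `A(q)` of a deformation form a cocycle. -/
theorem exists_cocycle (hp : ‖(p : K)‖ < 1) (hr0 : 0 < r) (hr : r ≤ 1)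
    {G : Matrix (Fin n) (Fin n) (Fn B K)} (h : RadiusCond B r q (dRay G)) :
    ∃ A : Q K → Matrix (Fin n) (Fin n) (Fn B K), A 1 = 1 ∧
      (∀ q₁ ∈ disk K r, ∀ q₂ ∈ disk K r, A (q₁ * q₂) = (A q₂).map (sigma q₁) * A q₁) ∧
      ∀ τ : ℝ, 0 < τ → τ < r → ∃ ε : ℝ, 0 < ε ∧ ε < 1 ∧ ∀ ρ : Set.Ioi (0 : ℝ), (ρ : ℝ) ∈ B.I ε →
        MConv ρ G ∧ ∀ q' : Q K, ‖(q' : K) - 1‖ ≤ τ →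
          MConv ρ (A q') ∧ Interp τ q' (toLauM ρ (A q')) (wSer (toLauM ρ G)) := by
  obtain ⟨A, hA⟩ := exists_deformation hp h
  have hI : ∀ τ : ℝ, 0 < τ → τ < r → ∃ ε : ℝ, 0 < ε ∧ ε < 1 ∧ ∀ ρ : Set.Ioi (0 : ℝ),
      (ρ : ℝ) ∈ B.I ε → MConv ρ G ∧ ∀ q' : Q K, ‖(q' : K) - 1‖ ≤ τ →
        MConv ρ (A q') ∧ Interp τ q' (toLauM ρ (A q')) (wSer (toLauM ρ G)) := by
    intro τ hτ0 hτr
    obtain ⟨ε, h0, h1, hε⟩ := hA τ hτ0 hτr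
    refine ⟨ε, h0, h1, fun ρ hρ => ⟨(hε ρ hρ).1, fun q' hq' => ?_⟩⟩
    obtain ⟨-, hW, hv⟩ := hε ρ hρ
    have h2 := interp_wSer hτ0 (hτr.trans_le hr) hW hq'
    rw [(hv q' hq').2] at h2
    exact ⟨(hv q' hq').1, h2⟩
  refine ⟨A, ?_, fun q₁ hq₁ q₂ hq₂ => ?_, hI⟩
  -- For `q = 1` the nodes of index `0` and `1` coincide, so the iterates `A_0 = 1` and `A_1 = A(1)`
  -- are the same value.
  · obtain ⟨ε, h0, h1, hε⟩ := hI (r / 2) (by linarith) (by linarith)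
    obtain ⟨x, hx⟩ := B.nonempty_I h0
    obtain ⟨-, hv⟩ := hε ⟨x, B.pos_of_mem h1 hx⟩ hx
    have h2 := hv 1 (by rw [coe_one_sphere, sub_self, norm_zero]; linarith)
    refine toLauM_inj h2.1 MConv.one ?_
    have h3 := h2.2.2 0
    have h4 := h2.2.2 1
    rw [coe_one_sphere, one_pow] at h3 h4
    rw [← cocyc_one 1 (toLauM _ (A 1)), ← h4, h3, cocyc, toLauM_one]
  · obtain ⟨τ, hτ, hτr⟩ := exists_between
      (max_lt (show ‖(q₁ : K) - 1‖ < r from hq₁) (show ‖(q₂ : K) - 1‖ < r from hq₂))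
    have hτ0 : 0 < τ := ((norm_nonneg _).trans (le_max_left _ _)).trans_lt hτ
    have hτ1 : ‖(q₁ : K) - 1‖ ≤ τ := (le_max_left _ _).trans hτ.le
    have hτ2 : ‖(q₂ : K) - 1‖ ≤ τ := (le_max_right _ _).trans hτ.le
    obtain ⟨ε, h0, h1, hε⟩ := hI τ hτ0 hτr
    obtain ⟨x, hx⟩ := B.nonempty_I h0
    obtain ⟨-, hv⟩ := hε ⟨x, B.pos_of_mem h1 hx⟩ hx
    have h3 := hv q₁ hτ1
    have h4 := hv q₂ hτ2
    have h12 : ‖((q₁ * q₂ : Q K) : K) - 1‖ ≤ τ := by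
      rw [coe_mul_sphere]
      exact norm_mul_sub_one_le (by simp) hτ1 hτ2
    have h5 := hv (q₁ * q₂) h12
    have hσ : MConv ⟨x, B.pos_of_mem h1 hx⟩ ((A q₂).map (sigma q₁)) := fun i j =>
      sigma_mem (h4.1 i j)
    refine toLauM_inj h5.1 (hσ.mul h3.1) ?_
    rw [toLauM_mul hσ h3.1, toLauM_sigma q₁ h4.1, ← h5.2.ev_eq, ← h3.2.ev_eq, ← h4.2.ev_eq,
      mul_comm q₁]
    exact wSer_ev_mul hτ0 (hτr.trans_le hr) h3.2.1 hτ2 hτ1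

end Systems

/-! ### Semilinear maps and connections in a basis -/

section Semilinear

variable {R M N P : Type*} [CommRing R] [AddCommGroup M] [AddCommGroup N] [AddCommGroup P]
  [Module R M] [Module R N] [Module R P] {l m n : ℕ}
  (b : Module.Basis (Fin l) R M) (b' : Module.Basis (Fin m) R N) (b'' : Module.Basis (Fin n) R P)

/-- The matrix of a map in two bases. -/
noncomputable def mapMat (φ : M → N) : Matrix (Fin l) (Fin m) R := fun i j => b'.repr (φ (b i)) j

variable {σ : R →+* R}

theorem repr_semilinear {φ : M →+ N} (hφ : ∀ (f : R) (x : M), φ (f • x) = σ f • φ x) (x : M)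
    (j : Fin m) : b'.repr (φ x) j = ∑ i, σ (b.repr x i) * mapMat b b' φ i j := by
  have h := congrArg (fun y => b'.repr (φ y) j) (b.sum_repr x)
  rw [← h]
  simp only [map_sum, hφ, map_smul, Finsupp.finsetSum_apply, Finsupp.smul_apply, smul_eq_mul, mapMat]

/-- Images of basis vectors are the rows, so a composition reverses the order of the factors; this
is the form taken by `cocyc` and `exists_cocycle`. -/
theorem mapMat_comp {ψ : N →+ P} (hψ : ∀ (f : R) (x : N), ψ (f • x) = σ f • ψ x) (φ : M → N) :
    mapMat b b'' (fun x => ψ (φ x)) = (mapMat b b' φ).map σ * mapMat b' b'' ψ := by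
  ext1 i j
  rw [Matrix.mul_apply]
  exact repr_semilinear b' b'' hψ _ j

variable {b b'}

theorem semilinear_ext {φ ψ : M →+ N} (hφ : ∀ (f : R) (x : M), φ (f • x) = σ f • φ x)
    (hψ : ∀ (f : R) (x : M), ψ (f • x) = σ f • ψ x) (h : mapMat b b' φ = mapMat b b' ψ) (x : M) :
    φ x = ψ x := by
  refine b'.repr.injective (Finsupp.ext fun j => ?_)
  rw [repr_semilinear b b' hφ, repr_semilinear b b' hψ, h]

theorem comm_iff_mapMat {φ : M →+ M} {ψ : N →+ N}
    (hφ : ∀ (f : R) (x : M), φ (f • x) = σ f • φ x)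
    (hψ : ∀ (f : R) (x : N), ψ (f • x) = σ f • ψ x) (L : M →ₗ[R] N) :
    (∀ x, L (φ x) = ψ (L x)) ↔
      mapMat b b φ * mapMat b b' L = (mapMat b b' L).map σ * mapMat b' b' ψ := by
  have h1 : mapMat b b' (fun x => L (φ x)) = mapMat b b φ * mapMat b b' L := by
    have := mapMat_comp (σ := RingHom.id R) b b b' (ψ := L.toAddMonoidHom)
      (fun f x => L.map_smul f x) φ
    rwa [show ((RingHom.id R : R → R)) = id from rfl, Matrix.map_id] at this
  have h2 : mapMat b b' (fun x => ψ (L x)) = (mapMat b b' L).map σ * mapMat b' b' ψ :=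
    mapMat_comp b b' b' hψ L
  rw [← h1, ← h2]
  refine ⟨fun h => by rw [funext h], fun h x => ?_⟩
  exact semilinear_ext (σ := σ) (b := b) (b' := b') (φ := L.toAddMonoidHom.comp φ)
    (ψ := ψ.comp L.toAddMonoidHom) (fun f x => by simp [hφ]) (fun f x => by simp [hψ]) h x

variable {δ : R → R}

theorem repr_connection {φ : M →+ M} (hφ : ∀ (f : R) (x : M), φ (f • x) = δ f • x + f • φ x)
    (x : M) (j : Fin l) :
    b.repr (φ x) j = δ (b.repr x j) + ∑ i, b.repr x i * mapMat b b φ i j := by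
  have h := congrArg (fun y => b.repr (φ y) j) (b.sum_repr x)
  rw [← h]
  simp only [map_sum, hφ, map_add, map_smul, Finsupp.finsetSum_apply, Finsupp.add_apply,
    Finsupp.smul_apply, smul_eq_mul, mapMat, Finset.sum_add_distrib]
  simp [Finsupp.single_apply]

/-- Neither `L ∘ φ` nor `ψ ∘ L` is linear, but the terms in `δ` cancel in their difference, which is
therefore determined by the basis. -/
theorem comm_connection_iff_mapMat {φ : M →+ M} {ψ : N →+ N}
    (hφ : ∀ (f : R) (x : M), φ (f • x) = δ f • x + f • φ x)
    (hψ : ∀ (f : R) (x : N), ψ (f • x) = δ f • x + f • ψ x) (L : M →ₗ[R] N) :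
    (∀ x, L (φ x) = ψ (L x)) ↔ mapMat b b φ * mapMat b b' L =
      (mapMat b b' L).map δ + mapMat b b' L * mapMat b' b' ψ := by
  have h1 : mapMat b b' (fun x => L (φ x)) = mapMat b b φ * mapMat b b' L := by
    have := mapMat_comp (σ := RingHom.id R) b b b' (ψ := L.toAddMonoidHom)
      (fun f x => L.map_smul f x) φ
    rwa [show ((RingHom.id R : R → R)) = id from rfl, Matrix.map_id] at this
  have h2 : mapMat b b' (fun x => ψ (L x)) =
      (mapMat b b' L).map δ + mapMat b b' L * mapMat b' b' ψ := by
    ext1 i j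
    rw [Matrix.add_apply, Matrix.mul_apply]
    exact repr_connection hψ _ j
  rw [← h1, ← h2]
  refine ⟨fun h => by rw [funext h], fun h x => sub_eq_zero.1 ?_⟩
  have h3 := semilinear_ext (σ := RingHom.id R) (b := b) (b' := b')
    (φ := L.toAddMonoidHom.comp φ - ψ.comp L.toAddMonoidHom) (ψ := 0) (fun f x => by
      simp [hφ, hψ, smul_sub]) (fun f x => by simp) (by
      ext1 i j
      have h4 := congrFun (congrFun h i) j
      simp only [mapMat] at h4 ⊢
      simp [h4]) x
  simpa using h3

variable (b σ δ)

/-- The semilinear map with a given matrix. -/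
noncomputable def semilinearOf (A : Matrix (Fin l) (Fin l) R) : M →+ M where
  toFun x := ∑ i, σ (b.repr x i) • ∑ j, A i j • b j
  map_zero' := by simp
  map_add' x y := by simp [add_smul, Finset.sum_add_distrib]

theorem semilinearOf_smul (A : Matrix (Fin l) (Fin l) R) (f : R) (x : M) :
    semilinearOf b σ A (f • x) = σ f • semilinearOf b σ A x := by
  simp [semilinearOf, Finset.smul_sum, mul_smul]

theorem mapMat_semilinearOf (A : Matrix (Fin l) (Fin l) R) :
    mapMat b b (semilinearOf b σ A) = A := by
  ext1 i j
  simp [mapMat, semilinearOf, Finsupp.single_apply, Finsupp.finsetSum_apply, apply_ite σ, ite_smul]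

/-- The connection with a given matrix. -/
noncomputable def connectionOf (hδ : ∀ f g, δ (f + g) = δ f + δ g)
    (A : Matrix (Fin l) (Fin l) R) : M →+ M :=
  AddMonoidHom.mk' (fun x => ∑ i, δ (b.repr x i) • b i + semilinearOf b (RingHom.id R) A x)
    fun x y => by
      simp only [map_add, Finsupp.add_apply, hδ, add_smul, Finset.sum_add_distrib]
      abel

theorem connectionOf_smul (hδ : ∀ f g, δ (f + g) = δ f + δ g)
    (hδ' : ∀ f g, δ (f * g) = δ f * g + f * δ g) (A : Matrix (Fin l) (Fin l) R) (f : R) (x : M) :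
    connectionOf b δ hδ A (f • x) = δ f • x + f • connectionOf b δ hδ A x := by
  have h : δ f • x = ∑ i, (δ f * b.repr x i) • b i := by
    simp only [mul_smul, ← Finset.smul_sum, b.sum_repr]
  simp only [connectionOf, AddMonoidHom.mk'_apply, semilinearOf_smul, map_smul, Finsupp.smul_apply,
    smul_eq_mul, hδ', add_smul, Finset.sum_add_distrib, h, smul_add, Finset.smul_sum, mul_smul,
    RingHom.id_apply]
  abel

theorem mapMat_connectionOf (hδ : ∀ f g, δ (f + g) = δ f + δ g) (h1 : δ 1 = 0)
    (A : Matrix (Fin l) (Fin l) R) : mapMat b b (connectionOf b δ hδ A) = A := by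
  have h0 : δ 0 = 0 := by simpa using hδ 0 0
  have h2 := mapMat_semilinearOf b (RingHom.id R) A
  ext1 i j
  conv_rhs => rw [← h2]
  simp [mapMat, connectionOf, Finsupp.single_apply, apply_ite δ, h0, h1]

end Semilinear

/-! ### The disk as a group; `σ_q` and `δ₁` on the base ring -/

section Disk

variable {B : Base} {K : Type u} [NormedField K] [CompleteSpace K] [IsUltrametricDist K]

/-- The disk `D⁻(1,r)` as a subgroup. -/
def diskSubgroup (K : Type u) [NormedField K] [IsUltrametricDist K] {r : ℝ} (hr : 0 < r) :
    Subgroup (Q K) where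
  carrier := disk K r
  mul_mem' {a b} ha hb := by
    have e : ((a * b : Q K) : K) - 1 = (a : K) * ((b : K) - 1) + ((a : K) - 1) := by
      rw [coe_mul_sphere]; ring
    change ‖((a * b : Q K) : K) - 1‖ < r
    rw [e]
    refine (IsUltrametricDist.norm_add_le_max _ _).trans_lt (max_lt ?_ ha)
    rw [norm_mul, norm_eq_of_mem_sphere, one_mul]
    exact hb
  one_mem' := by
    change ‖((1 : Q K) : K) - 1‖ < r
    simpa using hr
  inv_mem' {a} ha := by
    have ha0 : (a : K) ≠ 0 := ne_zero_of_mem_unit_sphere a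
    have e : ((a⁻¹ : Q K) : K) - 1 = -((a : K)⁻¹ * ((a : K) - 1)) := by
      have : ((a⁻¹ : Q K) : K) = (a : K)⁻¹ := rfl
      rw [this, mul_sub, inv_mul_cancel₀ ha0]
      ring
    change ‖((a⁻¹ : Q K) : K) - 1‖ < r
    rw [e, norm_neg, norm_mul, norm_inv, norm_eq_of_mem_sphere, inv_one, one_mul]
    exact ha

theorem mem_disk_of_mem_closure {r : ℝ} (hr : 0 < r) {S : Set (Q K)} (hS : S ⊆ disk K r) {q : Q K}
    (hq : q ∈ Subgroup.closure S) : q ∈ disk K r :=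
  ((Subgroup.closure_le (diskSubgroup K hr)).2 hS) hq

theorem sigma_one (f : Fn B K) : sigma 1 f = f := Fn.ext (funext fun i => by
  change ((1 : Q K) : K) ^ i * f.coeff i = f.coeff i
  simp)

theorem sigma_mul (q q' : Q K) (f : Fn B K) : sigma (q * q') f = sigma q (sigma q' f) :=
  Fn.ext (funext fun i => by
    change ((q * q' : Q K) : K) ^ i * f.coeff i = (q : K) ^ i * ((q' : K) ^ i * f.coeff i)
    rw [coe_mul_sphere, mul_zpow, mul_assoc])

theorem delta_add (f g : Fn B K) : delta (f + g) = delta f + delta g :=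
  Fn.ext (funext fun _ => mul_add _ _ _)

theorem delta_one : delta (1 : Fn B K) = 0 := Fn.ext (funext fun i => by
  change (i : K) * (Pi.single 0 1 : ℤ → K) i = 0
  by_cases hi : i = 0
  · simp [hi]
  · simp [hi])

theorem delta_mul [CharZero K] (f g : Fn B K) : delta (f * g) = delta f * g + f * delta g := by
  obtain ⟨x, hx, hf, hg, -⟩ := Fn.common f g 0
  have hf' : f ∈ convSubring B K ⟨x, hx⟩ := hf
  have hg' : g ∈ convSubring B K ⟨x, hx⟩ := hg
  refine toLau_inj (ρ := ⟨x, hx⟩) (delta_mem (mul_mem hf' hg'))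
    (add_mem (mul_mem (delta_mem hf') hg') (mul_mem hf' (delta_mem hg'))) ?_
  rw [toLau_delta (mul_mem hf' hg'), toLau_mul hf' hg', Lau.delta_mul,
    toLau_add (mul_mem (delta_mem hf') hg') (mul_mem hf' (delta_mem hg')),
    toLau_mul (delta_mem hf') hg', toLau_mul hf' (delta_mem hg'), toLau_delta hf', toLau_delta hg']

end Disk

/-! ### Morphisms -/

section Morphisms

open PowerSeries (coeff C)

variable {B : Base} {K : Type u} [NormedField K] [CompleteSpace K] [IsUltrametricDist K]
  [CharZero K] {S : Set (Q K)} {m n : ℕ}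

theorem SigmaMod.comm_iff (M N : SigmaMod B K S) (b : Module.Basis (Fin m) (Fn B K) M.carrier)
    (b' : Module.Basis (Fin n) (Fn B K) N.carrier) (L : M.carrier →ₗ[Fn B K] N.carrier) {q : Q K}
    (hq : q ∈ S) :
    (∀ x, L (M.act ⟨q, Subgroup.subset_closure hq⟩ x) =
      N.act ⟨q, Subgroup.subset_closure hq⟩ (L x)) ↔
    M.mat b q (Subgroup.subset_closure hq) * mapMat b b' L =
      (mapMat b b' L).map (sigma q) * N.mat b' q (Subgroup.subset_closure hq) :=
  comm_iff_mapMat (M.act_smul q hq) (N.act_smul q hq) L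

theorem SigmaDeltaMod.comm_conn_iff (M N : SigmaDeltaMod B K S)
    (b : Module.Basis (Fin m) (Fn B K) M.carrier) (b' : Module.Basis (Fin n) (Fn B K) N.carrier)
    (L : M.carrier →ₗ[Fn B K] N.carrier) :
    (∀ x, L (M.conn x) = N.conn (L x)) ↔ matrixOf b M.conn * mapMat b b' L =
      (mapMat b b' L).map delta + mapMat b b' L * matrixOf b' N.conn :=
  comm_connection_iff_mapMat M.conn_smul N.conn_smul L

theorem mapMat_id_mul_mapMat_id {M : Type u} [AddCommGroup M] [Module (Fn B K) M]
    (b : Module.Basis (Fin m) (Fn B K) M) (b' : Module.Basis (Fin n) (Fn B K) M) :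
    mapMat b b' (LinearMap.id : M →ₗ[Fn B K] M) * mapMat b' b (LinearMap.id : M →ₗ[Fn B K] M) =
      1 := by
  have h := mapMat_comp (σ := RingHom.id (Fn B K)) b b' b (ψ := AddMonoidHom.id M)
    (fun f x => rfl) fun x => x
  rw [show ((RingHom.id (Fn B K) : Fn B K → Fn B K)) = id from rfl, Matrix.map_id] at h
  refine Eq.trans h.symm ?_
  ext1 i j
  simp [mapMat, Matrix.one_apply, Finsupp.single_apply]

theorem exists_common_radius {ε₁ ε₂ ε₃ : ℝ} (h₁ : 0 < ε₁) (h₂ : 0 < ε₂) (h₃ : 0 < ε₃)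
    (h : ε₁ < 1) : ∃ ρ : Set.Ioi (0 : ℝ), (ρ : ℝ) ∈ B.I ε₁ ∧ (ρ : ℝ) ∈ B.I ε₂ ∧
      (ρ : ℝ) ∈ B.I ε₃ := by
  obtain ⟨x, hx⟩ := B.nonempty_I (lt_min h₁ (lt_min h₂ h₃))
  have hx1 := B.I_mono (min_le_left _ _) hx
  have hx2 := B.I_mono (min_le_right _ _) hx
  exact ⟨⟨x, B.pos_of_mem h hx1⟩, hx1, B.I_mono (min_le_left _ _) hx2,
    B.I_mono (min_le_right _ _) hx2⟩

/-- Passing to `Lau K ρ` keeps all coefficients, so a commutation over the base ring can be tested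
on one circle where everything converges. -/
theorem toLauM_comm_sigma {ρ : Set.Ioi (0 : ℝ)} {q : Q K} {A : Matrix (Fin m) (Fin m) (Fn B K)}
    {A' : Matrix (Fin n) (Fin n) (Fn B K)} {D : Matrix (Fin m) (Fin n) (Fn B K)} (hA : MConv ρ A)
    (hA' : MConv ρ A') (hD : MConv ρ D) :
    A * D = D.map (sigma q) * A' ↔ toLauM ρ A * toLauM ρ D =
      (toLauM ρ D).map (Lau.sigma q) * toLauM ρ A' := by
  have hσ : MConv ρ (D.map (sigma q)) := fun i j => sigma_mem (hD i j)
  rw [← toLauM_sigma q hD, ← toLauM_mul hA hD, ← toLauM_mul hσ hA']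
  exact ⟨fun h => by rw [h], toLauM_inj (hA.mul hD) (hσ.mul hA')⟩

theorem toLauM_comm_delta {ρ : Set.Ioi (0 : ℝ)} {G : Matrix (Fin m) (Fin m) (Fn B K)}
    {G' : Matrix (Fin n) (Fin n) (Fn B K)} {D : Matrix (Fin m) (Fin n) (Fn B K)} (hG : MConv ρ G)
    (hG' : MConv ρ G') (hD : MConv ρ D) :
    G * D = D.map delta + D * G' ↔ toLauM ρ G * toLauM ρ D =
      (toLauM ρ D).map Lau.delta + toLauM ρ D * toLauM ρ G' := by
  have hδ : MConv ρ (D.map delta) := fun i j => delta_mem (hD i j)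
  have hR : MConv ρ (D.map delta + D * G') := fun i j => add_mem (hδ i j) (hD.mul hG' i j)
  rw [← toLauM_delta hD, ← toLauM_mul hG hD, ← toLauM_mul hD hG', ← toLauM_add hδ (hD.mul hG')]
  exact ⟨fun h => by rw [h], toLauM_inj (hG.mul hD) hR⟩

variable {p : ℕ} [Fact p.Prime] {r τ : ℝ} {q q' : Q K}

theorem sigmaDeltaQProp.exists_interp (hp : ‖(p : K)‖ < 1) (hr : r ≤ 1)
    {M : SigmaDeltaMod B K {q}} (hM : sigmaDeltaQProp r q M) (hτ : 0 < τ) (hτr : τ < r)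
    (hq : ‖(q : K) - 1‖ ≤ τ) :
    ∃ (n : ℕ) (b : Module.Basis (Fin n) (Fn B K) M.carrier) (ε : ℝ), 0 < ε ∧ ε < 1 ∧
      ∀ ρ : Set.Ioi (0 : ℝ), (ρ : ℝ) ∈ B.I ε →
        MConv ρ (M.mat b q (Subgroup.subset_closure rfl)) ∧ MConv ρ (matrixOf b M.conn) ∧
        Interp τ q (toLauM ρ (M.mat b q (Subgroup.subset_closure rfl)))
          (wSer (toLauM ρ (matrixOf b M.conn))) := by
  obtain ⟨n, b, hR, ε, h0, h1, hS⟩ := hM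
  obtain ⟨ε', h0', h1', h⟩ := QConf.exists_interp hp hr hτ hτr hq hR h0 h1 hS
  exact ⟨n, b, ε', h0', h1', h⟩

/-- Horizontal maps commute with `σ_q`. -/
theorem comm_sigma_of_comm_conn (hp : ‖(p : K)‖ < 1) (hr : r ≤ 1) (hq : ‖(q : K) - 1‖ < r)
    {M N : SigmaDeltaMod B K {q}} (hM : sigmaDeltaQProp r q M) (hN : sigmaDeltaQProp r q N)
    (L : M.carrier →ₗ[Fn B K] N.carrier) (hL : ∀ x, L (M.conn x) = N.conn (L x))
    (x : M.carrier) : L (M.act ⟨q, Subgroup.subset_closure rfl⟩ x) =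
      N.act ⟨q, Subgroup.subset_closure rfl⟩ (L x) := by
  obtain ⟨τ, hτ0, hτr, hτq⟩ := exists_radius_between hq
  obtain ⟨m, b, ε₁, h1, h1', hb⟩ := hM.exists_interp hp hr hτ0 hτr hτq
  obtain ⟨n, b', ε₂, h2, h2', hb'⟩ := hN.exists_interp hp hr hτ0 hτr hτq
  obtain ⟨ε₃, h3, h3', hD⟩ := exists_eps_mConv (mapMat b b' L)
  obtain ⟨ρ, hρ1, hρ2, hρ3⟩ := exists_common_radius (B := B) h1 h2 h3 h1'
  obtain ⟨hA, hG, hW⟩ := hb ρ hρ1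
  obtain ⟨hA', hG', hW'⟩ := hb' ρ hρ2
  refine (SigmaMod.comm_iff M.toSigmaMod N.toSigmaMod b b' L rfl).2 ?_ x
  have hc := (toLauM_comm_delta hG hG' (hD ρ hρ3)).1 ((M.comm_conn_iff N b b' L).1 hL)
  refine (toLauM_comm_sigma hA hA' (hD ρ hρ3)).2 ?_
  rw [← hW.ev_eq, ← hW'.ev_eq]
  -- A horizontal matrix intertwines the two Taylor solutions; evaluation at `z = q - 1` gives the
  -- commutation with `σ_q`.
  exact ev_intertwine hτ0 (hτr.trans_le hr) hτq hW.1 hW'.1 (wSer_mul_const hc)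

/-- Linear maps commuting with `σ_q` are horizontal. -/
theorem comm_conn_of_comm_sigma (hp : ‖(p : K)‖ < 1) (hr : r ≤ 1) (hq : ‖(q : K) - 1‖ < r)
    (hu : ¬ IsRootOfUnity q)
    {M N : SigmaDeltaMod B K {q}} (hM : sigmaDeltaQProp r q M) (hN : sigmaDeltaQProp r q N)
    (L : M.carrier →ₗ[Fn B K] N.carrier)
    (hL : ∀ x, L (M.act ⟨q, Subgroup.subset_closure rfl⟩ x) =
      N.act ⟨q, Subgroup.subset_closure rfl⟩ (L x)) (x : M.carrier) :
    L (M.conn x) = N.conn (L x) := by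
  obtain ⟨τ, hτ0, hτr, hτq⟩ := exists_radius_between hq
  obtain ⟨m, b, ε₁, h1, h1', hb⟩ := hM.exists_interp hp hr hτ0 hτr hτq
  obtain ⟨n, b', ε₂, h2, h2', hb'⟩ := hN.exists_interp hp hr hτ0 hτr hτq
  obtain ⟨ε₃, h3, h3', hD⟩ := exists_eps_mConv (mapMat b b' L)
  obtain ⟨ρ, hρ1, hρ2, hρ3⟩ := exists_common_radius (B := B) h1 h2 h3 h1'
  obtain ⟨hA, hG, hW⟩ := hb ρ hρ1
  obtain ⟨hA', hG', hW'⟩ := hb' ρ hρ2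
  refine (M.comm_conn_iff N b b' L).2 ?_ x
  have hc := (toLauM_comm_sigma hA hA' (hD ρ hρ3)).1
    ((SigmaMod.comm_iff M.toSigmaMod N.toSigmaMod b b' L rfl).1 hL)
  -- Here the intertwining comes from the identity principle, and its coefficient of `z` is the
  -- commutation with the connections.
  exact (toLauM_comm_delta hG hG' (hD ρ hρ3)).2 (coeff_one_intertwine
    (interp_mul_const hp hu hτq hτ0 (hτr.trans_le hr) hW hW' hc))

/-- The radius is controlled in some basis, whereas the common Taylor solution in condition (ii)
refers to another. The interpolation is transported from one to the other by `Interp.change_basis`.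
-/
theorem sigmaQProp.exists_interp (hp : ‖(p : K)‖ < 1) (hr : r ≤ 1) (hq : ‖(q : K) - 1‖ ≤ τ)
    (hu : ¬ IsRootOfUnity q) (hτ : 0 < τ) (hτr : τ < r) {M : SigmaMod B K {q}}
    (hM : sigmaQProp r q M) (b : Module.Basis (Fin n) (Fn B K) M.carrier) :
    ∃ ε : ℝ, 0 < ε ∧ ε < 1 ∧ ∀ ρ : Set.Ioi (0 : ℝ), (ρ : ℝ) ∈ B.I ε →
      ∃ W, Interp τ q (toLauM ρ (M.mat b q (Subgroup.subset_closure rfl))) W := by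
  obtain ⟨m, b₁, hR⟩ := hM
  have hτ1 := hτr.trans_le hr
  obtain ⟨ε₁, h1, h1', hA₁⟩ := exists_eps_mConv (M.mat b₁ q (Subgroup.subset_closure rfl))
  obtain ⟨ε₁', h2, h2', hN⟩ := exists_decays_nSeq hp (hq.trans_lt hτ1) hu hR hτ hτr h1 h1' hA₁
  obtain ⟨ε₃, h3, h3', hA⟩ := exists_eps_mConv (M.mat b q (Subgroup.subset_closure rfl))
  obtain ⟨ε₄, h4, h4', hD⟩ := exists_eps_mConv
    (mapMat b₁ b (LinearMap.id : M.carrier →ₗ[Fn B K] M.carrier))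
  obtain ⟨ε₅, h5, h5', hD'⟩ := exists_eps_mConv
    (mapMat b b₁ (LinearMap.id : M.carrier →ₗ[Fn B K] M.carrier))
  refine ⟨min (min ε₁' ε₃) (min ε₄ ε₅), lt_min (lt_min h2 h3) (lt_min h4 h5),
    min_lt_of_right_lt (min_lt_of_left_lt h4'), fun ρ hρ => ?_⟩
  have hρ12 := B.I_mono (min_le_left _ _) hρ
  have hρ34 := B.I_mono (min_le_right _ _) hρ
  have hρ2 := B.I_mono (min_le_left _ _) hρ12
  have hA' := hA ρ (B.I_mono (min_le_right _ _) hρ12)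
  have hD2 := hD ρ (B.I_mono (min_le_left _ _) hρ34)
  have hD3 := hD' ρ (B.I_mono (min_le_right _ _) hρ34)
  refine ⟨_, (interp_newtonSer hq hτ hu (hN ρ hρ2)).change_basis hq hτ hτ1
    (B := toLauM ρ (mapMat b₁ b (LinearMap.id : M.carrier →ₗ[Fn B K] M.carrier)))
    (B' := toLauM ρ (mapMat b b₁ (LinearMap.id : M.carrier →ₗ[Fn B K] M.carrier))) ?_ ?_⟩
  · rw [← toLauM_mul hD3 hD2, mapMat_id_mul_mapMat_id, toLauM_one]
  · exact (toLauM_comm_sigma (hA₁ ρ (B.I_mono h2' hρ2)) hA' hD2).1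
      ((SigmaMod.comm_iff M M b₁ b LinearMap.id rfl).1 fun _ => rfl)

/-- For an object of `σ-Mod_D^{[r]}`, the interpolation of the iterates of `σ_q` interpolates all
`σ_{q'}`. -/
theorem sigmaProp.exists_interp (hp : ‖(p : K)‖ < 1) (hr : r ≤ 1) (hτ : 0 < τ) (hτr : τ < r)
    (hq : ‖(q : K) - 1‖ < τ) (hq' : ‖(q' : K) - 1‖ < τ) (hqr : q ∈ disk K r)
    (hqr' : q' ∈ disk K r) (hu : ¬ IsRootOfUnity q)
    {M : SigmaMod B K (disk K r)} (hM : sigmaProp r (disk K r) M) :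
    ∃ (n : ℕ) (b : Module.Basis (Fin n) (Fn B K) M.carrier) (ε : ℝ), 0 < ε ∧ ε < 1 ∧
      ∀ ρ : Set.Ioi (0 : ℝ), (ρ : ℝ) ∈ B.I ε →
        MConv ρ (M.mat b q (Subgroup.subset_closure hqr)) ∧
        MConv ρ (M.mat b q' (Subgroup.subset_closure hqr')) ∧
        ∃ W, Interp τ q (toLauM ρ (M.mat b q (Subgroup.subset_closure hqr))) W ∧
          W.map (ev ((q' : K) - 1)) = toLauM ρ (M.mat b q' (Subgroup.subset_closure hqr')) := by
  obtain ⟨ε, h0, h1, n, b, Y, hE, hY⟩ := hM.2 τ hτ hτr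
  obtain ⟨ε₁, h2, h2', hW⟩ := (hM.1 q hqr hu).exists_interp hp hr hq.le hu hτ hτr b
  -- When `q'` is a root of unity the claim is empty, and `1` is an arbitrary choice.
  have hq2 : ∃ ε₂ : ℝ, 0 < ε₂ ∧ ∀ ρ : Set.Ioi (0 : ℝ), (ρ : ℝ) ∈ B.I ε₂ →
      ¬ IsRootOfUnity q' →
        ∃ W, Interp τ q' (toLauM ρ (M.mat b q' (Subgroup.subset_closure hqr'))) W := by
    by_cases hu' : IsRootOfUnity q'
    · exact ⟨1, one_pos, fun _ _ h => absurd hu' h⟩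
    · obtain ⟨ε₂, h3, -, h4⟩ := (hM.1 q' hqr' hu').exists_interp hp hr hq'.le hu' hτ hτr b
      exact ⟨ε₂, h3, fun ρ hρ _ => h4 ρ hρ⟩
  obtain ⟨ε₂, h3, hW'⟩ := hq2
  refine ⟨n, b, min ε (min ε₁ ε₂), lt_min h0 (lt_min h2 h3), min_lt_of_left_lt h1,
    fun ρ hρ => ?_⟩
  have hρ0 := B.I_mono (min_le_left _ _) hρ
  have hρ12 := B.I_mono (min_le_right _ _) hρ
  have hA := (hE q (Subgroup.subset_closure ⟨hqr, hq⟩)).mConv hρ0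
  have hA' := (hE q' (Subgroup.subset_closure ⟨hqr', hq'⟩)).mConv hρ0
  obtain ⟨W, hI⟩ := hW ρ (B.I_mono (min_le_left _ _) hρ12)
  refine ⟨hA, hA', W, hI, ?_⟩
  obtain ⟨h5, h6⟩ := hY ρ hρ0 q' ⟨hqr', hq'⟩
  exact hI.ev_eq_of_common hp hτ (hτr.trans_le hr) hq.le hq'.le hu hA hA'
    ((hY ρ hρ0 q ⟨hqr, hq⟩).1 hu)
    (fun hu' => ⟨h5 hu', hW' ρ (B.I_mono (min_le_right _ _) hρ12) hu'⟩) h6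

/-- Maps commuting with `σ_q` commute with `σ_{q'}`. -/
theorem comm_sigma_of_comm_sigma (hp : ‖(p : K)‖ < 1) (hr : r ≤ 1) (hq : q ∈ disk K r)
    (hq' : q' ∈ disk K r) (hu : ¬ IsRootOfUnity q) {M N : SigmaMod B K (disk K r)}
    (hM : sigmaProp r (disk K r) M) (hN : sigmaProp r (disk K r) N)
    (L : M.carrier →ₗ[Fn B K] N.carrier)
    (hL : ∀ x, L (M.act ⟨q, Subgroup.subset_closure hq⟩ x) =
      N.act ⟨q, Subgroup.subset_closure hq⟩ (L x)) (x : M.carrier) :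
    L (M.act ⟨q', Subgroup.subset_closure hq'⟩ x) =
      N.act ⟨q', Subgroup.subset_closure hq'⟩ (L x) := by
  obtain ⟨τ, hτ, hτr⟩ := exists_between
    (max_lt (show ‖(q : K) - 1‖ < r from hq) (show ‖(q' : K) - 1‖ < r from hq'))
  have hτ0 : 0 < τ := ((norm_nonneg _).trans (le_max_left _ _)).trans_lt hτ
  have hτ1 := hτr.trans_le hr
  have hτq : ‖(q : K) - 1‖ < τ := (le_max_left _ _).trans_lt hτ
  have hτq' : ‖(q' : K) - 1‖ < τ := (le_max_right _ _).trans_lt hτ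
  obtain ⟨m, b, ε₁, h1, h1', hb⟩ := hM.exists_interp hp hr hτ0 hτr hτq hτq' hq hq' hu
  obtain ⟨n, b', ε₂, h2, h2', hb'⟩ := hN.exists_interp hp hr hτ0 hτr hτq hτq' hq hq' hu
  obtain ⟨ε₃, h3, h3', hD⟩ := exists_eps_mConv (mapMat b b' L)
  obtain ⟨ρ, hρ1, hρ2, hρ3⟩ := exists_common_radius (B := B) h1 h2 h3 h1'
  obtain ⟨hA, hA1, W, hW, hv⟩ := hb ρ hρ1
  obtain ⟨hA', hA1', W', hW', hv'⟩ := hb' ρ hρ2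
  refine (SigmaMod.comm_iff M N b b' L hq').2 ?_ x
  have hc := (toLauM_comm_sigma hA hA' (hD ρ hρ3)).1 ((SigmaMod.comm_iff M N b b' L hq).1 hL)
  refine (toLauM_comm_sigma hA1 hA1' (hD ρ hρ3)).2 ?_
  rw [← hv, ← hv']
  exact ev_intertwine hτ0 hτ1 hτq'.le hW.1 hW'.1
    (interp_mul_const hp hu hτq.le hτ0 hτ1 hW hW' hc)

end Morphisms

/-! ### Modules defined by cocycles -/

section Cocycles

variable {B : Base} {K : Type u} [NormedField K] [CompleteSpace K] [IsUltrametricDist K]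
  {S : Set (Q K)} {n : ℕ}

theorem semilinearOf_cocycle_one {M : Type*} [AddCommGroup M] [Module (Fn B K) M]
    (b : Module.Basis (Fin n) (Fn B K) M) {A : Q K → Matrix (Fin n) (Fin n) (Fn B K)}
    (h1 : A 1 = 1) : semilinearOf b (sigma 1) (A 1) = AddMonoidHom.id M :=
  AddMonoidHom.ext <| semilinear_ext (σ := sigma (1 : Q K)) (b := b) (b' := b)
    (semilinearOf_smul b (sigma 1) (A 1)) (fun f x => by rw [sigma_one]; rfl) (by
      rw [mapMat_semilinearOf, h1]
      ext1 i j
      simp [mapMat, Matrix.one_apply, Finsupp.single_apply])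

theorem semilinearOf_cocycle_mul {M : Type*} [AddCommGroup M] [Module (Fn B K) M]
    (b : Module.Basis (Fin n) (Fn B K) M) {A : Q K → Matrix (Fin n) (Fin n) (Fn B K)} {q₁ q₂ : Q K}
    (h : A (q₁ * q₂) = (A q₂).map (sigma q₁) * A q₁) :
    semilinearOf b (sigma (q₁ * q₂)) (A (q₁ * q₂)) =
      (semilinearOf b (sigma q₁) (A q₁)).comp (semilinearOf b (sigma q₂) (A q₂)) :=
  AddMonoidHom.ext <| semilinear_ext (σ := sigma (q₁ * q₂)) (b := b) (b' := b)
    (semilinearOf_smul b (sigma (q₁ * q₂)) (A (q₁ * q₂)))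
    (fun f x => by
      rw [AddMonoidHom.comp_apply, AddMonoidHom.comp_apply, semilinearOf_smul,
        semilinearOf_smul, sigma_mul]) (by
      have h2 := mapMat_comp b b b (semilinearOf_smul b (sigma q₁) (A q₁))
        (semilinearOf b (sigma q₂) (A q₂))
      rw [mapMat_semilinearOf, mapMat_semilinearOf] at h2
      rw [mapMat_semilinearOf, h]
      exact h2.symm)

/-- The `(σ,δ)`-module defined by a cocycle of matrices and a connection. -/
noncomputable def SigmaDeltaMod.ofCocycle {M : Type u} [AddCommGroup M] [Module (Fn B K) M]
    [Module.Free (Fn B K) M] [Module.Finite (Fn B K) M] (b : Module.Basis (Fin n) (Fn B K) M)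
    (A : Q K → Matrix (Fin n) (Fin n) (Fn B K)) (S : Set (Q K)) (h1 : A 1 = 1)
    (hmul : ∀ q₁ ∈ Subgroup.closure S, ∀ q₂ ∈ Subgroup.closure S,
      A (q₁ * q₂) = (A q₂).map (sigma q₁) * A q₁)
    (conn : M →+ M) (conn_smul : ∀ (f : Fn B K) (m : M), conn (f • m) = delta f • m + f • conn m) :
    SigmaDeltaMod B K S where
  carrier := M
  act :=
    { toFun := fun q => semilinearOf b (sigma (q : Q K)) (A q)
      map_one' := semilinearOf_cocycle_one b h1
      map_mul' := fun q₁ q₂ => semilinearOf_cocycle_mul b (hmul q₁ q₁.2 q₂ q₂.2) }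
  act_smul := fun q _ f m => semilinearOf_smul b (sigma q) (A q) f m
  conn := conn
  conn_smul := conn_smul

variable [CharZero K] {p : ℕ} [Fact p.Prime] {r : ℝ} {q : Q K}

/-- A connection with a good radius extends to an object of `(σ,δ)-Mod_D^{[r]}`, with underlying
object in `σ-Mod_D^{[r]}`. -/
theorem exists_extension (hp : ‖(p : K)‖ < 1) (hr : r ≤ 1) (hq : ‖(q : K) - 1‖ < r)
    (M : SigmaDeltaMod B K {q}) (b : Module.Basis (Fin n) (Fn B K) M.carrier)
    (hR : RadiusCond B r q (dRay (matrixOf b M.conn))) {ε : ℝ} (h0 : 0 < ε) (h1 : ε < 1)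
    (hS : ∀ ρ ∈ B.I ε,
      Solves ρ q (M.mat b q (Subgroup.subset_closure rfl)) (dTaylor (matrixOf b M.conn))) :
    ∃ N : SigmaDeltaMod B K (disk K r), sigmaDeltaProp r (disk K r) N ∧
      sigmaProp r (disk K r) N.toSigmaMod ∧
      Nonempty ((resSigmaDelta (singleton_sub_disk hq)).obj N ≅ M) := by
  have hr0 : 0 < r := (norm_nonneg _).trans_lt hq
  obtain ⟨A, hA1, hAm, hA⟩ := exists_cocycle hp hr0 hr hR
  have hcl : ∀ {x : Q K}, x ∈ Subgroup.closure (disk K r) → x ∈ disk K r := fun hx =>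
    mem_disk_of_mem_closure hr0 subset_rfl hx
  let N : SigmaDeltaMod B K (disk K r) := SigmaDeltaMod.ofCocycle b A (disk K r) hA1
    (fun q₁ h₁ q₂ h₂ => hAm q₁ (hcl h₁) q₂ (hcl h₂)) M.conn M.conn_smul
  have hmat : ∀ (x : Q K) (hx : x ∈ Subgroup.closure (disk K r)), N.mat b x hx = A x :=
    fun x hx => mapMat_semilinearOf b (sigma x) (A x)
  have hsolves : ∀ τ : ℝ, 0 < τ → τ < r → ∃ ε : ℝ, 0 < ε ∧ ε < 1 ∧
      EntriesIn ε (matrixOf b M.conn) ∧ ∀ x : Q K, ‖(x : K) - 1‖ ≤ τ → EntriesIn ε (A x) ∧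
        ∀ ρ ∈ B.I ε, Solves ρ x (A x) (dTaylor (matrixOf b M.conn)) ∧
          (¬ IsRootOfUnity x → IsQTaylor ρ x (A x) (dTaylor (matrixOf b M.conn))) := by
    intro τ hτ0 hτr
    obtain ⟨ε, h0, h1, hε⟩ := hA τ hτ0 hτr
    refine ⟨ε, h0, h1, fun i j ρ hρ => (hε ⟨ρ, B.pos_of_mem h1 hρ⟩ hρ).1 i j,
      fun x hx => ⟨fun i j ρ hρ => ((hε ⟨ρ, B.pos_of_mem h1 hρ⟩ hρ).2 x hx).1 i j,
        fun ρ hρ => ?_⟩⟩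
    obtain ⟨hG, hv⟩ := hε ⟨ρ, B.pos_of_mem h1 hρ⟩ hρ
    obtain ⟨hAx, hI⟩ := hv x hx
    have h2 := (solves_dTaylor_iff hτ0 hx hAx hG hI.1).2 hI.ev_eq
    refine ⟨h2, fun hu => ?_⟩
    have h3 := hI.isQTaylor hp hτ0 (hτr.trans_le hr) hx hu hAx hG
    exact h3
  -- The deformation returns the original `σ_q`: both matrices are the value at `q - 1` of the same
  -- Taylor solution.
  have hAq : A q = M.mat b q (Subgroup.subset_closure rfl) := by
    obtain ⟨τ, hτ0, hτr, hτq⟩ := exists_radius_between hq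
    obtain ⟨ε₁, h2, h3, hε₁⟩ := hA τ hτ0 hτr
    obtain ⟨ε₂, h4, h5, hε₂⟩ := exists_interp hp hr hτ0 hτr hτq hR h0 h1 hS
    obtain ⟨ρ, hρ1, hρ2, -⟩ := exists_common_radius (B := B) h2 h4 h4 h3
    have h6 := (hε₁ ρ hρ1).2 q hτq
    have h7 := hε₂ ρ hρ2
    exact toLauM_inj h6.1 h7.1 (h6.2.ev_eq.symm.trans h7.2.2.ev_eq)
  have hprop : ∀ x ∈ disk K r, ∃ ε : ℝ, 0 < ε ∧ ε < 1 ∧ ∀ ρ ∈ B.I ε,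
      Solves ρ x (A x) (dTaylor (matrixOf b M.conn)) := fun x hx => by
    obtain ⟨τ, hτ0, hτr, hτx⟩ := exists_radius_between (show ‖(x : K) - 1‖ < r from hx)
    obtain ⟨ε, h2, h3, -, h4⟩ := hsolves τ hτ0 hτr
    exact ⟨ε, h2, h3, fun ρ hρ => ((h4 x hτx).2 ρ hρ).1⟩
  have hmem : ∀ {τ : ℝ}, 0 < τ → ∀ {x : Q K}, x ∈ Subgroup.closure (disk K r ∩ disk K τ) →
      ‖(x : K) - 1‖ ≤ τ := fun hτ x hx =>
    le_of_lt (mem_disk_of_mem_closure hτ Set.inter_subset_right hx)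
  refine ⟨N, ⟨fun x hx => ⟨n, b, ?_, ?_⟩, fun τ hτ0 hτr => ?_⟩,
    ⟨fun x hx hu => ⟨n, b, ?_⟩, fun τ hτ0 hτr => ?_⟩, ?_⟩
  -- Only `q` changes in the condition; the connection and its radius are the same for every point
  -- of the disk.
  · exact hR.congr one_half_pos one_half_lt_one (fun _ _ => rfl) hx
  · obtain ⟨ε, h2, h3, h4⟩ := hprop x hx
    refine ⟨ε, h2, h3, fun ρ hρ => ?_⟩
    have h5 := h4 ρ hρ
    rw [← hmat x (Subgroup.subset_closure hx)] at h5
    exact h5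
  · obtain ⟨ε, h2, h3, h4, h5⟩ := hsolves τ hτ0 hτr
    refine ⟨ε, h2, h3, n, b, fun x hx => ?_, h4, fun ρ hρ x hx => ?_⟩
    · rw [hmat]
      exact (h5 x (hmem hτ0 hx)).1
    · rw [hmat]
      exact ((h5 x (le_of_lt hx.2)).2 ρ hρ).1
  · obtain ⟨ε, h2, h3, h4⟩ := hprop x hx
    have h5 := hR.qRay_of_dRay hp hr hx hu h2 h3 h4
    rw [← hmat x (Subgroup.subset_closure hx)] at h5
    exact h5
  · obtain ⟨ε, h2, h3, h4, h5⟩ := hsolves τ hτ0 hτr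
    refine ⟨ε, h2, h3, n, b, dTaylor (matrixOf b M.conn), fun x hx => ?_, fun ρ hρ x hx => ?_⟩
    · rw [hmat]
      exact (h5 x (hmem hτ0 hx)).1
    · rw [hmat]
      have h6 := (h5 x (le_of_lt hx.2)).2 ρ hρ
      exact ⟨h6.2, fun _ => h6.1⟩
  -- The extension has the same underlying module and connection as `M`, so the isomorphism is the
  -- identity map.
  · have hact : ∀ x : M.carrier,
        N.act ⟨q, Subgroup.subset_closure hq⟩ x = M.act ⟨q, Subgroup.subset_closure rfl⟩ x :=
      semilinear_ext (σ := sigma q) (b := b) (b' := b) (N.act_smul q hq) (M.act_smul q rfl)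
        ((hmat q (Subgroup.subset_closure hq)).trans hAq)
    refine ⟨⟨⟨⟨LinearMap.id, ?_⟩, fun _ => rfl⟩, ⟨⟨LinearMap.id, ?_⟩, fun _ => rfl⟩, rfl, rfl⟩⟩
    · rintro _ rfl x
      exact hact x
    · rintro _ rfl x
      exact (hact x).symm

/-- Confluence: an object of `σ_q-Mod^{[r]}` has a connection making it an object of
`(σ_q,δ_q)-Mod^{[r]}`. -/
theorem exists_sigmaDelta (hp : ‖(p : K)‖ < 1) (hr : r ≤ 1) (hq : ‖(q : K) - 1‖ < r)
    (hu : ¬ IsRootOfUnity q) {M : SigmaMod B K {q}} (hM : sigmaQProp r q M) :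
    ∃ N : SigmaDeltaMod B K {q}, N.toSigmaMod = M ∧ sigmaDeltaQProp r q N := by
  obtain ⟨n, b, hR⟩ := hM
  obtain ⟨G, hG, hS⟩ := exists_connection hp hr hq hu hR
  have e : matrixOf b (connectionOf b delta delta_add G) = G :=
    mapMat_connectionOf b delta delta_add delta_one G
  refine ⟨{ M with
    conn := connectionOf b delta delta_add G
    conn_smul := connectionOf_smul b delta delta_add delta_mul G }, rfl, n, b, ?_⟩
  have e' := congrArg (fun G' => RadiusCond B r q (dRay G') ∧ ∃ ε : ℝ, 0 < ε ∧ ε < 1 ∧ ∀ ρ ∈ B.I ε,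
      Solves ρ q (M.mat b q (Subgroup.subset_closure rfl)) (dTaylor G')) e
  exact e'.mpr ⟨hG, hS⟩

end Cocycles

/-! ### The equivalences -/

section Equivalences

variable {B : Base} {K : Type u} [NormedField K] [CompleteSpace K] [IsUltrametricDist K]
  [CharZero K] {p : ℕ} [Fact p.Prime] {r : ℝ} {q : Q K}

/-- The connection carries everything: a horizontal map commutes with every `σ_x` of the disk, which
gives fullness, and the connection alone generates the whole action, which gives essential
surjectivity. -/
theorem isEquivalence_resDeltaQ (hp : ‖(p : K)‖ < 1) (hr : r ≤ 1) (hq : ‖(q : K) - 1‖ < r) :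
    (resDeltaQ B r q hq).IsEquivalence where
  faithful := ⟨fun {M N} f g h => by
    have h1 := congrArg (fun f => f.hom.lin) h
    exact ObjectProperty.hom_ext _ (SigmaDeltaMod.Hom.ext h1)⟩
  full := ⟨fun {M N} f => by
    refine ⟨ObjectProperty.homMk ⟨⟨f.hom.lin, fun x hx => ?_⟩, f.hom.comm_conn⟩, rfl⟩
    exact comm_sigma_of_comm_conn hp hr hx (M.property.1 x hx) (N.property.1 x hx) f.hom.lin
      f.hom.comm_conn⟩
  essSurj := ⟨fun M => by
    obtain ⟨n, b, hR, ε, h0, h1, hS⟩ := M.property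
    obtain ⟨N, hN, -, ⟨e⟩⟩ := exists_extension hp hr hq M.obj b hR h0 h1 hS
    exact ⟨⟨N, hN⟩, ⟨ObjectProperty.isoMk _ e⟩⟩⟩

theorem isEquivalence_resQ (hp : ‖(p : K)‖ < 1) (hr : r ≤ 1) (hq : ‖(q : K) - 1‖ < r)
    (hu : ¬ IsRootOfUnity q) : (resQ B r q hq hu).IsEquivalence where
  faithful := ⟨fun {M N} f g h => by
    have h1 := congrArg (fun f => f.hom.lin) h
    exact ObjectProperty.hom_ext _ (SigmaMod.Hom.ext h1)⟩
  full := ⟨fun {M N} f => by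
    refine ⟨ObjectProperty.homMk ⟨f.hom.lin, fun x hx => ?_⟩, rfl⟩
    exact comm_sigma_of_comm_sigma hp hr hq hx hu M.property N.property f.hom.lin
      (f.hom.comm q rfl)⟩
  essSurj := ⟨fun M => by
    -- Without a given connection, confluence supplies one; it is deformed to the whole disk and
    -- then forgotten.
    obtain ⟨M', hM', n, b, hR, ε, h0, h1, hS⟩ := exists_sigmaDelta hp hr hq hu M.property
    obtain ⟨N, -, hN, ⟨e⟩⟩ := exists_extension hp hr hq M' b hR h0 h1 hS
    refine ⟨⟨N.toSigmaMod, hN⟩, ⟨ObjectProperty.isoMk _ ?_⟩⟩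
    exact (forgetDelta.mapIso e).trans (eqToIso hM')⟩

theorem sigmaQProp_forgetDelta (hp : ‖(p : K)‖ < 1) (hr : r ≤ 1) (hq : ‖(q : K) - 1‖ < r)
    (hu : ¬ IsRootOfUnity q) (M : SigmaDeltaQ B r q) :
    sigmaQProp r q (forgetDelta.obj M.obj) := by
  obtain ⟨n, b, hR, ε, h0, h1, hS⟩ := M.property
  exact ⟨n, b, hR.qRay_of_dRay hp hr hq hu h0 h1 hS⟩

/-- The connection is recovered from `σ_q` as the coefficient of `z` of the interpolation. Hence it
exists on every object and is respected by every morphism. -/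
theorem isEquivalence_forgetDeltaQ (hp : ‖(p : K)‖ < 1) (hr : r ≤ 1) (hq : ‖(q : K) - 1‖ < r)
    (hu : ¬ IsRootOfUnity q)
    (hf : ∀ M : SigmaDeltaQ B r q, sigmaQProp r q (forgetDelta.obj M.obj)) :
    (forgetDeltaQ B r q hf).IsEquivalence where
  faithful := ⟨fun {M N} f g h => by
    have h1 := congrArg (fun f => f.hom.lin) h
    exact ObjectProperty.hom_ext _ (SigmaDeltaMod.Hom.ext h1)⟩
  full := ⟨fun {M N} f => by
    refine ⟨ObjectProperty.homMk ⟨f.hom, fun x => ?_⟩, rfl⟩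
    exact comm_conn_of_comm_sigma hp hr hq hu M.property N.property f.hom.lin
      (f.hom.comm q rfl) x⟩
  essSurj := ⟨fun M => by
    obtain ⟨N, hN, hN'⟩ := exists_sigmaDelta hp hr hq hu M.property
    exact ⟨⟨N, hN'⟩, ⟨ObjectProperty.isoMk _ (eqToIso hN)⟩⟩⟩

theorem isEquivalence_deform {C D E : Type (u + 1)} [Category.{u} C] [Category.{u} D]
    [Category.{u} E] {F : C ⥤ D} (hF : F.IsEquivalence) {G : C ⥤ E} (hG : G.IsEquivalence) :
    (deform F hF G).IsEquivalence := by
  have := hF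
  have := hG
  exact inferInstanceAs (F.inv ⋙ G).IsEquivalence

end Equivalences
end QConf
open QConf in
theorem mainTheorem5 {K : Type u} [NormedField K] [CompleteSpace K] [IsUltrametricDist K]
    [CharZero K] (p : ℕ) [Fact p.Prime] (hp : ‖(p : K)‖ < 1) (B : Base) (r : ℝ) (hr : r ≤ 1) :
    (∀ (q q' : Q K) (hq : ‖(q : K) - 1‖ < r) (hq' : ‖(q' : K) - 1‖ < r)
        (hu : ¬ IsRootOfUnity q) (hu' : ¬ IsRootOfUnity q'),
      ∃ h : (resQ B r q hq hu).IsEquivalence,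
        (deform (resQ B r q hq hu) h (resQ B r q' hq' hu')).IsEquivalence) ∧
    (∀ (q q' : Q K) (hq : ‖(q : K) - 1‖ < r) (hq' : ‖(q' : K) - 1‖ < r),
      ∃ h : (resDeltaQ B r q hq).IsEquivalence,
        (deform (resDeltaQ B r q hq) h (resDeltaQ B r q' hq')).IsEquivalence) ∧
    (∀ (q : Q K) (hq : ‖(q : K) - 1‖ < r), ¬ IsRootOfUnity q →
      ∃ hf : ∀ M : SigmaDeltaQ B r q, sigmaQProp r q (forgetDelta.obj M.obj),
      ∃ he : (forgetDeltaQ B r q hf).IsEquivalence,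
      ∃ h : (resDeltaQ B r q hq).IsEquivalence,
        (deform (forgetDeltaQ B r q hf) he
          (deform (resDeltaQ B r q hq) h
            (resDeltaQ B r 1 (one_mem_disk hq)))).IsEquivalence) := by
  refine ⟨fun q q' hq hq' hu hu' => ?_, fun q q' hq hq' => ?_, fun q hq hu => ?_⟩
  · exact ⟨isEquivalence_resQ hp hr hq hu,
      isEquivalence_deform _ (isEquivalence_resQ hp hr hq' hu')⟩
  · exact ⟨isEquivalence_resDeltaQ hp hr hq,
      isEquivalence_deform _ (isEquivalence_resDeltaQ hp hr hq')⟩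
  · have hf := sigmaQProp_forgetDelta (B := B) hp hr hq hu
    exact ⟨hf, isEquivalence_forgetDeltaQ hp hr hq hu hf, isEquivalence_resDeltaQ hp hr hq,
      isEquivalence_deform _ (isEquivalence_deform _
        (isEquivalence_resDeltaQ hp hr (one_mem_disk hq)))⟩
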